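/- **Min-Max Selecting Items.** An instance consists of $n$ items, $K\ge 1$ scenarios $S$, each assigning a nonnegative integer cost $c_{S,i}$ to every item $i\in[n]$, and an integer $0\le p\le n$. The goal is to select a set $P\subseteq[n]$ with $|P|=p$ minimizing $\max_S c(P,S)$, where $c(P,S)=\sum_{i\in P}c_{S,i}$. For real $C\ge 0$ let $I_C=\{i\in[n] : c_{S,i}\le C \text{ for all } S\}$ and let $LP_C$ be the linear program $$\sum_{i\in I_C}x_i=p,\qquad \sum_{i\in I_C}c_{S,i}x_i\le C\ \text{ for all } S,\qquad x_i\in[0,1]\ \text{ for } i\in I_C .$$ **Theorem.** For $K\ge1$ let $\rho(K)=1+\dfrac{e\ln(2K)}{\ln(e\ln(2K))}$. There is a deterministic algorithm which, for every instance, runs in time polynomial in the bit length of the instance (on a random access machine with logarithmic cost) and outputs a set $P\subseteq[n]$ with $|P|=p$ such that $$c(P,S)\le C\,\rho(K)\quad\text{for every scenario } S,$$ where $C$ is the smallest real number $C\ge0$ for which $LP_C$ is feasible; this minimum exists and is at most the optimum $\min_{|Q|=p}\max_S c(Q,S)$. Consequently $\max_S c(P,S)\le\rho(K)\cdot\min_{|Q|=p}\max_S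 c(Q,S)$. Moreover $\rho(K)=O(\log K/\log\log K)$ as $K\to\infty$, so the algorithm has approximation ratio $O(\log K/\log\log K)$. -/

import Mathlib

open Filter Asymptotics

/-! ### The Min-Max Selecting Items problem -/

/-- An instance of Min-Max Selecting Items: `n` items, `K ≥ 1` scenarios, each assigning a
nonnegative integral cost to each item, and the number `p ≤ n` of items to be selected. -/
structure SelectingItems where
  n : ℕ
  K : ℕ
  p : ℕ
  cost : Fin K → Fin n → ℕ
  K_pos : 1 ≤ K
  p_le_n : p ≤ n

namespace SelectingItems

/-- The cost `c(P, S)` of the selection `P` in scenario `S`. -/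
def totalCost (I : SelectingItems) (P : Finset (Fin I.n)) (S : Fin I.K) : ℕ :=
  ∑ i ∈ P, I.cost S i

/-- The objective: the largest cost of `P` over all scenarios. -/
def maxCost (I : SelectingItems) (P : Finset (Fin I.n)) : ℕ :=
  Finset.univ.sup fun S => I.totalCost P S

open Classical in
/-- The set `I_C` of the items that cost at most `C` in every scenario. -/
noncomputable def cheapItems (I : SelectingItems) (C : ℝ) : Finset (Fin I.n) :=
  Finset.univ.filter fun i => ∀ S, (I.cost S i : ℝ) ≤ C

/-- The linear program `LP_C` has a solution. Its variables are the `x i` with `i ∈ I_C`; the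
other coordinates of `x` occur in no constraint. -/
def LPFeasible (I : SelectingItems) (C : ℝ) : Prop :=
  ∃ x : Fin I.n → ℝ,
    ∑ i ∈ I.cheapItems C, x i = (I.p : ℝ) ∧
    (∀ S, ∑ i ∈ I.cheapItems C, (I.cost S i : ℝ) * x i ≤ C) ∧
    ∀ i ∈ I.cheapItems C, 0 ≤ x i ∧ x i ≤ 1

end SelectingItems

/-- The factor `1 + e ln(2K) / ln(e ln(2K))`. -/
noncomputable def roundingRatio (K : ℕ) : ℝ :=
  1 + Real.exp 1 * Real.log (2 * K) / Real.log (Real.exp 1 * Real.log (2 * K))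

/-! ### Random access machines with logarithmic cost -/

namespace RAM

/-- The bit length charged for a number (at least one, also for `0`). -/
def bits (a : ℕ) : ℕ := Nat.size a + 1

/-- The memory: register `a` holds the natural number `M a`. -/
abbrev Memory := ℕ → ℕ

/-- The arithmetic operations; `sub` is truncated at `0`, `div` rounds down, and division by zero
gives `0`. -/
inductive Op
  | add
  | sub
  | mul
  | div

/-- The value of an arithmetic operation. -/
def Op.eval : Op → ℕ → ℕ → ℕ
  | .add, a, b => a + b
  | .sub, a, b => a - b
  | .mul, a, b => a * b
  | .div, a, b => a / b

/-- Programs of a random access machine, with structured control flow.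
* `const r k`: `M[r] := k`
* `arith o r s t`: `M[r] := M[s] o M[t]`
* `load r s`: `M[r] := M[M[s]]`
* `store r s`: `M[M[r]] := M[s]`
* `seq a b`: first `a`, then `b`
* `ite r a b`: `a` if `M[r] ≠ 0`, and `b` otherwise
* `loop r a`: while `M[r] ≠ 0`, repeat `a` -/
inductive Program
  | const (r k : ℕ)
  | arith (o : Op) (r s t : ℕ)
  | load (r s : ℕ)
  | store (r s : ℕ)
  | seq (a b : Program)
  | ite (r : ℕ) (a b : Program)
  | loop (r : ℕ) (a : Program)

/-- `Exec A M M' t`: started in memory `M`, the program `A` halts with memory `M'`, and the run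
takes time `t` under the logarithmic cost criterion. Each executed instruction and each test is
charged the bit lengths of all addresses and of all values that it reads or writes. -/
inductive Exec : Program → Memory → Memory → ℕ → Prop
  | const (r k : ℕ) (M : Memory) :
      Exec (.const r k) M (Function.update M r k) (bits r + bits k)
  | arith (o : Op) (r s t : ℕ) (M : Memory) :
      Exec (.arith o r s t) M (Function.update M r (o.eval (M s) (M t)))
        (bits r + bits s + bits t + bits (M s) + bits (M t) + bits (o.eval (M s) (M t)))
  | load (r s : ℕ) (M : Memory) :
      Exec (.load r s) M (Function.update M r (M (M s)))
        (bits r + bits s + bits (M s) + bits (M (M s)))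
  | store (r s : ℕ) (M : Memory) :
      Exec (.store r s) M (Function.update M (M r) (M s))
        (bits r + bits s + bits (M r) + bits (M s))
  | seq {a b : Program} {M M₁ M₂ : Memory} {t₁ t₂ : ℕ} :
      Exec a M M₁ t₁ → Exec b M₁ M₂ t₂ → Exec (.seq a b) M M₂ (t₁ + t₂)
  | ite_then {r : ℕ} {a b : Program} {M M₁ : Memory} {t : ℕ} :
      M r ≠ 0 → Exec a M M₁ t → Exec (.ite r a b) M M₁ (bits r + bits (M r) + t)
  | ite_else {r : ℕ} {a b : Program} {M M₁ : Memory} {t : ℕ} :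
      M r = 0 → Exec b M M₁ t → Exec (.ite r a b) M M₁ (bits r + bits (M r) + t)
  | loop_exit {r : ℕ} {a : Program} {M : Memory} :
      M r = 0 → Exec (.loop r a) M M (bits r + bits (M r))
  | loop_step {r : ℕ} {a : Program} {M M₁ M₂ : Memory} {t₁ t₂ : ℕ} :
      M r ≠ 0 → Exec a M M₁ t₁ → Exec (.loop r a) M₁ M₂ t₂ →
        Exec (.loop r a) M M₂ (bits r + bits (M r) + t₁ + t₂)

/-- Programs are deterministic: the initial memory determines the result and the running time. -/
theorem Exec.deterministic {A : Program} {M M₁ M₂ : Memory} {t₁ t₂ : ℕ}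
    (h₁ : Exec A M M₁ t₁) (h₂ : Exec A M M₂ t₂) : M₁ = M₂ ∧ t₁ = t₂ := by
  induction h₁ generalizing M₂ t₂ with
  | const r k M => cases h₂; exact ⟨rfl, rfl⟩
  | arith o r s t M => cases h₂; exact ⟨rfl, rfl⟩
  | load r s M => cases h₂; exact ⟨rfl, rfl⟩
  | store r s M => cases h₂; exact ⟨rfl, rfl⟩
  | seq _ _ iha ihb =>
    cases h₂ with
    | seq ha hb =>
      obtain ⟨rfl, rfl⟩ := iha ha
      obtain ⟨rfl, rfl⟩ := ihb hb
      exact ⟨rfl, rfl⟩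
  | ite_then hr _ ih =>
    cases h₂ with
    | ite_then _ h => obtain ⟨rfl, rfl⟩ := ih h; exact ⟨rfl, rfl⟩
    | ite_else hr' _ => exact absurd hr' hr
  | ite_else hr _ ih =>
    cases h₂ with
    | ite_then hr' _ => exact absurd hr hr'
    | ite_else _ h => obtain ⟨rfl, rfl⟩ := ih h; exact ⟨rfl, rfl⟩
  | loop_exit hr =>
    cases h₂ with
    | loop_exit _ => exact ⟨rfl, rfl⟩
    | loop_step hr' _ _ => exact absurd hr hr'
  | loop_step hr _ _ iha ihb =>
    cases h₂ with
    | loop_exit hr' => exact absurd hr' hr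
    | loop_step _ ha hb =>
      obtain ⟨rfl, rfl⟩ := iha ha
      obtain ⟨rfl, rfl⟩ := ihb hb
      exact ⟨rfl, rfl⟩

end RAM

namespace SelectingItems

/-- The sequence of the numbers in the input: `n, K, p`, and then, at position
`3 + (i + n * S)`, the cost of item `i` in scenario `S` (items and scenarios are numbered from
`0`); it is continued by zeros. -/
def inputWord (I : SelectingItems) (a : ℕ) : ℕ :=
  if a = 0 then I.n
  else if a = 1 then I.K
  else if a = 2 then I.p
  else if h : a - 3 < I.K * I.n then
    I.cost (finProdFinEquiv.symm ⟨a - 3, h⟩).1 (finProdFinEquiv.symm ⟨a - 3, h⟩).2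
  else 0

/-- The initial memory: the even registers `0, 2, 4, …` hold the input sequence, and the odd
registers, which are free for the computation, hold `0`. -/
def inputMemory (I : SelectingItems) : RAM.Memory := fun r =>
  if r % 2 = 0 then I.inputWord (r / 2) else 0

/-- The input length: the number of bits of all numbers in the input, written in binary. -/
def inputLength (I : SelectingItems) : ℕ :=
  RAM.bits I.n + RAM.bits I.K + RAM.bits I.p + ∑ S, ∑ i, RAM.bits (I.cost S i)

/-- The output, read from the even registers after the machine has halted: item `i` is selected
if register `2 * i` holds `1`. -/
def outputSet (I : SelectingItems) (M : RAM.Memory) : Finset (Fin I.n) :=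
  Finset.univ.filter fun i => M (2 * i) = 1

end SelectingItems

/-!
# Approximation of Min-Max Selecting Items by local search

The program does not solve the linear program; its solutions only occur in the analysis of a local
search. For a guess of the value `C` and an index `m`, the search starts from any `p` items of
cost at most `C` in every scenario, and exchanges selected items for other such items as long as
this noticeably lowers the potential `∑ S, φ (z S)`. Here `z S` is the cost in scenario `S`,
measured in units of `C`, and `φ = penalty m` is the convex function
`2 F 1 + ∑ k ∈ [2, m + 2], F k / (k - 1)` of truncated falling factorials
`F k z = z (z - 1) ⋯ (z - k + 1)`, with `F = fall`.

Let `ξ` be a solution of the linear program. In a local optimum, averaging over the exchanges of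
`i` for `j` with weights `(1 - ξ i) ξ j` shows (`sum_drift_le`) that the sum over all scenarios of
the drift `z (φ z - φ (z - 1)) - (φ (z + 1) - φ z)` is at most a tiny multiple of the potential.
Because of `z F k (z - 1) = F (k + 1) z` and `F k (z + 1) = (z + 1) F (k - 1) z`, the drift
telescopes. It is never below `-9/4`, and it is at least `F (m + 2) z - 9/4` for `z ≥ m + 2`
(`drift_penalty`). Hence `F (m + 2) z` is bounded by a little more than `9 K / 4` for the largest
load `z` (`fall_load_le`). On the other hand, `log (F (m + 2) R)` is about `R log R - R` if
`m + 2` is just below `R`, and the choice of the constant `e` in the ratio makes this larger than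
`log (2 K)` by a sufficient amount for `R = roundingRatio K / 1.01` (`exists_fall_gt`). So all
loads are below `R`.

The guesses run through a sequence that grows by about half a percent in each step, so that one of
them exceeds the smallest value `C` by at most one percent if `C ≥ 1`. By integrality of the
costs, the only other case is `C = 0`, and the first guess then admits the same items. All
`m < 3 K` are tried, and the best selection is returned (`best_le`). Accepted exchanges lower the
potential, an integer with polynomially many bits, by a factor `1 - 1 / Q` with polynomial `Q`, so
that each search makes polynomially many of them (`exists_energy`).

For the random access machine, a small language with variables, arrays, loops and expressions is
compiled to machine programs. The relation `RAM.Does` counts instructions, and bounds their cost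
by the length of the largest number that occurs; its rules are total-correctness rules for the
constructs of the language.
-/

/-! ### States and their representation in memory -/

namespace RAM

/-- The scalar variables of the program. -/
inductive Var
  | n | K | p | C | m | q | tot | best | lim | cnt | i | j | k | S | z | w | f | g | flag | mx | cur

/-- The arrays of the program. -/
inductive Arr
  | inp | x | y | mc

/-- The state of the program on the level of variables and arrays.
* `inp` is the input sequence, and later the output; `x` is the current and `y` the best known
  selection; `mc i` is the largest cost of item `i` over all scenarios.
* `n`, `K`, `p` are copied from the input. `tot` is the sum of `mc`, `lim` the end of the guesses,
  `C` the current guess for 200 times the value of the linear program, `m` the index of the current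
  potential, and `q` the resolution of the local search.
* `best` and `mx` are the largest costs of `y` and of `x` over all scenarios, `cur` and `g` the
  potentials before and after an exchange, `cnt` the number of selected items, and `flag` records
  whether an exchange was made.
* `i`, `j`, `k`, `S` are loop counters, and `z`, `w`, `f` are used to evaluate the potential. -/
structure St where
  inp : ℕ → ℕ
  x : ℕ → ℕ
  y : ℕ → ℕ
  mc : ℕ → ℕ
  n : ℕ
  K : ℕ
  p : ℕ
  C : ℕ
  m : ℕ
  q : ℕ
  tot : ℕ
  best : ℕ
  lim : ℕ
  cnt : ℕ
  i : ℕ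
  j : ℕ
  k : ℕ
  S : ℕ
  z : ℕ
  w : ℕ
  f : ℕ
  g : ℕ
  flag : ℕ
  mx : ℕ
  cur : ℕ

/-- The number of a variable. -/
def Var.idx : Var → ℕ
  | .n => 0 | .K => 1 | .p => 2 | .C => 3 | .m => 4 | .q => 5 | .tot => 6 | .best => 7
  | .lim => 8 | .cnt => 9 | .i => 10 | .j => 11 | .k => 12 | .S => 13 | .z => 14 | .w => 15
  | .f => 16 | .g => 17 | .flag => 18 | .mx => 19 | .cur => 20

/-- The value of a variable. -/
def St.get (σ : St) : Var → ℕ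
  | .n => σ.n | .K => σ.K | .p => σ.p | .C => σ.C | .m => σ.m | .q => σ.q | .tot => σ.tot
  | .best => σ.best | .lim => σ.lim | .cnt => σ.cnt | .i => σ.i | .j => σ.j | .k => σ.k
  | .S => σ.S | .z => σ.z | .w => σ.w | .f => σ.f | .g => σ.g | .flag => σ.flag | .mx => σ.mx
  | .cur => σ.cur

/-- The state after the assignment of `a` to a variable. -/
def St.set (σ : St) (a : ℕ) : Var → St
  | .n => { σ with n := a } | .K => { σ with K := a } | .p => { σ with p := a }
  | .C => { σ with C := a } | .m => { σ with m := a } | .q => { σ with q := a }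
  | .tot => { σ with tot := a } | .best => { σ with best := a } | .lim => { σ with lim := a }
  | .cnt => { σ with cnt := a } | .i => { σ with i := a } | .j => { σ with j := a }
  | .k => { σ with k := a } | .S => { σ with S := a } | .z => { σ with z := a }
  | .w => { σ with w := a } | .f => { σ with f := a } | .g => { σ with g := a }
  | .flag => { σ with flag := a } | .mx => { σ with mx := a }
  | .cur => { σ with cur := a }

/-- The contents of an array. -/
def St.arr (σ : St) : Arr → ℕ → ℕ
  | .inp => σ.inp | .x => σ.x | .y => σ.y | .mc => σ.mc

/-- The state after `a` has been written to position `l` of an array. -/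
def St.write (σ : St) (l a : ℕ) : Arr → St
  | .inp => { σ with inp := Function.update σ.inp l a }
  | .x => { σ with x := Function.update σ.x l a }
  | .y => { σ with y := Function.update σ.y l a }
  | .mc => { σ with mc := Function.update σ.mc l a }

/-- The distance between the registers of consecutive entries of an array. -/
def Arr.scale : Arr → ℕ
  | .inp => 2 | _ => 8

/-- The register of the first entry of an array. The input occupies the even registers, and the
other arrays the residue classes `3`, `5`, `7` modulo `8`. -/
def Arr.base : Arr → ℕ
  | .inp => 0 | .x => 3 | .y => 5 | .mc => 7

/-- The register of a variable. Variables and temporary registers share the residue class `1`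
modulo `8`. -/
def Var.addr (v : Var) : ℕ := 8 * v.idx + 1

/-- The temporary registers, a stack on which expressions are evaluated. -/
def tmp (d : ℕ) : ℕ := 8 * (32 + d) + 1

/-- The memory `M` represents the state `σ`; temporary registers may hold anything. -/
def Rep (M : Memory) (σ : St) : Prop :=
  (∀ v : Var, M v.addr = σ.get v) ∧ ∀ (A : Arr) (l : ℕ), M (A.scale * l + A.base) = σ.arr A l

theorem Var.idx_lt (v : Var) : v.idx < 32 := by cases v <;> decide

theorem Var.idx_inj {v v' : Var} (h : v.idx = v'.idx) : v = v' := by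
  cases v <;> cases v' <;> first | rfl | (exact absurd h (by decide))

theorem Var.get_set (σ : St) (a : ℕ) {v v' : Var} (h : v ≠ v') : (σ.set a v).get v' = σ.get v' := by
  cases v <;> cases v' <;> first | rfl | (exact absurd rfl h)

theorem Rep.tmp {M : Memory} {σ : St} (h : Rep M σ) (d a : ℕ) :
    Rep (Function.update M (tmp d) a) σ := by
  refine ⟨fun v => ?_, fun A l => ?_⟩
  · rw [Function.update_of_ne, h.1]
    have := v.idx_lt
    unfold Var.addr RAM.tmp; omega
  · rw [Function.update_of_ne, h.2]
    unfold RAM.tmp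
    cases A <;> simp only [Arr.scale, Arr.base] <;> omega

theorem Rep.set {M : Memory} {σ : St} (h : Rep M σ) (v : Var) (a : ℕ) :
    Rep (Function.update M v.addr a) (σ.set a v) := by
  refine ⟨fun v' => ?_, fun A l => ?_⟩
  · by_cases hv : v = v'
    · subst hv
      rw [Function.update_self]
      cases v <;> rfl
    · rw [Function.update_of_ne, h.1, Var.get_set _ _ hv]
      intro e
      unfold Var.addr at e
      exact hv (Var.idx_inj (by omega))
  · rw [Function.update_of_ne, h.2]
    · cases v <;> rfl
    · unfold Var.addr
      cases A <;> simp only [Arr.scale, Arr.base] <;> omega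

theorem Rep.write {M : Memory} {σ : St} (h : Rep M σ) (A : Arr) (l a : ℕ) :
    Rep (Function.update M (A.scale * l + A.base) a) (σ.write l a A) := by
  refine ⟨fun v' => ?_, fun A' l' => ?_⟩
  · rw [Function.update_of_ne, h.1]
    · cases A <;> cases v' <;> rfl
    · unfold Var.addr
      cases A <;> simp only [Arr.scale, Arr.base] <;> omega
  · by_cases hA : A'.scale * l' + A'.base = A.scale * l + A.base
    · have : A' = A ∧ l' = l := by
        cases A <;> cases A' <;> simp only [Arr.scale, Arr.base] at hA <;>
          first | exact ⟨rfl, by omega⟩ | omega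
      obtain ⟨rfl, rfl⟩ := this
      rw [Function.update_self]
      cases A' <;> simp [St.arr, St.write]
    · rw [Function.update_of_ne hA, h.2]
      cases A <;> cases A' <;> first
        | rfl
        | (simp only [Arr.scale, Arr.base] at hA
           simp only [St.arr, St.write]
           rw [Function.update_of_ne (by omega)])

/-! ### Expressions -/

/-- Arithmetic expressions in variables and array entries. -/
inductive Expr
  | lit (k : ℕ)
  | var (v : Var)
  | bin (o : Op) (a b : Expr)
  | read (A : Arr) (a : Expr)

namespace Expr

instance : Add Expr := ⟨bin .add⟩
instance : Sub Expr := ⟨bin .sub⟩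
instance : Mul Expr := ⟨bin .mul⟩
instance : Div Expr := ⟨bin .div⟩
instance : Coe Var Expr := ⟨var⟩

/-- The value of an expression. -/
def eval (σ : St) : Expr → ℕ
  | lit k => k
  | var v => σ.get v
  | bin o a b => o.eval (a.eval σ) (b.eval σ)
  | read A a => σ.arr A (a.eval σ)

/-- The number of instructions in the code for an expression. -/
def size : Expr → ℕ
  | lit _ => 1
  | var _ => 2
  | bin _ a b => a.size + b.size + 1
  | read _ a => a.size + 5

/-- No number that occurs in the evaluation of an expression exceeds `B`; this includes the
register addresses `8 * l + 7` of array entries. -/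
def Bdd (B : ℕ) (σ : St) : Expr → Prop
  | lit k => k ≤ B
  | var v => σ.get v ≤ B
  | bin .add a b => a.Bdd B σ ∧ b.Bdd B σ ∧ a.eval σ + b.eval σ ≤ B
  | bin .sub a b => a.Bdd B σ ∧ b.Bdd B σ
  | bin .mul a b => a.Bdd B σ ∧ b.Bdd B σ ∧ a.eval σ * b.eval σ ≤ B
  | bin .div a b => a.Bdd B σ ∧ b.Bdd B σ
  | read A a => a.Bdd B σ ∧ 8 * a.eval σ + 8 ≤ B ∧ σ.arr A (a.eval σ) ≤ B

/-- Replaces an array position on top of the stack by its register. -/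
def toAddr (A : Arr) (d : ℕ) : Program :=
  .seq (.const (tmp (d + 1)) A.scale) (.seq (.arith .mul (tmp d) (tmp d) (tmp (d + 1)))
    (.seq (.const (tmp (d + 1)) A.base) (.arith .add (tmp d) (tmp d) (tmp (d + 1)))))

/-- Code that leaves the value of an expression in `tmp d` and preserves the stack below. -/
def compile : Expr → ℕ → Program
  | lit k, d => .const (tmp d) k
  | var v, d => .seq (.const (tmp d) 0) (.arith .add (tmp d) v.addr (tmp d))
  | bin o a b, d => .seq (a.compile d) (.seq (b.compile (d + 1))
      (.arith o (tmp d) (tmp d) (tmp (d + 1))))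
  | read A a, d => .seq (a.compile d) (.seq (toAddr A d) (.load (tmp d) (tmp d)))

section
variable (B k : ℕ) (σ : St) (v : Var) (A : Arr) (a b : Expr)

@[simp] theorem eval_add : (a + b).eval σ = a.eval σ + b.eval σ := rfl
@[simp] theorem eval_sub : (a - b).eval σ = a.eval σ - b.eval σ := rfl
@[simp] theorem eval_mul : (a * b).eval σ = a.eval σ * b.eval σ := rfl
@[simp] theorem eval_div : (a / b).eval σ = a.eval σ / b.eval σ := rfl
@[simp] theorem eval_lit : (lit k).eval σ = k := rfl
@[simp] theorem eval_var : (var v).eval σ = σ.get v := rfl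
@[simp] theorem eval_read : (read A a).eval σ = σ.arr A (a.eval σ) := rfl
@[simp] theorem size_add : (a + b).size = a.size + b.size + 1 := rfl
@[simp] theorem size_sub : (a - b).size = a.size + b.size + 1 := rfl
@[simp] theorem size_mul : (a * b).size = a.size + b.size + 1 := rfl
@[simp] theorem size_div : (a / b).size = a.size + b.size + 1 := rfl
@[simp] theorem size_lit : (lit k).size = 1 := rfl
@[simp] theorem size_var : (var v).size = 2 := rfl
@[simp] theorem size_read : (read A a).size = a.size + 5 := rfl
@[simp] theorem bdd_add : (a + b).Bdd B σ ↔
    a.Bdd B σ ∧ b.Bdd B σ ∧ a.eval σ + b.eval σ ≤ B := Iff.rfl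
@[simp] theorem bdd_sub : (a - b).Bdd B σ ↔ a.Bdd B σ ∧ b.Bdd B σ := Iff.rfl
@[simp] theorem bdd_mul : (a * b).Bdd B σ ↔
    a.Bdd B σ ∧ b.Bdd B σ ∧ a.eval σ * b.eval σ ≤ B := Iff.rfl
@[simp] theorem bdd_div : (a / b).Bdd B σ ↔ a.Bdd B σ ∧ b.Bdd B σ := Iff.rfl
@[simp] theorem bdd_lit : (lit k).Bdd B σ ↔ k ≤ B := Iff.rfl
@[simp] theorem bdd_var : (var v).Bdd B σ ↔ σ.get v ≤ B := Iff.rfl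
@[simp] theorem bdd_read : (read A a).Bdd B σ ↔
    a.Bdd B σ ∧ 8 * a.eval σ + 8 ≤ B ∧ σ.arr A (a.eval σ) ≤ B := Iff.rfl

end

theorem eval_le {B : ℕ} {σ : St} : ∀ {e : Expr}, e.Bdd B σ → e.eval σ ≤ B
  | lit _, h => h
  | var _, h => h
  | bin .add _ _, h => h.2.2
  | bin .mul _ _, h => h.2.2
  | bin .sub _ _, h => (Nat.sub_le _ _).trans (eval_le h.1)
  | bin .div _ _, h => (Nat.div_le_self _ _).trans (eval_le h.1)
  | read _ _, h => h.2.2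

theorem bin_left {B : ℕ} {σ : St} {o : Op} {a b : Expr} (h : (bin o a b).Bdd B σ) :
    a.Bdd B σ := by
  cases o <;> exact h.1

theorem bin_right {B : ℕ} {σ : St} {o : Op} {a b : Expr} (h : (bin o a b).Bdd B σ) :
    b.Bdd B σ := by
  cases o
  exacts [h.2.1, h.2, h.2.1, h.2]

end Expr

theorem bits_mono {a b : ℕ} (h : a ≤ b) : bits a ≤ bits b :=
  Nat.succ_le_succ (Nat.size_le_size h)

theorem toAddr_spec {B : ℕ} (A : Arr) (d l : ℕ) {M : Memory} {σ : St} (h : Rep M σ)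
    (hd : 8 * (34 + d) ≤ B) (hl : M (tmp d) = l) (hb : 8 * l + 8 ≤ B) :
    ∃ M' t, Exec (Expr.toAddr A d) M M' t ∧ t ≤ 4 * (6 * bits B) ∧ Rep M' σ ∧
      M' (tmp d) = A.scale * l + A.base ∧ ∀ d' < d, M' (tmp d') = M (tmp d') := by
  have hsc : A.scale ≤ 8 := by cases A <;> decide
  have hba : A.base ≤ 8 := by cases A <;> decide
  have hne : tmp d ≠ tmp (d + 1) := by unfold tmp; omega
  have hm : A.scale * l + A.base ≤ 8 * l + 8 := by
    cases A <;> simp only [Arr.scale, Arr.base] <;> omega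
  refine ⟨_, _, .seq (.const _ _ _) (.seq (.arith _ _ _ _ _) (.seq (.const _ _ _)
    (.arith _ _ _ _ _))), ?_, (((h.tmp _ _).tmp _ _).tmp _ _).tmp _ _, ?_, ?_⟩
  · have b1 : bits (tmp d) ≤ bits B := bits_mono (by unfold tmp; omega)
    have b2 : bits (tmp (d + 1)) ≤ bits B := bits_mono (by unfold tmp; omega)
    have b3 : bits A.scale ≤ bits B := bits_mono (by omega)
    have b4 : bits A.base ≤ bits B := bits_mono (by omega)
    have b5 : bits (l * A.scale) ≤ bits B := bits_mono (by rw [mul_comm]; omega)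
    have b6 : bits (l * A.scale + A.base) ≤ bits B := bits_mono (by rw [mul_comm]; omega)
    have b7 : bits l ≤ bits B := bits_mono (by omega)
    simp only [Function.update_self, Function.update_of_ne hne,
      Op.eval, hl]
    omega
  · simp [Function.update_of_ne hne, Op.eval, hl, mul_comm]
  · intro d' hd'
    have h1 : tmp d' ≠ tmp d := by unfold tmp; omega
    have h2 : tmp d' ≠ tmp (d + 1) := by unfold tmp; omega
    simp [Function.update_of_ne h1, Function.update_of_ne h2]

theorem Expr.compile_spec {B : ℕ} {σ : St} : ∀ (e : Expr) (d : ℕ) (M : Memory), Rep M σ →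
    e.Bdd B σ → 8 * (34 + d + e.size) ≤ B →
    ∃ M' t, Exec (e.compile d) M M' t ∧ t ≤ e.size * (6 * bits B) ∧ Rep M' σ ∧
      M' (tmp d) = e.eval σ ∧ ∀ d' < d, M' (tmp d') = M (tmp d')
  | lit k, d, M, h, hb, hd => by
    refine ⟨_, _, .const _ _ _, ?_, h.tmp _ _, by simp [eval], fun d' hd' => ?_⟩
    · have b1 : bits (tmp d) ≤ bits B := bits_mono (by unfold tmp; omega)
      have b2 : bits k ≤ bits B := bits_mono hb
      simp only [size]; omega
    · have h1 : tmp d' ≠ tmp d := by unfold tmp; omega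
      simp [Function.update_of_ne h1]
  | var v, d, M, h, hb, hd => by
    have hne : v.addr ≠ tmp d := by have := v.idx_lt; unfold tmp Var.addr; omega
    refine ⟨_, _, .seq (.const _ _ _) (.arith _ _ _ _ _), ?_, (h.tmp _ _).tmp _ _, ?_,
      fun d' hd' => ?_⟩
    · have b1 : bits (tmp d) ≤ bits B := bits_mono (by unfold tmp; omega)
      have b2 : bits v.addr ≤ bits B :=
        bits_mono (by have := v.idx_lt; unfold Var.addr; omega)
      have b3 : bits (σ.get v) ≤ bits B := bits_mono hb
      have b4 : bits 0 ≤ bits B := bits_mono (by omega)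
      simp only [Function.update_self, Function.update_of_ne hne, Op.eval, h.1, add_zero, size]
      omega
    · simp [Function.update_of_ne hne, Op.eval, h.1, eval]
    · have h1 : tmp d' ≠ tmp d := by unfold tmp; omega
      simp [Function.update_of_ne h1]
  | bin o a b, d, M, h, hb, hd => by
    simp only [size] at hd
    obtain ⟨M₁, t₁, e₁, ht₁, r₁, v₁, f₁⟩ := compile_spec a d M h (bin_left hb) (by omega)
    obtain ⟨M₂, t₂, e₂, ht₂, r₂, v₂, f₂⟩ :=
      compile_spec b (d + 1) M₁ r₁ (bin_right hb) (by omega)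
    have v₁' : M₂ (tmp d) = a.eval σ := by rw [f₂ d (by omega), v₁]
    refine ⟨_, _, .seq e₁ (.seq e₂ (.arith _ _ _ _ _)), ?_, r₂.tmp _ _, ?_, fun d' hd' => ?_⟩
    · have b1 : bits (tmp d) ≤ bits B := bits_mono (by unfold tmp; omega)
      have b2 : bits (tmp (d + 1)) ≤ bits B := bits_mono (by unfold tmp; omega)
      have b3 : bits (a.eval σ) ≤ bits B := bits_mono (eval_le (bin_left hb))
      have b4 : bits (b.eval σ) ≤ bits B := bits_mono (eval_le (bin_right hb))
      have b5 : bits (o.eval (a.eval σ) (b.eval σ)) ≤ bits B := bits_mono (eval_le hb)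
      rw [v₁', v₂]
      simp only [size, add_mul]
      omega
    · simp [v₁', v₂, eval]
    · have h1 : tmp d' ≠ tmp d := by unfold tmp; omega
      rw [Function.update_of_ne h1, f₂ _ (by omega), f₁ _ hd']
  | read A a, d, M, h, hb, hd => by
    simp only [size] at hd
    obtain ⟨M₁, t₁, e₁, ht₁, r₁, v₁, f₁⟩ := compile_spec a d M h hb.1 (by omega)
    obtain ⟨M₂, t₂, e₂, ht₂, r₂, v₂, f₂⟩ := toAddr_spec A d _ r₁ (by omega) v₁ hb.2.1
    refine ⟨_, _, .seq e₁ (.seq e₂ (.load _ _ _)), ?_, r₂.tmp _ _, ?_, fun d' hd' => ?_⟩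
    · have b1 : bits (tmp d) ≤ bits B := bits_mono (by unfold tmp; omega)
      have b3 : bits (A.scale * a.eval σ + A.base) ≤ bits B := bits_mono (by
        have := hb.2.1
        cases A <;> simp only [Arr.scale, Arr.base] <;> omega)
      have b4 : bits (σ.arr A (a.eval σ)) ≤ bits B := bits_mono hb.2.2
      rw [v₂, r₂.2]
      simp only [size, add_mul]
      omega
    · simp [v₂, r₂.2, eval]
    · have h1 : tmp d' ≠ tmp d := by unfold tmp; omega
      rw [Function.update_of_ne h1, f₂ _ hd', f₁ _ hd']

/-! ### Structured programs and their running time -/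

/-- Total correctness with time: from every representation of `σ`, the program reaches one of `σ'`
within the time of `n` instructions. An instruction touches at most six numbers, and none of them
exceeds `B`. -/
def Does (B : ℕ) (A : Program) (σ : St) (n : ℕ) (σ' : St) : Prop :=
  ∀ M, Rep M σ → ∃ M' t, Exec A M M' t ∧ t ≤ n * (6 * bits B) ∧ Rep M' σ'

/-- `v := e` -/
def assign (v : Var) (e : Expr) : Program :=
  .seq (e.compile 0) (.seq (.const (tmp 1) 0) (.arith .add v.addr (tmp 0) (tmp 1)))

/-- `A[a] := e` -/
def writeArr (A : Arr) (a e : Expr) : Program :=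
  .seq (a.compile 0) (.seq (Expr.toAddr A 0) (.seq (e.compile 1) (.store (tmp 0) (tmp 1))))

/-- `if e ≠ 0 then a else b` -/
def cond (e : Expr) (a b : Program) : Program := .seq (e.compile 0) (.ite (tmp 0) a b)

/-- `while e ≠ 0 do a` -/
def whileDo (e : Expr) (a : Program) : Program :=
  .seq (e.compile 0) (.loop (tmp 0) (.seq a (e.compile 0)))

/-- An instruction without effect on the state. -/
def skip : Program := .const (tmp 0) 0

/-- `for v = 0, 1, …` as long as `v < e`; afterwards, `v` is reset to `0`. -/
def forLt (v : Var) (e : Expr) (a : Program) : Program :=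
  .seq (assign v (.lit 0)) (.seq
    (whileDo (.bin .sub e (.var v)) (.seq a (assign v (.bin .add (.var v) (.lit 1)))))
    (assign v (.lit 0)))

theorem Does.mono {B : ℕ} {A : Program} {σ σ' : St} {n n' : ℕ} (h : Does B A σ n σ')
    (hn : n ≤ n') : Does B A σ n' σ' := fun M r =>
  let ⟨M', t, e, ht, r'⟩ := h M r
  ⟨M', t, e, ht.trans (Nat.mul_le_mul_right _ hn), r'⟩

theorem Does.seq {B : ℕ} {A A' : Program} {σ σ' σ'' : St} {n n' : ℕ} (h : Does B A σ n σ')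
    (h' : Does B A' σ' n' σ'') : Does B (.seq A A') σ (n + n') σ'' := fun M r =>
  let ⟨M', t, e, ht, r'⟩ := h M r
  let ⟨M'', t', e', ht', r''⟩ := h' M' r'
  ⟨M'', t + t', .seq e e', by rw [add_mul]; omega, r''⟩

theorem Does.skip {B : ℕ} (σ : St) (hB : 300 ≤ B) : Does B skip σ 1 σ := fun M r =>
  ⟨_, _, .const _ _ _, by
    have b1 : bits (tmp 0) ≤ bits B := bits_mono (by unfold tmp; omega)
    have b2 : bits 0 ≤ bits B := bits_mono (by omega)
    omega, r.tmp _ _⟩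

theorem Does.assign {B : ℕ} (σ : St) (v : Var) (e : Expr) (hb : e.Bdd B σ)
    (hs : 8 * (35 + e.size) ≤ B) : Does B (assign v e) σ (e.size + 2) (σ.set (e.eval σ) v) := by
  intro M r
  obtain ⟨M₁, t₁, e₁, ht₁, r₁, v₁, -⟩ := e.compile_spec 0 M r hb (by omega)
  have hne : tmp 0 ≠ tmp 1 := by decide
  refine ⟨_, _, .seq e₁ (.seq (.const _ _ _) (.arith _ _ _ _ _)), ?_, ?_⟩
  · have b1 : bits (tmp 0) ≤ bits B := bits_mono (by unfold tmp; omega)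
    have b2 : bits (tmp 1) ≤ bits B := bits_mono (by unfold tmp; omega)
    have b3 : bits (e.eval σ) ≤ bits B := bits_mono (Expr.eval_le hb)
    have b4 : bits v.addr ≤ bits B :=
      bits_mono (by have := v.idx_lt; unfold Var.addr; omega)
    have b5 : bits 0 ≤ bits B := bits_mono (by omega)
    simp only [Function.update_self, Function.update_of_ne hne, v₁, Op.eval, add_zero, add_mul]
    omega
  · have := (r₁.tmp 1 0).set v (e.eval σ)
    simpa only [Function.update_self, Function.update_of_ne hne, v₁, Op.eval, add_zero] using this

theorem Does.assign_eq {B n : ℕ} {σ σ' : St} {v : Var} {e : Expr} (hb : e.Bdd B σ)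
    (hs : 8 * (35 + e.size) ≤ B) (hn : e.size + 2 ≤ n) (h : σ.set (e.eval σ) v = σ') :
    Does B (RAM.assign v e) σ n σ' := h ▸ (Does.assign σ v e hb hs).mono hn

theorem Does.write {B : ℕ} (σ : St) (A : Arr) (a e : Expr) (ha : a.Bdd B σ)
    (hl : 8 * a.eval σ + 8 ≤ B) (hb : e.Bdd B σ) (hs : 8 * (35 + a.size + e.size) ≤ B) :
    Does B (writeArr A a e) σ (a.size + e.size + 5) (σ.write (a.eval σ) (e.eval σ) A) := by
  intro M r
  obtain ⟨M₁, t₁, e₁, ht₁, r₁, v₁, -⟩ := a.compile_spec 0 M r ha (by omega)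
  obtain ⟨M₂, t₂, e₂, ht₂, r₂, v₂, -⟩ := toAddr_spec A 0 _ r₁ (by omega) v₁ hl
  obtain ⟨M₃, t₃, e₃, ht₃, r₃, v₃, f₃⟩ := e.compile_spec 1 M₂ r₂ hb (by omega)
  have v₂' : M₃ (tmp 0) = A.scale * a.eval σ + A.base := by rw [f₃ 0 (by omega), v₂]
  refine ⟨_, _, .seq e₁ (.seq e₂ (.seq e₃ (.store _ _ _))), ?_, ?_⟩
  · have b1 : bits (tmp 0) ≤ bits B := bits_mono (by unfold tmp; omega)
    have b2 : bits (tmp 1) ≤ bits B := bits_mono (by unfold tmp; omega)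
    have b3 : bits (e.eval σ) ≤ bits B := bits_mono (Expr.eval_le hb)
    have b4 : bits (A.scale * a.eval σ + A.base) ≤ bits B := bits_mono (by
      cases A <;> simp only [Arr.scale, Arr.base] <;> omega)
    rw [v₂', v₃]
    simp only [add_mul]
    omega
  · rw [v₂', v₃]
    exact r₃.write A _ _

theorem Does.cond_pos {B : ℕ} {σ σ' : St} {e : Expr} {a b : Program} {n : ℕ} (hb : e.Bdd B σ)
    (hs : 8 * (35 + e.size) ≤ B) (h : e.eval σ ≠ 0) (ha : Does B a σ n σ') :
    Does B (cond e a b) σ (e.size + 1 + n) σ' := by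
  intro M r
  obtain ⟨M₁, t₁, e₁, ht₁, r₁, v₁, -⟩ := e.compile_spec 0 M r hb (by omega)
  obtain ⟨M₂, t₂, e₂, ht₂, r₂⟩ := ha M₁ r₁
  refine ⟨_, _, .seq e₁ (.ite_then (by rwa [v₁]) e₂), ?_, r₂⟩
  have b1 : bits (tmp 0) ≤ bits B := bits_mono (by unfold tmp; omega)
  have b3 : bits (e.eval σ) ≤ bits B := bits_mono (Expr.eval_le hb)
  rw [v₁]
  simp only [add_mul]
  omega

theorem Does.cond_neg {B : ℕ} {σ σ' : St} {e : Expr} {a b : Program} {n : ℕ} (hb : e.Bdd B σ)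
    (hs : 8 * (35 + e.size) ≤ B) (h : e.eval σ = 0) (ha : Does B b σ n σ') :
    Does B (cond e a b) σ (e.size + 1 + n) σ' := by
  intro M r
  obtain ⟨M₁, t₁, e₁, ht₁, r₁, v₁, -⟩ := e.compile_spec 0 M r hb (by omega)
  obtain ⟨M₂, t₂, e₂, ht₂, r₂⟩ := ha M₁ r₁
  refine ⟨_, _, .seq e₁ (.ite_else (by rwa [v₁]) e₂), ?_, r₂⟩
  have b1 : bits (tmp 0) ≤ bits B := bits_mono (by unfold tmp; omega)
  have b3 : bits (e.eval σ) ≤ bits B := bits_mono (Expr.eval_le hb)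
  rw [v₁]
  simp only [add_mul]
  omega

/-- Total correctness of `while`: `Inv f` says that the loop stops within `f` rounds. -/
theorem Does.while {B : ℕ} {e : Expr} {a : Program} {c : ℕ} (Inv : ℕ → St → Prop)
    (hb : ∀ f σ, Inv f σ → e.Bdd B σ) (hs : 8 * (35 + e.size) ≤ B)
    (step : ∀ f σ, Inv f σ → e.eval σ ≠ 0 → ∃ σ', Does B a σ c σ' ∧ ∃ f' < f, Inv f' σ')
    (f : ℕ) (σ : St) (h : Inv f σ) :
    ∃ σ' f', Does B (whileDo e a) σ ((f + 1) * (e.size + 1 + c)) σ' ∧ Inv f' σ' ∧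
      e.eval σ' = 0 := by
  have key : ∀ f σ, Inv f σ → ∃ σ' f', Inv f' σ' ∧ e.eval σ' = 0 ∧
      ∀ M, Rep M σ → M (tmp 0) = e.eval σ → ∃ M' t, Exec (.loop (tmp 0) (.seq a (e.compile 0)))
        M M' t ∧ t ≤ (f * (e.size + 1 + c) + 1) * (6 * bits B) ∧ Rep M' σ' := by
    intro f
    induction f using Nat.strong_induction_on with
    | _ f ih =>
      intro σ h
      have b1 : bits (tmp 0) ≤ bits B := bits_mono (by unfold tmp; omega)
      have b3 : bits (e.eval σ) ≤ bits B := bits_mono (Expr.eval_le (hb f σ h))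
      by_cases h0 : e.eval σ = 0
      · refine ⟨σ, f, h, h0, fun M r hM => ⟨_, _, .loop_exit (by rw [hM, h0]), ?_, r⟩⟩
        rw [hM, add_mul]
        omega
      · obtain ⟨σ₁, d₁, f₁, hf, h₁⟩ := step f σ h h0
        obtain ⟨σ', f', h', h0', H⟩ := ih f₁ hf σ₁ h₁
        refine ⟨σ', f', h', h0', fun M r hM => ?_⟩
        obtain ⟨M₁, t₁, e₁, ht₁, r₁⟩ := d₁ M r
        obtain ⟨M₂, t₂, e₂, ht₂, r₂, v₂, -⟩ := e.compile_spec 0 M₁ r₁ (hb _ _ h₁) (by omega)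
        obtain ⟨M₃, t₃, e₃, ht₃, r₃⟩ := H M₂ r₂ v₂
        refine ⟨_, _, .loop_step (by rwa [hM]) (.seq e₁ e₂) e₃, ?_, r₃⟩
        rw [hM]
        have : (f₁ + 1) * (e.size + 1 + c) * (6 * bits B) ≤
            f * (e.size + 1 + c) * (6 * bits B) := by gcongr; omega
        simp only [add_mul, one_mul] at this ht₃ ⊢
        omega
  obtain ⟨σ', f', h', h0', H⟩ := key f σ h
  refine ⟨σ', f', fun M r => ?_, h', h0'⟩
  obtain ⟨M₁, t₁, e₁, ht₁, r₁, v₁, -⟩ := e.compile_spec 0 M r (hb _ _ h) (by omega)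
  obtain ⟨M₂, t₂, e₂, ht₂, r₂⟩ := H M₁ r₁ v₁
  refine ⟨_, _, .seq e₁ e₂, ?_, r₂⟩
  have : (0 + 1) * (e.size + 1 + c) * (6 * bits B) ≤
      1 * (e.size + 1 + c) * (6 * bits B) := by gcongr
  simp only [add_mul, one_mul] at this ht₂ ⊢
  omega

/-- Total correctness of `forLt`: `Inv t` describes the state before the round with counter `t`. -/
theorem Does.for {B : ℕ} {v : Var} {e : Expr} {a : Program} {c N : ℕ} (Inv : ℕ → St → Prop)
    (σ : St) (hN : N + 1 ≤ B) (hs : 8 * (40 + e.size) ≤ B)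
    (hInv : ∀ t σ, Inv t σ → e.Bdd B σ ∧ e.eval σ = N ∧ σ.get v = t)
    (h0 : Inv 0 (σ.set 0 v))
    (step : ∀ t < N, ∀ σ, Inv t σ → ∃ σ', Does B a σ c σ' ∧ σ'.get v = t ∧
      Inv (t + 1) (σ'.set (t + 1) v)) :
    ∃ σ', Does B (forLt v e a) σ ((N + 1) * (e.size + c + 16)) (σ'.set 0 v) ∧ Inv N σ' := by
  have hB : 300 ≤ B := by omega
  obtain ⟨σ', f', hd, ⟨-, t, ht, hi⟩, hz⟩ := Does.while (B := B) (e := .bin .sub e (.var v))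
    (a := .seq a (RAM.assign v (.bin .add (.var v) (.lit 1)))) (c := c + 6)
    (fun f σ => f ≤ N ∧ ∃ t, t + f = N ∧ Inv t σ)
    (fun f σ h => by
      obtain ⟨-, t, ht, hi⟩ := h
      obtain ⟨h1, h2, h3⟩ := hInv t σ hi
      exact ⟨h1, by simp only [Expr.Bdd]; omega⟩)
    (by simp only [Expr.size]; omega)
    (fun f σ h hne => by
      obtain ⟨hf, t, ht, hi⟩ := h
      obtain ⟨h1, h2, h3⟩ := hInv t σ hi
      have htN : t < N := by
        simp only [Expr.eval, Op.eval, h2, h3] at hne; omega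
      obtain ⟨σ', d, hv, hi'⟩ := step t htN σ hi
      refine ⟨_, d.seq ((Does.assign σ' v (.bin .add (.var v) (.lit 1)) ?_ ?_).mono ?_), f - 1,
        by omega, by omega, t + 1, by omega, ?_⟩
      · simp only [Expr.Bdd, Expr.eval, hv]; omega
      · simp only [Expr.size]; omega
      · simp only [Expr.size]; omega
      · simpa only [Expr.eval, Op.eval, hv] using hi')
    N (σ.set 0 v) ⟨le_rfl, 0, by omega, h0⟩
  obtain ⟨h1, h2, h3⟩ := hInv t σ' hi
  have htN : t = N := by
    simp only [Expr.eval, Op.eval, h2, h3] at hz; omega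
  subst htN
  refine ⟨σ', ((Does.assign σ v (.lit 0) (by simp [Expr.Bdd])
    (by simp only [Expr.size]; omega)).seq (hd.seq (Does.assign σ' v (.lit 0) (by simp [Expr.Bdd])
      (by simp only [Expr.size]; omega)))).mono ?_, hi⟩
  have e1 : e.size + c + 16 = ((Expr.bin Op.sub e (Expr.var v)).size + 1 + (c + 6)) + 6 := by
    simp only [Expr.size]; omega
  rw [e1, mul_add (t + 1) _ 6]
  simp only [Expr.size]
  omega

/-- A `forLt` loop whose rounds are described by a sequence of states. -/
theorem Does.for_seq {B : ℕ} {v : Var} {e : Expr} {a : Program} {c N : ℕ} (F : ℕ → St)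
    {σ : St} (hN : N + 1 ≤ B) (hs : 8 * (40 + e.size) ≤ B)
    (hF : ∀ t ≤ N, e.Bdd B (F t) ∧ e.eval (F t) = N ∧ (F t).get v = t)
    (h0 : σ.set 0 v = F 0)
    (step : ∀ t < N, ∃ σ', Does B a (F t) c σ' ∧ σ'.get v = t ∧ σ'.set (t + 1) v = F (t + 1)) :
    Does B (forLt v e a) σ ((N + 1) * (e.size + c + 16)) ((F N).set 0 v) := by
  obtain ⟨σ', h, h1, rfl⟩ := Does.for (B := B) (a := a) (c := c) (N := N)
    (fun t σ => t ≤ N ∧ σ = F t) σ hN hs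
    (fun t σ h => by obtain ⟨ht, rfl⟩ := h; exact hF t ht) ⟨Nat.zero_le _, h0⟩
    (fun t ht σ h => by
      obtain ⟨-, rfl⟩ := h
      obtain ⟨σ', h1, h2, h3⟩ := step t ht
      exact ⟨σ', h1, h2, ht, h3⟩)
  exact h

end RAM

/-! ### The potential -/

namespace RAM

open RAM.Expr

/-- The cost of the selection `x` in scenario `S`. -/
def loadOf (inp x : ℕ → ℕ) (n S : ℕ) : ℕ := ∑ i ∈ Finset.range n, x i * inp (3 + (i + n * S))

/-- The terms of the potential in integers. With `z = c / C`, the components at `m` are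
`m! C^(m+2) fall (m+2) z` and `(m+1)! C^(m+2) penalty m z`, see `chain_eq`. -/
def chain (C c : ℕ) : ℕ → ℕ × ℕ
  | 0 => (c * (c - C), 2 * (c * C) + c * (c - C))
  | k + 1 => ((chain C c k).1 * ((k + 1) * (c - (k + 2) * C)),
      (chain C c k).2 * ((k + 2) * C) + (chain C c k).1 * ((k + 1) * (c - (k + 2) * C)))

/-- The potential of a selection `x`: a multiple of the sum of the penalties of its loads, measured
in units of `C / 200`. It is an integer and is computed without division. -/
def potential (inp x : ℕ → ℕ) (n K C m : ℕ) : ℕ :=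
  ∑ S ∈ Finset.range K, (chain C (200 * loadOf inp x n S) m).2

/-- `z :=` the cost of `x` in scenario `S` -/
def loadProg : Program :=
  .seq (assign .z (lit 0)) (forLt .k Var.n
    (assign .z (Var.z + read .x Var.k * read .inp (lit 3 + (Var.k + Var.n * Var.S)))))

/-- A bound `X` on the numbers in the input, their sums, and the addresses of array entries. -/
structure Fits (X : ℕ) (inp : ℕ → ℕ) (n K : ℕ) : Prop where
  big : 10000 ≤ X
  addr : 8 * (3 + (n + n * K)) + 8 ≤ X
  n_le : n + 1 ≤ X
  K_le : 3 * K + 5 ≤ X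
  inp_le : ∀ S < K, ∀ i < n, inp (3 + (i + n * S)) ≤ X
  sum_le : ∀ S < K, 200 * ∑ i ∈ Finset.range n, inp (3 + (i + n * S)) ≤ X

theorem Fits.index {X : ℕ} {inp : ℕ → ℕ} {n K : ℕ} (h : Fits X inp n K) {S i : ℕ} (hS : S < K)
    (hi : i < n) : 8 * (3 + (i + n * S)) + 8 ≤ X := by
  have := h.addr
  have : n * S ≤ n * K := Nat.mul_le_mul_left _ hS.le
  omega

theorem partial_load_le {inp x : ℕ → ℕ} (n S t : ℕ) (ht : t ≤ n) (hx : ∀ i, x i ≤ 1) :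
    ∑ i ∈ Finset.range t, x i * inp (3 + (i + n * S)) ≤
      ∑ i ∈ Finset.range n, inp (3 + (i + n * S)) :=
  calc _ ≤ ∑ i ∈ Finset.range t, inp (3 + (i + n * S)) :=
        Finset.sum_le_sum fun i _ => by simpa using Nat.mul_le_mul_right _ (hx i)
    _ ≤ _ := Finset.sum_le_sum_of_subset (Finset.range_subset_range.2 ht)

/-- Instruction count for `loadProg`. -/
def tLoad (n : ℕ) : ℕ := (n + 1) * 80

theorem load_does {B X : ℕ} (σ : St) (hX : Fits X σ.inp σ.n σ.K) (hB : X ≤ B) (hS : σ.S < σ.K)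
    (hx : ∀ i, σ.x i ≤ 1) :
    Does B loadProg σ (tLoad σ.n) { σ with z := loadOf σ.inp σ.x σ.n σ.S, k := 0 } := by
  have h1 := hX.big
  have h2 := hX.n_le
  have h3 := hX.K_le
  have h4 := hX.sum_le _ hS
  have hz := fun t ht => partial_load_le (inp := σ.inp) σ.n σ.S t ht hx
  refine Does.mono (Does.seq (Does.assign _ _ _ (by simp) (by simp; omega))
    (Does.for_seq (c := 40) (N := σ.n) (fun t => { σ with
        z := ∑ i ∈ Finset.range t, σ.x i * σ.inp (3 + (i + σ.n * σ.S)), k := t })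
      (by omega) (by simp; omega) (fun t ht => ⟨?_, rfl, rfl⟩) rfl
      (fun t ht => ⟨{ σ with
        z := ∑ i ∈ Finset.range (t + 1), σ.x i * σ.inp (3 + (i + σ.n * σ.S)), k := t },
        Does.assign_eq ?_ (by simp; omega) (by simp) ?_, rfl, rfl⟩))) ?_
  · simp only [bdd_var, St.get]; omega
  · have h5 := hX.index hS ht
    have h6 := hX.inp_le _ hS _ ht
    have h7 := hz t ht.le
    have h8 := hz (t + 1) ht
    have h9 := hx t
    rw [Finset.sum_range_succ] at h8
    simp only [bdd_add, bdd_mul, bdd_read, bdd_var, bdd_lit, eval_add, eval_mul, eval_read,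
      eval_var, eval_lit, St.get, St.arr]
    omega
  · simp [St.set, St.get, St.arr, Finset.sum_range_succ]
  · simp [tLoad]; omega

theorem chain_le {X C c : ℕ} (hX : 10000 ≤ X) (hC : C ≤ X) (hc : c ≤ X) :
    ∀ k, k + 2 ≤ X → (chain C c k).1 ≤ X ^ (3 * k + 2) ∧ (chain C c k).2 ≤ X ^ (3 * k + 3)
  | 0, _ => by
    have h1 : c * (c - C) ≤ X * X := Nat.mul_le_mul hc (by omega)
    have h2 : c * C ≤ X * X := Nat.mul_le_mul hc hC
    have h3 : 3 * (X * X) ≤ X * (X * X) := Nat.mul_le_mul_right _ (by omega)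
    simp only [chain, mul_zero, zero_add, pow_succ, pow_zero, one_mul]
    constructor
    · exact h1
    · rw [mul_assoc]; omega
  | k + 1, hk => by
    obtain ⟨h1, h2⟩ := chain_le hX hC hc k (by omega)
    have h3 : (k + 1) * (c - (k + 2) * C) ≤ X * X := Nat.mul_le_mul (by omega) (by omega)
    have h4 : (k + 2) * C ≤ X * X := Nat.mul_le_mul (by omega) hC
    have h5 := Nat.mul_le_mul h1 h3
    have h6 := Nat.mul_le_mul h2 h4
    have e1 : X ^ (3 * k + 2) * (X * X) = X ^ (3 * k + 4) := by ring
    have e2 : X ^ (3 * k + 3) * (X * X) = X ^ (3 * k + 5) := by ring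
    have e3 : X ^ (3 * (k + 1) + 3) = X * X ^ (3 * k + 5) := by ring
    have e4 : 2 * X ^ (3 * k + 5) ≤ X * X ^ (3 * k + 5) := Nat.mul_le_mul_right _ (by omega)
    have e5 : X ^ (3 * k + 4) ≤ X ^ (3 * k + 5) := Nat.pow_le_pow_right (by omega) (by omega)
    simp only [chain]
    rw [e3, show 3 * (k + 1) + 2 = 3 * k + 5 by ring]
    omega

/-- Replaces the load `z` by its contribution `f` to the potential. -/
def termProg : Program :=
  .seq (assign .z (lit 200 * Var.z)) <| .seq (assign .w (Var.z * (Var.z - Var.C))) <|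
  .seq (assign .f (lit 2 * (Var.z * Var.C) + Var.w)) <|
  forLt .k Var.m (.seq (assign .w (Var.w * ((Var.k + lit 1) * (Var.z - (Var.k + lit 2) * Var.C))))
    (assign .f (Var.f * ((Var.k + lit 2) * Var.C) + Var.w)))

/-- Instruction count for `termProg`. -/
def tTerm (m : ℕ) : ℕ := (m + 2) * 80

theorem term_does {B X : ℕ} (σ : St) (hX : 10000 ≤ X) (hm : σ.m + 3 ≤ X) (hC : σ.C ≤ X)
    (hz : 200 * σ.z ≤ X) (hB : X ^ (3 * σ.m + 3) ≤ B) :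
    Does B termProg σ (tTerm σ.m) { σ with
      z := 200 * σ.z, k := 0, w := (chain σ.C (200 * σ.z) σ.m).1,
      f := (chain σ.C (200 * σ.z) σ.m).2 } := by
  have hch := chain_le hX hC hz
  have hpow : ∀ k, k ≤ 3 * σ.m + 3 → X ^ k ≤ B := fun k hk =>
    (Nat.pow_le_pow_right (by omega) hk).trans hB
  have b1 : X ≤ B := by simpa using hpow 1 (by omega)
  have b2 : X * X ≤ B := by simpa [pow_two] using hpow 2 (by omega)
  have b0 : (chain σ.C (200 * σ.z) 0).2 ≤ B := (hch 0 (by omega)).2.trans (hpow _ (by omega))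
  have h1 : 200 * σ.z * (200 * σ.z - σ.C) ≤ X * X := Nat.mul_le_mul hz (by omega)
  have h2 : 200 * σ.z * σ.C ≤ X * X := Nat.mul_le_mul hz hC
  refine Does.mono (Does.seq (Does.assign _ _ _ (by simp [St.get]; omega) (by simp; omega)) <|
    Does.seq (Does.assign _ _ _ (by simp [St.get, St.set]; omega) (by simp; omega)) <|
    Does.seq (Does.assign _ _ _ (by
      simp only [chain] at b0
      simp [St.get, St.set]; omega) (by simp; omega)) <|
    Does.for_seq (c := 50) (N := σ.m) (fun t => { σ with
        z := 200 * σ.z, k := t, w := (chain σ.C (200 * σ.z) t).1,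
        f := (chain σ.C (200 * σ.z) t).2 })
      (by omega) (by simp; omega) (fun t ht => ⟨?_, rfl, rfl⟩) rfl
      (fun t ht => ⟨{ σ with
        z := 200 * σ.z, k := t, w := (chain σ.C (200 * σ.z) (t + 1)).1,
        f := (chain σ.C (200 * σ.z) (t + 1)).2 }, Does.mono (Does.seq
        (Does.assign _ _ _ ?_ (by simp; omega)) (Does.assign _ _ _ ?_ (by simp; omega)))
        (by simp), rfl, rfl⟩)) ?_
  · simp only [bdd_var, St.get]; omega
  any_goals
    have c1 := hch t (by omega)
    have c2 := hch (t + 1) (by omega)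
    have d1 := hpow (3 * t + 2) (by omega)
    have d2 := hpow (3 * t + 3) (by omega)
    have d3 := hpow (3 * (t + 1) + 2) (by omega)
    have d4 := hpow (3 * (t + 1) + 3) (by omega)
    have h3 : (t + 1) * (200 * σ.z - (t + 2) * σ.C) ≤ X * X :=
      Nat.mul_le_mul (by omega) (by omega)
    have h4 : (t + 2) * σ.C ≤ X * X := Nat.mul_le_mul (by omega) hC
    simp only [chain] at c2
    simp [St.get, St.set]
    omega
  · simp [tTerm]; omega

/-- `g :=` the potential of `x` -/
def potProg : Program :=
  .seq (assign .g (lit 0)) <| forLt .S Var.K <| .seq loadProg <| .seq termProg <|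
    .seq (assign .g (Var.g + Var.f)) <| .seq (assign .z (lit 0)) <|
    .seq (assign .w (lit 0)) (assign .f (lit 0))

/-- Instruction count for `potProg`. -/
def tPot (n K m : ℕ) : ℕ := (K + 1) * (tLoad n + tTerm m + 60)

theorem potential_partial_le {X C m n K : ℕ} {inp x : ℕ → ℕ} (hX : Fits X inp n K) (hC : C ≤ X)
    (hm : m + 3 ≤ X) (hx : ∀ i, x i ≤ 1) {t : ℕ} (ht : t ≤ K) :
    ∑ S ∈ Finset.range t, (chain C (200 * loadOf inp x n S) m).2 ≤ X ^ (3 * m + 4) := by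
  calc _ ≤ ∑ S ∈ Finset.range t, X ^ (3 * m + 3) := Finset.sum_le_sum fun S hS => by
        have hS : S < K := by have := Finset.mem_range.1 hS; omega
        refine (chain_le hX.big hC ?_ m (by omega)).2
        exact (Nat.mul_le_mul_left _ (partial_load_le n S n le_rfl hx)).trans (hX.sum_le S hS)
    _ = t * X ^ (3 * m + 3) := by simp
    _ ≤ X * X ^ (3 * m + 3) := Nat.mul_le_mul_right _ (by have := hX.K_le; omega)
    _ = _ := by ring

theorem pot_does {B X : ℕ} (σ : St) (hX : Fits X σ.inp σ.n σ.K) (hm : σ.m + 3 ≤ X)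
    (hC : σ.C ≤ X) (hB : X ^ (3 * σ.m + 4) ≤ B) (hK : σ.K ≠ 0)
    (hx : ∀ i, σ.x i ≤ 1) :
    Does B potProg σ (tPot σ.n σ.K σ.m) { σ with
      g := potential σ.inp σ.x σ.n σ.K σ.C σ.m, S := 0, k := 0, z := 0, w := 0, f := 0 } := by
  have hbig := hX.big
  have h3 := hX.K_le
  have hpow : ∀ k, k ≤ 3 * σ.m + 4 → X ^ k ≤ B := fun k hk =>
    (Nat.pow_le_pow_right (by omega) hk).trans hB
  have b1 : X ≤ B := by simpa using hpow 1 (by omega)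
  have hload : ∀ S < σ.K, 200 * loadOf σ.inp σ.x σ.n S ≤ X := fun S hS =>
    (Nat.mul_le_mul_left _ (partial_load_le σ.n S σ.n le_rfl hx)).trans (hX.sum_le S hS)
  -- Before the first round, the work variables still hold their old values.
  suffices h : Does B potProg σ (tPot σ.n σ.K σ.m) { σ with
      g := potential σ.inp σ.x σ.n σ.K σ.C σ.m, S := 0, k := if σ.K = 0 then σ.k else 0,
      z := if σ.K = 0 then σ.z else 0, w := if σ.K = 0 then σ.w else 0,
      f := if σ.K = 0 then σ.f else 0 } by simpa only [if_neg hK] using h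
  refine Does.mono (Does.seq (Does.assign _ _ _ (by simp) (by simp; omega)) <|
    Does.for_seq (c := tLoad σ.n + tTerm σ.m + 30) (N := σ.K) (fun t => { σ with
        g := ∑ S ∈ Finset.range t, (chain σ.C (200 * loadOf σ.inp σ.x σ.n S) σ.m).2, S := t,
        k := if t = 0 then σ.k else 0, z := if t = 0 then σ.z else 0,
        w := if t = 0 then σ.w else 0, f := if t = 0 then σ.f else 0 })
      (by omega) (by simp; omega) (fun t ht => ⟨?_, rfl, rfl⟩) rfl
      (fun t ht => ⟨{ σ with
        g := ∑ S ∈ Finset.range (t + 1), (chain σ.C (200 * loadOf σ.inp σ.x σ.n S) σ.m).2, S := t,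
        k := 0, z := 0, w := 0, f := 0 },
        Does.mono (Does.seq (load_does _ hX b1 ht hx) <| Does.seq
        (term_does _ hbig hm hC (hload t ht) (hpow _ ?_)) <|
        (Does.assign _ _ _ ?_ ?_).seq <|
        (Does.assign _ _ _ ?_ ?_).seq <|
        (Does.assign _ _ _ ?_ ?_).seq <|
        Does.assign_eq (n := 3) ?_ ?_ ?_ ?_) ?_, rfl, ?_⟩)) ?_
  · simp only [bdd_var, St.get]; omega
  · show 3 * σ.m + 3 ≤ _; omega
  · have e2 := potential_partial_le hX hC hm hx (t := t + 1) ht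
    have e4 := hpow (3 * σ.m + 4) (by omega)
    rw [Finset.sum_range_succ] at e2
    simp [St.get]
    omega
  any_goals first | (simp; done) | (simp; omega)
  · simp [St.set, St.get, Finset.sum_range_succ]
  · simp [St.set]
  · simp only [tPot]
    simp
    ring_nf
    omega

/-! ### Local search by exchanges -/

/-- The selection `x` with item `i` replaced by item `j`. -/
def exchange (x : ℕ → ℕ) (i j : ℕ) : ℕ → ℕ := Function.update (Function.update x i 0) j 1

/-- `x` is the indicator function of `p` items of cost at most `C / 200`. -/
structure Selection (mc : ℕ → ℕ) (n p C : ℕ) (x : ℕ → ℕ) : Prop where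
  le_one : ∀ i, x i ≤ 1
  card : ∑ i ∈ Finset.range n, x i = p
  cheap : ∀ i < n, x i = 1 → 200 * mc i ≤ C

/-- The exchange of `i` for `j`, if admissible, does not lower the potential by a factor
`1 - 1 / q`. -/
def NoGain (σ : St) (x : ℕ → ℕ) (i j : ℕ) : Prop :=
  x i = 1 → x j = 0 → 200 * σ.mc j ≤ σ.C →
    potential σ.inp x σ.n σ.K σ.C σ.m * (σ.q - 1) ≤
      potential σ.inp (exchange x i j) σ.n σ.K σ.C σ.m * σ.q

theorem sum_exchange {x : ℕ → ℕ} {n i j : ℕ} (hi : i < n) (hj : j < n) (hxi : x i = 1)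
    (hxj : x j = 0) (c : ℕ → ℕ) :
    ∑ l ∈ Finset.range n, exchange x i j l * c l + c i =
      ∑ l ∈ Finset.range n, x l * c l + c j := by
  have hij : i ≠ j := by rintro rfl; omega
  have h1 : ∀ l, exchange x i j l * c l + (if l = i then c i else 0) =
      x l * c l + (if l = j then c j else 0) := by
    intro l
    unfold exchange
    by_cases h : l = j
    · subst h; simp [hxj, hij.symm]
    · by_cases h' : l = i
      · subst h'; simp [h, hxi]
      · simp [h, h']
  have h2 := Finset.sum_congr rfl fun l (_ : l ∈ Finset.range n) => h1 l
  simpa [Finset.sum_add_distrib, hi, hj] using h2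

theorem Selection.exchange {mc : ℕ → ℕ} {n p C : ℕ} {x : ℕ → ℕ} (h : Selection mc n p C x)
    {i j : ℕ} (hi : i < n) (hj : j < n) (hxi : x i = 1) (hxj : x j = 0)
    (hc : 200 * mc j ≤ C) : Selection mc n p C (exchange x i j) := by
  refine ⟨fun l => ?_, ?_, fun l hl h1 => ?_⟩
  · have := h.le_one l
    unfold RAM.exchange Function.update
    split_ifs <;> simp_all
  · have := sum_exchange hi hj hxi hxj fun _ => 1
    have h2 := h.card
    simp only [mul_one] at this
    omega
  · by_cases hl' : l = j
    · rwa [hl']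
    · refine h.cheap l hl ?_
      unfold RAM.exchange Function.update at h1
      by_cases hli : l = i
      · rwa [hli]
      · simpa [hl', hli] using h1

/-- The states that occur between two steps of the local search. -/
def work (σ : St) (x : ℕ → ℕ) (c a i j : ℕ) : St :=
  { σ with x := x, cur := c, flag := a, i := i, j := j, g := 0, S := 0, k := 0, z := 0, w := 0,
           f := 0 }

/-- Exchanges `i` for `j` if this is admissible and lowers the potential noticeably. -/
def tryProg : Program :=
  cond (read .x Var.i * ((lit 1 - read .x Var.j) * (lit 1 - (lit 200 * read .mc Var.j - Var.C))))
    (.seq (writeArr .x Var.i (lit 0)) <| .seq (writeArr .x Var.j (lit 1)) <| .seq potProg <|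
      .seq (cond (Var.cur * (Var.q - lit 1) - Var.g * Var.q)
        (.seq (assign .cur Var.g) (assign .flag (lit 1)))
        (.seq (writeArr .x Var.i (lit 1)) (writeArr .x Var.j (lit 0))))
      (assign .g (lit 0)))
    skip

/-- Instruction count for `tryProg`. -/
def tTry (n K m : ℕ) : ℕ := tPot n K m + 150

/-- The bounds on the memory contents under which the local search is analysed. -/
structure Bounds (B X : ℕ) (σ : St) : Prop where
  fits : Fits X σ.inp σ.n σ.K
  m_le : σ.m + 3 ≤ X
  C_le : σ.C ≤ X
  q_le : σ.q ≤ X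
  mc_le : ∀ i < σ.n, 200 * σ.mc i ≤ X
  p_le : σ.p ≤ σ.n
  K_ne : σ.K ≠ 0
  pow_le : X ^ (3 * σ.m + 5) ≤ B

theorem Bounds.X_le {B X : ℕ} {σ : St} (h : Bounds B X σ) : X ≤ B :=
  (Nat.le_self_pow (by omega) X).trans h.pow_le

theorem potential_le {B X : ℕ} {σ : St} (h : Bounds B X σ) {x : ℕ → ℕ} (hx : ∀ i, x i ≤ 1) :
    potential σ.inp x σ.n σ.K σ.C σ.m ≤ X ^ (3 * σ.m + 4) :=
  potential_partial_le h.fits h.C_le h.m_le hx le_rfl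

/-- One test of an exchange. -/
theorem try_does {B X : ℕ} {σ : St} (h : Bounds B X σ) {x : ℕ → ℕ} {a i j : ℕ}
    (hi : i < σ.n) (hj : j < σ.n) (hx : Selection σ.mc σ.n σ.p σ.C x) :
    ∃ x' a', Does B tryProg (work σ x (potential σ.inp x σ.n σ.K σ.C σ.m) a i j)
        (tTry σ.n σ.K σ.m)
        (work σ x' (potential σ.inp x' σ.n σ.K σ.C σ.m) a' i j) ∧
      Selection σ.mc σ.n σ.p σ.C x' ∧
      ((x' = x ∧ a' = a ∧ NoGain σ x i j) ∨ (a' = 1 ∧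
        potential σ.inp x' σ.n σ.K σ.C σ.m * σ.q <
          potential σ.inp x σ.n σ.K σ.C σ.m * (σ.q - 1))) := by
  have hbig := h.fits.big
  have hXB := h.X_le
  have hn := h.fits.addr
  have hmc := h.mc_le j hj
  have hxi := hx.le_one i
  have hxj := hx.le_one j
  have e2 : (1 - x j) * (1 - (200 * σ.mc j - σ.C)) ≤ 1 :=
    Nat.mul_le_mul (Nat.sub_le 1 _) (Nat.sub_le 1 _)
  have e1 : x i * ((1 - x j) * (1 - (200 * σ.mc j - σ.C))) ≤ 1 :=
    Nat.mul_le_mul hxi e2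
  set P := potential σ.inp x σ.n σ.K σ.C σ.m with hP
  have hbd : (read .x Var.i * ((lit 1 - read .x Var.j) *
      (lit 1 - (lit 200 * read .mc Var.j - Var.C)))).Bdd B (work σ x P a i j) := by
    have := h.C_le
    simp [work, St.get, St.arr]
    omega
  by_cases hc : x i = 1 ∧ x j = 0 ∧ 200 * σ.mc j ≤ σ.C
  · obtain ⟨c1, c2, c3⟩ := hc
    have hx' := hx.exchange hi hj c1 c2 c3
    set x' := exchange x i j with hx'def
    set P' := potential σ.inp x' σ.n σ.K σ.C σ.m with hP'
    have l1 : P * (σ.q - 1) ≤ B := by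
      refine le_trans (Nat.mul_le_mul (potential_le h hx.le_one)
        (show σ.q - 1 ≤ X from (Nat.sub_le _ _).trans h.q_le)) (le_trans (le_of_eq ?_) h.pow_le)
      ring
    have l2 : P' * σ.q ≤ B := by
      refine le_trans (Nat.mul_le_mul (potential_le h hx'.le_one) h.q_le)
        (le_trans (le_of_eq ?_) h.pow_le)
      ring
    have l3 : X ^ (3 * σ.m + 4) ≤ B :=
      le_trans (Nat.pow_le_pow_right (by omega) (by omega)) h.pow_le
    have l4 : P ≤ B := (potential_le h hx.le_one).trans l3
    have l5 : P' ≤ B := (potential_le h hx'.le_one).trans l3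
    have hq := h.q_le
    let τ : St := { work σ x' P a i j with g := P' }
    have w₁ : Does B (writeArr .x Var.i (lit 0)) (work σ x P a i j) 8
        (work σ (Function.update x i 0) P a i j) :=
      Does.mono (Does.write _ _ _ _ (by simp [work, St.get]; omega) (by simp [work, St.get]; omega)
        (by simp) (by simp; omega)) (by simp)
    have w₂ : Does B (writeArr .x Var.j (lit 1)) (work σ (Function.update x i 0) P a i j) 8
        (work σ x' P a i j) :=
      Does.mono (Does.write _ _ _ _ (by simp [work, St.get]; omega) (by simp [work, St.get]; omega)
        (by simp; omega) (by simp; omega)) (by simp)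
    have w₃ : Does B potProg (work σ x' P a i j) (tPot σ.n σ.K σ.m) τ :=
      pot_does (work σ x' P a i j) h.fits h.m_le h.C_le l3 h.K_ne hx'.le_one
    have hcb : (Var.cur * (Var.q - lit 1) - Var.g * Var.q : Expr).Bdd B τ := by
      simp [τ, work, St.get]
      omega
    have hne : (read .x Var.i * ((lit 1 - read .x Var.j) *
        (lit 1 - (lit 200 * read .mc Var.j - Var.C)))).eval (work σ x P a i j) ≠ 0 := by
      simp [work, St.get, St.arr, c1, c2]; omega
    by_cases hg : P' * σ.q < P * (σ.q - 1)
    · refine ⟨x', 1, ?_, hx', .inr ⟨rfl, hg⟩⟩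
      have w₄ : Does B (.seq (assign .cur Var.g) (assign .flag (lit 1))) τ 8
          { work σ x' P' 1 i j with g := P' } :=
        Does.mono (Does.seq (Does.assign _ _ _ (by simpa [τ, St.get] using l5) (by simp; omega))
          (Does.assign _ _ _ (by simp; omega) (by simp; omega))) (by simp)
      refine Does.mono (Does.cond_pos hbd (by simp; omega) hne (w₁.seq <| w₂.seq <| w₃.seq <|
        (Does.cond_pos hcb (by simp; omega) ?_ w₄).seq
        (Does.assign_eq (n := 3) (by simp) (by simp; omega) (by simp) rfl))) ?_
      · simp [τ, work, St.get]; omega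
      · simp [tTry]; omega
    · refine ⟨x, a, ?_, hx, .inl ⟨rfl, rfl, fun _ _ _ => not_lt.1 hg⟩⟩
      have w₄ : Does B (writeArr .x Var.i (lit 1)) τ 8
          { work σ (Function.update x' i 1) P a i j with g := P' } :=
        Does.mono (Does.write _ _ _ _ (by simp [τ, work, St.get]; omega)
          (by simp [τ, work, St.get]; omega) (by simp; omega) (by simp; omega)) (by simp)
      have w₅ : Does B (writeArr .x Var.j (lit 0))
          { work σ (Function.update x' i 1) P a i j with g := P' } 8
          { work σ x P a i j with g := P' } := by
        have hw := Does.mono (n' := 8) (Does.write (B := B)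
          { work σ (Function.update x' i 1) P a i j with g := P' } .x (var .j) (lit 0)
          (by simp [work, St.get]; omega) (by simp [work, St.get]; omega) (by simp)
          (by simp; omega)) (by simp)
        have : Function.update (Function.update x' i 1) j 0 = x := by
          funext l
          have hij : i ≠ j := by rintro rfl; omega
          rw [hx'def]
          unfold exchange
          by_cases hl : l = j
          · subst hl; simp [c2]
          · by_cases hl' : l = i
            · subst hl'; simp [hl, c1]
            · simp [hl, hl']
        simpa [St.write, work, St.get, this] using hw
      refine Does.mono (Does.cond_pos hbd (by simp; omega) hne (w₁.seq <| w₂.seq <| w₃.seq <|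
        (Does.cond_neg hcb (by simp; omega) ?_ (w₄.seq w₅)).seq
        (Does.assign_eq (n := 3) (by simp) (by simp; omega) (by simp) rfl))) ?_
      · simp [τ, work, St.get]; omega
      · simp [tTry]; omega
  · refine ⟨x, a, ?_, hx, .inl ⟨rfl, rfl, fun h1 h2 h3 => absurd ⟨h1, h2, h3⟩ hc⟩⟩
    refine Does.mono (Does.cond_neg hbd (by simp; omega) ?_ (Does.skip _ (by omega))) ?_
    · simp [work, St.get, St.arr]
      omega
    · simp [tTry]

/-- Tests all exchanges once. -/
def sweepProg : Program := forLt .i Var.n (forLt .j Var.n tryProg)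

/-- Repeats sweeps until no exchange is made. -/
def searchProg : Program := whileDo Var.flag (.seq (assign .flag (lit 0)) sweepProg)

/-- Instruction count for `sweepProg`. -/
def tSweep (n K m : ℕ) : ℕ := (n + 1) * ((n + 1) * (tTry n K m + 18) + 18)

/-- A sweep either leaves `x` unchanged, and then no exchange is profitable, or it lowers the
energy `E` of the potential. -/
theorem sweep_does {B X : ℕ} {σ : St} (h : Bounds B X σ) {x : ℕ → ℕ} {E : ℕ → ℕ}
    (hE : ∀ a b, b * σ.q < a * (σ.q - 1) → E b < E a) (hx : Selection σ.mc σ.n σ.p σ.C x) :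
    ∃ x' a, Does B sweepProg (work σ x (potential σ.inp x σ.n σ.K σ.C σ.m) 0 0 0)
        (tSweep σ.n σ.K σ.m) (work σ x' (potential σ.inp x' σ.n σ.K σ.C σ.m) a 0 0) ∧
      Selection σ.mc σ.n σ.p σ.C x' ∧
      ((a = 0 ∧ ∀ i < σ.n, ∀ j < σ.n, NoGain σ x' i j) ∨ (a = 1 ∧
        E (potential σ.inp x' σ.n σ.K σ.C σ.m) < E (potential σ.inp x σ.n σ.K σ.C σ.m))) := by
  have hbig := h.fits.big
  have hXB := h.X_le
  have hn := h.fits.n_le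
  let W (x' : ℕ → ℕ) (a i j : ℕ) := work σ x' (potential σ.inp x' σ.n σ.K σ.C σ.m) a i j
  let Q (x' : ℕ → ℕ) (a : ℕ) (R : ℕ → ℕ → Prop) : Prop := Selection σ.mc σ.n σ.p σ.C x' ∧
    ((a = 0 ∧ x' = x ∧ ∀ i < σ.n, ∀ j < σ.n, R i j → NoGain σ x i j) ∨ (a = 1 ∧
      E (potential σ.inp x' σ.n σ.K σ.C σ.m) < E (potential σ.inp x σ.n σ.K σ.C σ.m)))
  obtain ⟨σ', hd, x', a, rfl, hx', hQ⟩ := Does.for (B := B) (v := .i) (e := Var.n)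
    (a := forLt .j Var.n tryProg) (c := (σ.n + 1) * (tTry σ.n σ.K σ.m + 18)) (N := σ.n)
    (fun t τ => ∃ x' a, τ = W x' a t 0 ∧ Q x' a fun i _ => i < t) (W x 0 0 0)
    (by omega) (by simp; omega)
    (fun t τ ht => by
      obtain ⟨x', a, rfl, -⟩ := ht
      exact ⟨by simp [W, work, St.get]; omega, rfl, rfl⟩)
    ⟨x, 0, rfl, hx, .inl ⟨rfl, rfl, by omega⟩⟩
    (fun t ht τ hτ => by
      obtain ⟨x₁, a₁, rfl, hx₁, hQ₁⟩ := hτ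
      obtain ⟨σ', hd, x', a, rfl, hx', hQ'⟩ := Does.for (B := B) (v := .j) (e := Var.n)
        (a := tryProg) (c := tTry σ.n σ.K σ.m) (N := σ.n)
        (fun s τ => ∃ x' a, τ = W x' a t s ∧ Q x' a fun i j => i < t ∨ i = t ∧ j < s)
        (W x₁ a₁ t 0) (by omega) (by simp; omega)
        (fun s τ hs => by
          obtain ⟨x', a, rfl, -⟩ := hs
          exact ⟨by simp [W, work, St.get]; omega, rfl, rfl⟩)
        ⟨x₁, a₁, rfl, hx₁, hQ₁.imp_left fun ⟨h1, h2, h3⟩ => ⟨h1, h2, fun i hi j hj hij =>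
          h3 i hi j hj (by omega)⟩⟩
        (fun s hs τ hτ => by
          obtain ⟨x₂, a₂, rfl, hx₂, hQ₂⟩ := hτ
          obtain ⟨x₃, a₃, hd₃, hx₃, hQ₃⟩ := try_does h (a := a₂) ht hs hx₂
          refine ⟨_, hd₃, rfl, x₃, a₃, rfl, hx₃, ?_⟩
          rcases hQ₃ with ⟨rfl, rfl, hng⟩ | ⟨rfl, hlt⟩
          · refine hQ₂.imp_left fun ⟨h1, h2, h3⟩ => ⟨h1, h2, fun i hi j hj hij => ?_⟩
            by_cases hlast : i = t ∧ j = s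
            · obtain ⟨rfl, rfl⟩ := hlast
              rwa [← h2]
            · exact h3 i hi j hj (by omega)
          · refine .inr ⟨rfl, (hE _ _ hlt).trans_le ?_⟩
            rcases hQ₂ with ⟨-, rfl, -⟩ | ⟨-, h2⟩
            exacts [le_rfl, h2.le])
      refine ⟨_, hd.mono (by simp; ring_nf; omega), rfl, x', a, rfl, hx', hQ'.imp_left
        fun ⟨h1, h2, h3⟩ => ⟨h1, h2, fun i hi j hj hij => h3 i hi j hj (by omega)⟩⟩)
  refine ⟨x', a, hd.mono ?_, hx', ?_⟩
  · simp [tSweep]; ring_nf; omega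
  · exact hQ.imp_left fun ⟨h1, h2, h3⟩ => ⟨h1, fun i hi j hj => h2 ▸ h3 i hi j hj hi⟩

/-- The energy `E` takes values up to `T`, which bounds the number of sweeps. -/
theorem search_does {B X T : ℕ} {σ : St} (h : Bounds B X σ) {x : ℕ → ℕ} {E : ℕ → ℕ}
    (hE : ∀ a b, b * σ.q < a * (σ.q - 1) → E b < E a)
    (hT : ∀ a ≤ X ^ (3 * σ.m + 4), E a ≤ T) (hx : Selection σ.mc σ.n σ.p σ.C x) :
    ∃ x', Does B searchProg (work σ x (potential σ.inp x σ.n σ.K σ.C σ.m) 1 0 0)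
        ((T + 2) * (tSweep σ.n σ.K σ.m + 6))
        (work σ x' (potential σ.inp x' σ.n σ.K σ.C σ.m) 0 0 0) ∧
      Selection σ.mc σ.n σ.p σ.C x' ∧ ∀ i < σ.n, ∀ j < σ.n, NoGain σ x' i j := by
  have hbig := h.fits.big
  have hXB := h.X_le
  obtain ⟨σ', f', hd, ⟨x', a, rfl, hx', hQ⟩, hz⟩ := Does.while (B := B) (e := Var.flag)
    (a := .seq (assign .flag (lit 0)) sweepProg) (c := tSweep σ.n σ.K σ.m + 3)
    (fun f τ => ∃ x' a, τ = work σ x' (potential σ.inp x' σ.n σ.K σ.C σ.m) a 0 0 ∧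
      Selection σ.mc σ.n σ.p σ.C x' ∧
      ((a = 0 ∧ ∀ i < σ.n, ∀ j < σ.n, NoGain σ x' i j) ∨
        (a = 1 ∧ E (potential σ.inp x' σ.n σ.K σ.C σ.m) + 1 ≤ f)))
    (fun f τ hτ => by
      obtain ⟨x', a, rfl, -, hQ⟩ := hτ
      have : a ≤ 1 := by rcases hQ with ⟨rfl, -⟩ | ⟨rfl, -⟩ <;> omega
      simp [work, St.get]; omega)
    (by simp; omega)
    (fun f τ hτ hne => by
      obtain ⟨x₁, a, rfl, hx₁, hQ⟩ := hτ
      rcases hQ with ⟨rfl, -⟩ | ⟨rfl, hf⟩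
      · exact absurd rfl hne
      obtain ⟨x₂, a₂, hd, hx₂, hQ₂⟩ := sweep_does h hE hx₁
      refine ⟨_, ((Does.assign_eq (n := 3) (by simp) (by simp; omega) (by simp) rfl).seq hd).mono
        (by omega), f - 1, by omega, x₂, a₂, rfl, hx₂, hQ₂.imp_right fun ⟨h1, h2⟩ =>
          ⟨h1, by omega⟩⟩)
    (T + 1) (work σ x (potential σ.inp x σ.n σ.K σ.C σ.m) 1 0 0)
    ⟨x, 1, rfl, hx, .inr ⟨rfl, by have := hT _ (potential_le h hx.le_one); omega⟩⟩
  have ha : a = 0 := hz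
  subst ha
  refine ⟨x', hd.mono (by simp; ring_nf; omega), hx', ?_⟩
  rcases hQ with ⟨-, h⟩ | ⟨h, -⟩
  exacts [h, absurd h (by omega)]

/-! ### One round of the search -/

/-- Selects the first `p` items of cost at most `C / 200`, or all if there are fewer. -/
def initProg : Program :=
  .seq (assign .cnt (lit 0)) <| forLt .i Var.n <|
    .seq (writeArr .x Var.i ((lit 1 - (lit 200 * read .mc Var.i - Var.C)) *
        (lit 1 - ((Var.cnt + lit 1) - Var.p))))
      (assign .cnt (Var.cnt + read .x Var.i))

/-- The number of items of cost at most `C / 200`; the summand is `1` for these items and `0` for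
the others. -/
def cheapCount (mc : ℕ → ℕ) (n C : ℕ) : ℕ := ∑ i ∈ Finset.range n, (1 - (200 * mc i - C))

/-- Instruction count for `initProg`. -/
def tInit (n : ℕ) : ℕ := (n + 1) * 80

theorem init_does {B X : ℕ} {σ : St} (h : Bounds B X σ) (hx : ∀ i, σ.x i ≤ 1) :
    ∃ x', Does B initProg σ (tInit σ.n) { σ with
        x := x', cnt := min σ.p (cheapCount σ.mc σ.n σ.C), i := 0 } ∧
      (∀ i, x' i ≤ 1) ∧ (∀ i < σ.n, x' i = 1 → 200 * σ.mc i ≤ σ.C) ∧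
      ∑ i ∈ Finset.range σ.n, x' i = min σ.p (cheapCount σ.mc σ.n σ.C) := by
  have hbig := h.fits.big
  have hXB := h.X_le
  have hn := h.fits.n_le
  have ha := h.fits.addr
  obtain ⟨σ', hd, x', rfl, h1, h2, h3⟩ := Does.for (B := B) (v := .i) (e := Var.n)
    (a := .seq (writeArr .x Var.i ((lit 1 - (lit 200 * read .mc Var.i - Var.C)) *
        (lit 1 - ((Var.cnt + lit 1) - Var.p)))) (assign .cnt (Var.cnt + read .x Var.i)))
    (c := 50) (N := σ.n)
    (fun t τ => ∃ x', τ = { σ with x := x', cnt := min σ.p (cheapCount σ.mc t σ.C), i := t } ∧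
      (∀ i, x' i ≤ 1) ∧ (∀ i < t, x' i = 1 → 200 * σ.mc i ≤ σ.C) ∧
      ∑ i ∈ Finset.range t, x' i = min σ.p (cheapCount σ.mc t σ.C))
    { σ with cnt := 0 } (by omega) (by simp; omega)
    (fun t τ ht => by
      obtain ⟨x', rfl, -⟩ := ht
      exact ⟨by simp [St.get]; omega, rfl, rfl⟩)
    ⟨σ.x, by simp [cheapCount, St.set], hx, by simp, by simp [cheapCount]⟩
    (fun t ht τ hτ => by
      obtain ⟨x', rfl, h1, h2, h3⟩ := hτ
      have hp := h.p_le
      have hC := h.C_le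
      have hmc := h.mc_le t ht
      have e0 : cheapCount σ.mc (t + 1) σ.C =
        cheapCount σ.mc t σ.C + (1 - (200 * σ.mc t - σ.C)) := Finset.sum_range_succ _ _
      set c := cheapCount σ.mc t σ.C with hc
      set b := (1 - (200 * σ.mc t - σ.C)) * (1 - ((min σ.p c + 1) - σ.p)) with hb
      have hb1 : b ≤ 1 := Nat.mul_le_mul (Nat.sub_le 1 _) (Nat.sub_le 1 _)
      have hmin : min σ.p (cheapCount σ.mc (t + 1) σ.C) = min σ.p c + b := by
        rw [e0, hb]
        by_cases h1 : 200 * σ.mc t ≤ σ.C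
        · rw [show 1 - (200 * σ.mc t - σ.C) = 1 by omega, one_mul]; omega
        · rw [show 1 - (200 * σ.mc t - σ.C) = 0 by omega, zero_mul]; omega
      refine ⟨{ σ with x := Function.update x' t b, cnt := min σ.p c + b, i := t },
        Does.mono (Does.seq (Does.write _ _ _ _ ?_ ?_ ?_ ?_)
          (Does.assign_eq (n := 12) ?_ ?_ ?_ ?_)) ?_, rfl, Function.update x' t b, ?_, ?_, ?_, ?_⟩
      · simp [St.get]; omega
      · simp [St.get]; omega
      · simp [St.get, St.arr, ← hb]; omega
      · simp; omega
      · simp [St.get, St.arr, St.write, ← hb]; omega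
      · simp; omega
      · simp
      · simp [St.get, St.arr, St.write, St.set, ← hb]
      · simp
      · rw [hmin]; rfl
      · intro i
        by_cases hi : i = t
        · subst hi; simpa using hb1
        · simpa [hi] using h1 i
      · intro i hi
        by_cases hit : i = t
        · subst hit
          simp only [Function.update_self]
          intro hb1
          by_contra hcon
          rw [hb, show 1 - (200 * σ.mc i - σ.C) = 0 by omega, zero_mul] at hb1
          omega
        · simpa [hit] using h2 i (by omega)
      · rw [Finset.sum_range_succ, hmin, ← h3, Function.update_self]
        congr 1
        refine Finset.sum_congr rfl fun i hi => Function.update_of_ne ?_ _ _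
        have := Finset.mem_range.1 hi; omega)
  refine ⟨x', Does.mono (Does.seq (Does.assign _ _ _ (by simp) (by simp; omega)) hd) ?_, h1, h2, h3⟩
  simp [tInit]; omega

/-- The largest cost of `x` over all scenarios. -/
def maxLoad (inp x : ℕ → ℕ) (n K : ℕ) : ℕ := (Finset.range K).sup (loadOf inp x n)

/-- `mx :=` the largest cost of `x` over all scenarios -/
def maxProg : Program :=
  .seq (assign .mx (lit 0)) <| forLt .S Var.K <|
    .seq loadProg <| .seq (assign .mx (Var.mx + (Var.z - Var.mx))) (assign .z (lit 0))

/-- Instruction count for `maxProg`. -/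
def tMax (n K : ℕ) : ℕ := (K + 1) * (tLoad n + 50)

theorem load_le {B X : ℕ} {σ : St} (h : Bounds B X σ) {x : ℕ → ℕ} (hx : ∀ i, x i ≤ 1) {S : ℕ}
    (hS : S < σ.K) : loadOf σ.inp x σ.n S ≤ X := by
  have := (Nat.mul_le_mul_left 200 (partial_load_le σ.n S σ.n le_rfl hx)).trans
    (h.fits.sum_le S hS)
  unfold loadOf; omega

theorem max_does {B X : ℕ} {σ : St} (h : Bounds B X σ) (hx : ∀ i, σ.x i ≤ 1)
    (hk : σ.k = 0) (hz : σ.z = 0) :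
    Does B maxProg σ (tMax σ.n σ.K) { σ with mx := maxLoad σ.inp σ.x σ.n σ.K, S := 0 } := by
  have hbig := h.fits.big
  have hXB := h.X_le
  have hK := h.fits.K_le
  have e1 : ∀ t ≤ σ.K, (Finset.range t).sup (loadOf σ.inp σ.x σ.n) ≤ X := fun t ht =>
    Finset.sup_le fun S hS => load_le h hx (by have := Finset.mem_range.1 hS; omega)
  have hs : ∀ τ : St, τ.k = 0 → τ.z = 0 → τ = { τ with k := 0, z := 0 } := by
    intro τ h1 h2; cases τ; simp_all
  rw [hs σ hk hz]
  refine Does.mono (Does.seq (Does.assign _ _ _ (by simp) (by simp; omega)) <|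
    Does.for_seq (c := tLoad σ.n + 20) (N := σ.K) (fun t => { σ with
      mx := (Finset.range t).sup (loadOf σ.inp σ.x σ.n), S := t, k := 0, z := 0 })
      (by omega) (by simp; omega) (fun t ht => ⟨?_, rfl, rfl⟩) rfl
      (fun t ht => ⟨{ σ with
        mx := (Finset.range (t + 1)).sup (loadOf σ.inp σ.x σ.n), S := t, k := 0, z := 0 },
        Does.mono (Does.seq (load_does _ h.fits hXB ht hx) <|
        (Does.assign _ _ _ ?_ ?_).seq <| Does.assign_eq (n := 3) ?_ ?_ ?_ ?_) ?_, rfl, rfl⟩)) ?_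
  · simp [St.get]; omega
  · have e2 := load_le h hx ht
    have e3 := e1 t ht.le
    simp only [bdd_add, bdd_sub, bdd_var, eval_sub, eval_var, St.get]
    omega
  any_goals first | (simp; done) | (simp; omega)
  · simp [St.set, St.get, Finset.range_add_one]
    omega
  · simp [tMax]; ring_nf; omega

/-- `y := x` -/
def copyProg : Program := forLt .i Var.n (writeArr .y Var.i (read .x Var.i))

theorem copy_does {B X : ℕ} {σ : St} (h : Bounds B X σ) (hx : ∀ i, σ.x i ≤ 1) :
    ∃ y', Does B copyProg σ ((σ.n + 1) * 40) { σ with y := y', i := 0 } ∧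
      ∀ i < σ.n, y' i = σ.x i := by
  have hbig := h.fits.big
  have hXB := h.X_le
  have ha := h.fits.addr
  obtain ⟨σ', hd, y', rfl, h1⟩ := Does.for (B := B) (v := .i) (e := Var.n)
    (a := writeArr .y Var.i (read .x Var.i)) (c := 20) (N := σ.n)
    (fun t τ => ∃ y', τ = { σ with y := y', i := t } ∧ ∀ i < t, y' i = σ.x i)
    σ (by omega) (by simp; omega)
    (fun t τ ht => by
      obtain ⟨y', rfl, -⟩ := ht
      exact ⟨by simp [St.get]; omega, rfl, rfl⟩)
    ⟨σ.y, rfl, by simp⟩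
    (fun t ht τ hτ => by
      obtain ⟨y', rfl, h1⟩ := hτ
      have := hx t
      refine ⟨_, Does.mono (Does.write _ _ _ _ ?_ ?_ ?_ ?_) ?_, rfl,
        Function.update y' t (σ.x t), rfl, ?_⟩
      · simp [St.get]; omega
      · simp [St.get]; omega
      · simp [St.get, St.arr]; omega
      · simp; omega
      · simp
      · intro i hi
        by_cases hit : i = t
        · subst hit; simp
        · simpa [hit] using h1 i (by omega))
  exact ⟨y', hd.mono (by simp), h1⟩

/-- The recorded selection `y` has size `p` and largest cost at most `best`. -/
def Recorded (σ : St) : Prop :=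
  (∀ i < σ.n, σ.y i ≤ 1) ∧ (σ.best ≤ σ.tot → ∑ i ∈ Finset.range σ.n, σ.y i = σ.p ∧
    ∀ S < σ.K, loadOf σ.inp σ.y σ.n S ≤ σ.best)

/-- `x` is a selection of cheap items that no exchange for a cheap item improves noticeably. -/
def LocalOpt (inp mc : ℕ → ℕ) (n K p C m : ℕ) (x : ℕ → ℕ) : Prop :=
  Selection mc n p C x ∧ ∀ i < n, ∀ j < n, x i = 1 → x j = 0 → 200 * mc j ≤ C →
    potential inp x n K C m * (1000 * (n * (K * (m + 3))) - 1) ≤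
      potential inp (exchange x i j) n K C m * (1000 * (n * (K * (m + 3))))

/-- The recorded value is at most that of some local optimum for the guess `C` and index `m`,
provided that there are enough cheap items. -/
def Handled (σ : St) (C m best : ℕ) : Prop :=
  σ.p ≤ cheapCount σ.mc σ.n C →
    ∃ x, LocalOpt σ.inp σ.mc σ.n σ.K σ.p C m x ∧ best ≤ maxLoad σ.inp x σ.n σ.K

/-- The two states agree on the data that the search does not change. -/
structure SameInput (σ τ : St) : Prop where
  inp : τ.inp = σ.inp
  mc : τ.mc = σ.mc
  n : τ.n = σ.n
  K : τ.K = σ.K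
  p : τ.p = σ.p
  tot : τ.tot = σ.tot
  lim : τ.lim = σ.lim

/-- Runs the local search for one guess and one potential, and records the result if it is better
than the best one so far. -/
def guessProg : Program :=
  .seq (assign .q (lit 1000 * (Var.n * (Var.K * (Var.m + lit 3))))) <| .seq initProg <|
  cond (lit 1 - (Var.p - Var.cnt))
    (.seq (assign .j (lit 0)) <| .seq potProg <| .seq (.seq (assign .cur Var.g) <|
      .seq (assign .g (lit 0)) (assign .flag (lit 1))) <| .seq searchProg <|
      .seq maxProg <| cond (Var.best - Var.mx) (.seq (assign .best Var.mx) copyProg) skip)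
    skip

/-- Instruction count for `guessProg`, if a local search takes at most `T` sweeps. -/
def tGuess (n K m T : ℕ) : ℕ :=
  tInit n + tPot n K m + (T + 2) * (tSweep n K m + 6) + tMax n K + (n + 1) * 40 + 150

theorem guess_does {B X T : ℕ} {σ : St} (h : Bounds B X { σ with
      q := 1000 * (σ.n * (σ.K * (σ.m + 3))) })
    {E : ℕ → ℕ}
    (hE : ∀ a b, b * (1000 * (σ.n * (σ.K * (σ.m + 3)))) <
      a * (1000 * (σ.n * (σ.K * (σ.m + 3))) - 1) → E b < E a)
    (hT : ∀ a ≤ X ^ (3 * σ.m + 4), E a ≤ T) (hx : ∀ i, σ.x i ≤ 1) (hbest : σ.best ≤ B)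
    (hR : Recorded σ) :
    ∃ σ', Does B guessProg σ (tGuess σ.n σ.K σ.m T) σ' ∧ SameInput σ σ' ∧ σ'.C = σ.C ∧
      σ'.m = σ.m ∧ (∀ i, σ'.x i ≤ 1) ∧ σ'.best ≤ σ.best ∧ Recorded σ' ∧
      Handled σ σ.C σ.m σ'.best := by
  have hbig := h.fits.big
  have hXB := h.X_le
  have ha := h.fits.addr
  have hn := h.fits.n_le
  have hK := h.fits.K_le
  have hm := h.m_le
  have hp := h.p_le
  have hq := h.q_le
  have hpow : X ^ (3 * σ.m + 4) ≤ B :=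
    le_trans (Nat.pow_le_pow_right (by omega) (by simp)) h.pow_le
  set q := 1000 * (σ.n * (σ.K * (σ.m + 3))) with hqdef
  let σ₁ : St := { σ with q := q }
  change Bounds B X σ₁ at h
  simp only at hn hK hm hp hq
  have d₁ : Does B (assign .q (lit 1000 * (Var.n * (Var.K * (Var.m + lit 3))))) σ 20 σ₁ := by
    refine Does.assign_eq ?_ (by simp; omega) (by simp) rfl
    -- The factor `n` could be `0`, so that the bound on `q` does not bound this product.
    have e1 : σ.K * (σ.m + 3) ≤ X ∨ σ.n = 0 := by
      rcases Nat.eq_zero_or_pos σ.n with h0 | h0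
      · exact .inr h0
      · have := Nat.le_mul_of_pos_left (σ.K * (σ.m + 3)) h0
        left; omega
    have e2 : σ.K * (σ.m + 3) ≤ B := by
      rcases e1 with e1 | e1
      · omega
      · refine le_trans (Nat.mul_le_mul (show σ.K ≤ X by omega) hm) (le_trans ?_ hpow)
        rw [← pow_two]
        exact Nat.pow_le_pow_right (by omega) (by omega)
    simp [St.get]
    omega
  obtain ⟨x₀, d₂, hx₀, hc₀, hs₀⟩ := init_does h hx
  set cc := cheapCount σ.mc σ.n σ.C with hcc
  let σ₂ : St := { σ₁ with x := x₀, cnt := min σ.p cc, i := 0 }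
  have hcb : (lit 1 - (Var.p - Var.cnt) : Expr).Bdd B σ₂ := by
    simp [σ₂, σ₁, St.get]; omega
  by_cases hcnt : σ.p ≤ cc
  swap
  · refine ⟨σ₂, Does.mono (d₁.seq <| d₂.seq <| Does.cond_neg hcb (by simp; omega) ?_
      (Does.skip _ (by omega))) ?_, ⟨rfl, rfl, rfl, rfl, rfl, rfl, rfl⟩, rfl, rfl, hx₀, le_rfl, hR,
      fun h => absurd h hcnt⟩
    · simp [σ₁, St.get]; omega
    · simp [tGuess, σ₁]; omega
  have hsel : Selection σ.mc σ.n σ.p σ.C x₀ := ⟨hx₀, hs₀.trans (min_eq_left hcnt), hc₀⟩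
  let σ₃ : St := { σ₂ with j := 0 }
  have hb₃ : Bounds B X σ₃ := ⟨h.1, h.2, h.3, h.4, h.5, h.6, h.7, h.8⟩
  have d₃ : Does B (assign .j (lit 0)) σ₂ 3 σ₃ :=
    Does.assign_eq (by simp) (by simp; omega) (by simp) rfl
  have d₄ := pot_does σ₃ hb₃.fits hb₃.m_le hb₃.C_le hpow hb₃.K_ne hx₀
  set P := potential σ.inp x₀ σ.n σ.K σ.C σ.m with hP
  have hPB : P ≤ B := (potential_le h hx₀).trans hpow
  have d₅ : Does B (.seq (assign .cur Var.g) <| .seq (assign .g (lit 0)) (assign .flag (lit 1)))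
      { σ₃ with g := P, S := 0, k := 0, z := 0, w := 0, f := 0 } 10 (work σ₃ x₀ P 1 0 0) :=
    Does.mono (Does.seq (Does.assign _ _ _ (by simpa [St.get] using hPB) (by simp; omega)) <|
      Does.seq (Does.assign _ _ _ (by simp) (by simp; omega)) <|
      Does.assign_eq (n := 3) (by simp; omega) (by simp; omega) (by simp) rfl) (by simp)
  obtain ⟨x₁, d₆, hsel₁, hng⟩ := search_does hb₃ hE hT hsel
  let σ₄ : St := work σ₃ x₁ (potential σ.inp x₁ σ.n σ.K σ.C σ.m) 0 0 0
  have hb₄ : Bounds B X σ₄ := ⟨h.1, h.2, h.3, h.4, h.5, h.6, h.7, h.8⟩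
  have d₇ := max_does hb₄ hsel₁.le_one rfl rfl
  set V := maxLoad σ.inp x₁ σ.n σ.K with hV
  have hVX : V ≤ X := Finset.sup_le fun S hS =>
    load_le h hsel₁.le_one (Finset.mem_range.1 hS)
  let σ₅ : St := { σ₄ with mx := V, S := 0 }
  have hb₅ : Bounds B X σ₅ := ⟨h.1, h.2, h.3, h.4, h.5, h.6, h.7, h.8⟩
  have hcb₅ : (Var.best - Var.mx : Expr).Bdd B σ₅ := by
    simp [σ₅, σ₄, σ₃, σ₂, σ₁, work, St.get]; omega
  obtain ⟨σ', d₈, hin, hC', hm', hx', hle, hR', hle'⟩ : ∃ σ',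
      Does B (cond (Var.best - Var.mx) (.seq (assign .best Var.mx) copyProg) skip) σ₅
        ((σ.n + 1) * 40 + 20) σ' ∧ SameInput σ σ' ∧ σ'.C = σ.C ∧ σ'.m = σ.m ∧
        (∀ i, σ'.x i ≤ 1) ∧ σ'.best ≤ σ.best ∧ Recorded σ' ∧ σ'.best ≤ V := by
    by_cases hlt : V < σ.best
    · have d₉ : Does B (assign .best Var.mx) σ₅ 4 { σ₅ with best := V } :=
        Does.assign_eq (by simp [σ₅, St.get]; omega) (by simp; omega) (by simp) rfl
      obtain ⟨y', d, hy⟩ := copy_does (B := B) (X := X) (σ := { σ₅ with best := V })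
        ⟨h.1, h.2, h.3, h.4, h.5, h.6, h.7, h.8⟩ hsel₁.le_one
      refine ⟨_, Does.mono (Does.cond_pos hcb₅ (by simp; omega) ?_ (d₉.seq d)) ?_,
        ⟨rfl, rfl, rfl, rfl, rfl, rfl, rfl⟩, rfl, rfl, hsel₁.le_one, hlt.le,
        ⟨?_, fun _ => ⟨?_, ?_⟩⟩, le_rfl⟩
      · simp [σ₅, σ₄, σ₃, σ₂, σ₁, work, St.get]; omega
      · simp [σ₅, σ₄, σ₃, σ₂, σ₁, work]; omega
      · intro i hi
        exact (hy i hi).trans_le (hsel₁.le_one i)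
      · exact (Finset.sum_congr rfl fun i hi => hy i (Finset.mem_range.1 hi)).trans hsel₁.card
      · intro S hS
        have : loadOf σ.inp y' σ.n S = loadOf σ.inp x₁ σ.n S :=
          Finset.sum_congr rfl fun i hi => by rw [hy i (Finset.mem_range.1 hi)]; rfl
        exact this.trans_le (Finset.le_sup (f := loadOf σ.inp x₁ σ.n) (Finset.mem_range.2 hS))
    · refine ⟨σ₅, Does.mono (Does.cond_neg hcb₅ (by simp; omega) ?_ (Does.skip _ (by omega))) ?_,
        ⟨rfl, rfl, rfl, rfl, rfl, rfl, rfl⟩, rfl, rfl, hsel₁.le_one, le_rfl, hR, not_lt.1 hlt⟩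
      · simp [σ₅, σ₄, σ₃, σ₂, σ₁, work, St.get]; omega
      · simp
  refine ⟨σ', Does.mono (d₁.seq <| d₂.seq <| Does.cond_pos hcb (by simp; omega) ?_ <| d₃.seq <|
    d₄.seq <| d₅.seq <| d₆.seq <| d₇.seq d₈) ?_, hin, hC', hm', hx', hle, hR',
    fun _ => ⟨x₁, ⟨hsel₁, hng⟩, hle'⟩⟩
  · simp [σ₁, St.get]; omega
  · simp [tGuess, σ₄, σ₃, σ₂, σ₁, work]; omega

/-! ### The sequence of guesses -/

/-- The guesses for 200 times the value of the linear program. They grow by steps of at most one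
plus half a percent, and double within 200 steps. -/
def guess : ℕ → ℕ
  | 0 => 1
  | j + 1 => guess j + (guess j / 200 + 1)

theorem guess_add_le (j k : ℕ) : guess j + k * (guess j / 200 + 1) ≤ guess (j + k) := by
  induction k with
  | zero => simp
  | succ k ih =>
    have h1 : guess j ≤ guess (j + k) := le_trans (Nat.le_add_right _ _) ih
    have h2 := Nat.div_le_div_right (c := 200) h1
    rw [← add_assoc, guess, add_mul]
    omega

theorem guess_strictMono : StrictMono guess := strictMono_nat_of_lt_succ fun j => by
  rw [guess]; omega

theorem two_pow_le_guess (s : ℕ) : 2 ^ s ≤ guess (200 * s) := by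
  induction s with
  | zero => simp [guess]
  | succ s ih =>
    have h1 := guess_add_le (200 * s) 200
    have h2 := Nat.div_add_mod (guess (200 * s)) 200
    have h3 := Nat.mod_lt (guess (200 * s)) (show 200 > 0 by omega)
    rw [show 200 * (s + 1) = 200 * s + 200 by ring, pow_succ]
    omega

/-- The bounds that hold throughout the program: `X` on the numbers in the data, `B` on all numbers,
and `T` on an energy that every accepted exchange lowers. -/
structure Setup (B X T : ℕ) (σ : St) : Prop where
  fits : Fits X σ.inp σ.n σ.K
  lim_le : 2 * σ.lim + 1 ≤ X
  tot_le : σ.tot + 1 ≤ X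
  q_le : 1000 * (σ.n * (σ.K * (3 * σ.K + 3))) ≤ X
  mc_le : ∀ i < σ.n, 200 * σ.mc i ≤ X
  p_le : σ.p ≤ σ.n
  K_ne : σ.K ≠ 0
  pow_le : X ^ (9 * σ.K + 5) ≤ B
  energy : ∀ m < 3 * σ.K, ∃ E : ℕ → ℕ,
    (∀ a b, b * (1000 * (σ.n * (σ.K * (m + 3)))) <
      a * (1000 * (σ.n * (σ.K * (m + 3))) - 1) → E b < E a) ∧
    ∀ a ≤ X ^ (3 * m + 4), E a ≤ T

theorem SameInput.refl (σ : St) : SameInput σ σ := ⟨rfl, rfl, rfl, rfl, rfl, rfl, rfl⟩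

theorem SameInput.trans {σ τ υ : St} (h : SameInput σ τ) (h' : SameInput τ υ) : SameInput σ υ :=
  ⟨h'.1.trans h.1, h'.2.trans h.2, h'.3.trans h.3, h'.4.trans h.4, h'.5.trans h.5,
    h'.6.trans h.6, h'.7.trans h.7⟩

theorem Setup.of_same {B X T : ℕ} {σ τ : St} (h : Setup B X T σ) (hs : SameInput σ τ) :
    Setup B X T τ := by
  obtain ⟨h1, h2, h3, h4, h5, h6, h7⟩ := hs
  obtain ⟨k1, k2, k3, k4, k5, k6, k7, k8, k9⟩ := h
  rw [← h1, ← h3, ← h4] at k1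
  rw [← h7] at k2
  rw [← h6] at k3
  rw [← h3, ← h4] at k4
  rw [← h3, ← h2] at k5
  rw [← h3, ← h5] at k6
  rw [← h4] at k7 k8
  rw [← h3, ← h4] at k9
  exact ⟨k1, k2, k3, k4, k5, k6, k7, k8, k9⟩

theorem Handled.of_same {σ τ : St} (hs : SameInput σ τ) {C m b b' : ℕ} (h : Handled τ C m b)
    (hb : b' ≤ b) : Handled σ C m b' := by
  obtain ⟨h1, h2, h3, h4, h5, h6, h7⟩ := hs
  unfold Handled at h ⊢
  rw [h1, h2, h3, h4, h5] at h
  intro hc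
  obtain ⟨x, hx, hle⟩ := h hc
  exact ⟨x, hx, hb.trans hle⟩

theorem tGuess_mono (n K T : ℕ) {m m' : ℕ} (h : m ≤ m') : tGuess n K m T ≤ tGuess n K m' T := by
  unfold tGuess tSweep tTry tPot tTerm
  gcongr

/-- What holds between two rounds of the search for the best guess. -/
structure Progress (σ τ : St) : Prop where
  same : SameInput σ τ
  x_le : ∀ i, τ.x i ≤ 1
  best_le : τ.best ≤ σ.tot + 1
  recorded : Recorded τ

/-- Runs the search with all potentials for one guess. -/
def sizesProg : Program := forLt .m (lit 3 * Var.K) guessProg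

/-- Instruction count for `sizesProg`. -/
def tSizes (n K T : ℕ) : ℕ := (3 * K + 1) * (tGuess n K (3 * K) T + 20)

theorem sizes_does {B X T : ℕ} {σ τ : St} (h : Setup B X T σ) (hp : Progress σ τ)
    (hC : τ.C ≤ X) :
    ∃ τ', Does B sizesProg τ (tSizes σ.n σ.K T) τ' ∧ Progress σ τ' ∧ τ'.C = τ.C ∧
      τ'.best ≤ τ.best ∧ ∀ m < 3 * σ.K, Handled σ τ.C m τ'.best := by
  have hbig := h.fits.big
  have hK := h.fits.K_le
  have hXB : X ≤ B := (Nat.le_self_pow (by omega) X).trans h.pow_le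
  obtain ⟨υ, hd, hp', hC', hb', -, hh⟩ := Does.for (B := B) (v := .m) (e := lit 3 * Var.K)
    (a := guessProg) (c := tGuess σ.n σ.K (3 * σ.K) T) (N := 3 * σ.K)
    (fun t υ => Progress σ υ ∧ υ.C = τ.C ∧ υ.best ≤ τ.best ∧ υ.m = t ∧
      ∀ m < t, Handled σ τ.C m υ.best)
    τ (by omega) (by simp; omega)
    (fun t υ ht => by
      obtain ⟨hp', -, -, hm, -⟩ := ht
      have := hp'.same.K
      exact ⟨by simp [St.get]; omega, by simp [St.get]; omega, hm⟩)
    ⟨⟨⟨hp.1.1, hp.1.2, hp.1.3, hp.1.4, hp.1.5, hp.1.6, hp.1.7⟩, hp.2, hp.3, hp.4⟩, rfl, le_rfl, rfl,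
      by simp⟩
    (fun t ht υ hυ => by
      obtain ⟨hp', hC', hb', hm, hh⟩ := hυ
      have hs := h.of_same hp'.same
      have eK := hp'.same.K
      have en := hp'.same.n
      obtain ⟨E, hE, hT⟩ := hs.energy t (by omega)
      have hq : 1000 * (υ.n * (υ.K * (υ.m + 3))) ≤ X := le_trans (by gcongr; omega) hs.q_le
      have hbest := hp'.best_le
      have htot := h.tot_le
      obtain ⟨υ', hd, h1, h2, h3, h4, h5, h6, h7⟩ := guess_does (B := B) (X := X) (T := T) (σ := υ)
        ⟨hs.fits, show υ.m + 3 ≤ X by omega, show υ.C ≤ X by omega, hq, hs.mc_le, hs.p_le, hs.K_ne,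
          le_trans (Nat.pow_le_pow_right (by omega) (by
            show 3 * υ.m + 5 ≤ 9 * υ.K + 5; omega)) hs.pow_le⟩
        (E := E) (by rwa [hm]) (by rwa [hm]) hp'.x_le (by omega) hp'.recorded
      refine ⟨υ', hd.mono ?_, h3.trans hm, ⟨?_, h4, h5.trans hbest, h6⟩, h2.trans hC',
        h5.trans hb', rfl, fun m hm' => ?_⟩
      · rw [en, eK]
        exact tGuess_mono _ _ _ (by omega)
      · have := hp'.same.trans h1
        exact ⟨this.1, this.2, this.3, this.4, this.5, this.6, this.7⟩
      · rcases Nat.lt_succ_iff_lt_or_eq.1 hm' with h8 | rfl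
        · exact (hh m h8).of_same (.refl σ) h5
        · rw [← hC', ← hm]
          exact h7.of_same hp'.same le_rfl)
  exact ⟨_, hd.mono (by simp [tSizes]; omega),
    ⟨⟨hp'.1.1, hp'.1.2, hp'.1.3, hp'.1.4, hp'.1.5, hp'.1.6, hp'.1.7⟩, hp'.2, hp'.3,
    hp'.4⟩, hC', hb', hh⟩

/-- Runs the search for all guesses below `lim`. -/
def guessesProg : Program :=
  whileDo (Var.lim - Var.C) (.seq sizesProg (assign .C (Var.C + (Var.C / lit 200 + lit 1))))

theorem guesses_does {B X T J : ℕ} {σ : St} (h : Setup B X T σ) (hp : Progress σ σ)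
    (hC : σ.C = 1) (hJ : σ.lim ≤ guess J) :
    ∃ τ, Does B guessesProg σ ((J + 1) * (tSizes σ.n σ.K T + 30)) τ ∧ Progress σ τ ∧
      ∀ j, guess j < σ.lim → ∀ m < 3 * σ.K, Handled σ (guess j) m τ.best := by
  have hbig := h.fits.big
  have hXB : X ≤ B := (Nat.le_self_pow (by omega) X).trans h.pow_le
  have hlim := h.lim_le
  obtain ⟨τ, f, hd, ⟨hp', hCX, j, hjC, -, -, hh⟩, hz⟩ := Does.while (B := B)
    (e := Var.lim - Var.C) (c := tSizes σ.n σ.K T + 11)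
    (a := .seq sizesProg (assign .C (Var.C + (Var.C / lit 200 + lit 1))))
    (fun f τ => Progress σ τ ∧ τ.C ≤ X ∧ ∃ j, τ.C = guess j ∧ j ≤ J ∧ f = J - j ∧
      ∀ j' < j, ∀ m < 3 * σ.K, Handled σ (guess j') m τ.best)
    (fun f τ hτ => by
      obtain ⟨hp', hCX, -⟩ := hτ
      have := hp'.same.lim
      simp [St.get]; omega)
    (by simp; omega)
    (fun f τ hτ hne => by
      obtain ⟨hp', hCX, j, hjC, hjJ, rfl, hh⟩ := hτ
      have e1 := hp'.same.lim
      have hlt : τ.C < σ.lim := by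
        simp [St.get] at hne; omega
      have hj : j < J := by
        rcases hjJ.lt_or_eq with h1 | rfl
        exacts [h1, by omega]
      obtain ⟨τ', hd, hp'', hC', hb', hh'⟩ := sizes_does h hp' hCX
      refine ⟨_, Does.mono (hd.seq (Does.assign_eq (n := 11)
        (σ' := { τ' with C := guess (j + 1) }) ?_ ?_ ?_ ?_)) le_rfl, J - (j + 1), by omega,
        ⟨⟨hp''.1.1, hp''.1.2, hp''.1.3, hp''.1.4, hp''.1.5, hp''.1.6, hp''.1.7⟩, hp''.2, hp''.3,
          hp''.4⟩, ?_, j + 1, rfl, by omega, rfl, fun j' hj' m hm => ?_⟩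
      · simp [St.get, hC']; omega
      · simp; omega
      · simp
      · simp [St.get, St.set, hC', hjC, guess]
      · simp only [guess, ← hjC]; omega
      · rcases Nat.lt_succ_iff_lt_or_eq.1 hj' with h8 | rfl
        · exact (hh j' h8 m hm).of_same (.refl σ) hb'
        · rw [← hjC]; exact hh' m hm)
    J σ ⟨hp, by omega, 0, hC, by omega, by omega, by simp⟩
  refine ⟨τ, hd.mono (by simp; ring_nf; omega), hp', fun j' hj' => hh j' ?_⟩
  have e1 := hp'.same.lim
  simp [St.get] at hz
  exact guess_strictMono.lt_iff_lt.1 (by omega)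

/-! ### The complete program -/

/-- The largest cost of item `i` over all scenarios. -/
def largest (inp : ℕ → ℕ) (n K i : ℕ) : ℕ :=
  (Finset.range K).sup fun S => inp (3 + (i + n * S))

/-- Fills `mc`, and sums it up in `tot`. -/
def largestProg : Program :=
  forLt .i Var.n <| .seq
    (forLt .S Var.K (writeArr .mc Var.i (read .mc Var.i +
      (read .inp (lit 3 + (Var.i + Var.n * Var.S)) - read .mc Var.i))))
    (assign .tot (Var.tot + read .mc Var.i))

/-- Instruction count for `largestProg`. -/
def tLargest (n K : ℕ) : ℕ := (n + 1) * ((K + 1) * 80 + 40)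

theorem largest_le {X : ℕ} {inp : ℕ → ℕ} {n K i : ℕ} (hX : Fits X inp n K) (hi : i < n) :
    largest inp n K i ≤ X :=
  Finset.sup_le fun _ hS => hX.inp_le _ (Finset.mem_range.1 hS) _ hi

theorem largest_does {B X : ℕ} {σ : St} (hX : Fits X σ.inp σ.n σ.K) (hB : X ≤ B)
    (h0 : σ.mc = 0) (h1 : σ.tot = 0) (h2 : σ.S = 0)
    (hsum : ∑ i ∈ Finset.range σ.n, largest σ.inp σ.n σ.K i ≤ X) :
    ∃ mc, Does B largestProg σ (tLargest σ.n σ.K) { σ with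
        mc := mc, tot := ∑ i ∈ Finset.range σ.n, largest σ.inp σ.n σ.K i, i := 0, S := 0 } ∧
      ∀ i < σ.n, mc i = largest σ.inp σ.n σ.K i := by
  have hbig := hX.big
  have hn := hX.n_le
  have hK := hX.K_le
  have ha := hX.addr
  obtain ⟨σ', hd, mc, rfl, h3, -⟩ := Does.for (B := B) (v := .i) (e := Var.n)
    (a := .seq
      (forLt .S Var.K (writeArr .mc Var.i (read .mc Var.i +
        (read .inp (lit 3 + (Var.i + Var.n * Var.S)) - read .mc Var.i))))
      (assign .tot (Var.tot + read .mc Var.i)))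
    (c := (σ.K + 1) * 80 + 20) (N := σ.n)
    (fun t τ => ∃ mc, τ = { σ with
      mc := mc, tot := ∑ i ∈ Finset.range t, largest σ.inp σ.n σ.K i, i := t, S := 0 } ∧
      (∀ i < t, mc i = largest σ.inp σ.n σ.K i) ∧ ∀ i, t ≤ i → mc i = 0)
    σ (by omega) (by simp; omega)
    (fun t τ ht => by
      obtain ⟨mc, rfl, -⟩ := ht
      exact ⟨by simp [St.get]; omega, rfl, rfl⟩)
    ⟨σ.mc, by cases σ; simp_all [St.set], by simp, by simp [h0]⟩
    (fun t ht τ hτ => by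
      obtain ⟨mc, rfl, h3, h4⟩ := hτ
      have hle := largest_le hX ht
      have hsum' : ∑ i ∈ Finset.range (t + 1), largest σ.inp σ.n σ.K i ≤ X :=
        (Finset.sum_le_sum_of_subset (Finset.range_subset_range.2 ht)).trans hsum
      have hsup : ∀ s ≤ σ.K,
          ((Finset.range s).sup fun S => σ.inp (3 + (t + σ.n * S))) ≤ X := fun s hs =>
        (Finset.sup_mono (Finset.range_subset_range.2 hs)).trans hle
      rw [Finset.sum_range_succ] at hsum'
      refine ⟨_, Does.mono (Does.seq (Does.for_seq (c := 50) (N := σ.K) (fun s => { σ with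
          mc := Function.update mc t ((Finset.range s).sup fun S => σ.inp (3 + (t + σ.n * S))),
          tot := ∑ i ∈ Finset.range t, largest σ.inp σ.n σ.K i, i := t, S := s })
          (by omega) (by simp; omega) (fun s hs => ⟨by simp [St.get]; omega, rfl, rfl⟩) ?_
          (fun s hs => ⟨{ σ with
            mc := Function.update mc t
              ((Finset.range (s + 1)).sup fun S => σ.inp (3 + (t + σ.n * S))),
            tot := ∑ i ∈ Finset.range t, largest σ.inp σ.n σ.K i, i := t, S := s }, ?_, rfl, rfl⟩))
        (Does.assign_eq (n := 15) (σ' := { σ with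
          mc := Function.update mc t (largest σ.inp σ.n σ.K t),
          tot := ∑ i ∈ Finset.range (t + 1), largest σ.inp σ.n σ.K i, i := t, S := 0 })
          ?_ ?_ ?_ ?_)) ?_, rfl, _, rfl, ?_, ?_⟩
      · have h5 : Function.update mc t 0 = mc := by
          have := Function.update_eq_self t mc
          rwa [h4 t le_rfl] at this
        simp [St.set, h5]
      · have e1 := hX.index hs ht
        have e2 := hX.inp_le _ hs _ ht
        have e3 := hsup s hs.le
        have hw := Does.write (B := B) { σ with
          mc := Function.update mc t ((Finset.range s).sup fun S => σ.inp (3 + (t + σ.n * S))),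
          tot := ∑ i ∈ Finset.range t, largest σ.inp σ.n σ.K i, i := t, S := s }
          .mc (var .i) (read .mc Var.i +
            (read .inp (lit 3 + (Var.i + Var.n * Var.S)) - read .mc Var.i))
          (by simp [St.get]; omega) (by simp [St.get]; omega)
          (by
            simp only [bdd_add, bdd_sub, bdd_var, bdd_read, bdd_lit, bdd_mul, eval_add, eval_sub,
              eval_var, eval_read, eval_mul, eval_lit, St.get, St.arr, Function.update_self]
            omega)
          (by simp; omega)
        have e4 : ((Finset.range s).sup fun S => σ.inp (3 + (t + σ.n * S))) +
            (σ.inp (3 + (t + σ.n * s)) - (Finset.range s).sup fun S => σ.inp (3 + (t + σ.n * S))) =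
            (Finset.range (s + 1)).sup fun S => σ.inp (3 + (t + σ.n * S)) := by
          simp only [Finset.range_add_one, Finset.sup_insert]
          omega
        simp only [St.write, St.get, St.arr, eval_add, eval_sub, eval_read, eval_var, eval_mul,
          eval_lit, Function.update_self, Function.update_idem, e4] at hw
        exact hw.mono (by simp)
      · have e3 := hsup σ.K le_rfl
        have e5 : ((Finset.range σ.K).sup fun S => σ.inp (3 + (t + σ.n * S))) =
          largest σ.inp σ.n σ.K t := rfl
        simp only [bdd_add, bdd_var, bdd_read, eval_var, eval_read, St.get, St.arr, St.set,
          Function.update_self, e5]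
        omega
      · simp; omega
      · simp
      · simp [St.get, St.arr, St.set, Finset.sum_range_succ, largest]
      · simp; omega
      · intro i hi
        by_cases hit : i = t
        · subst hit; simp
        · simpa [hit] using h3 i (by omega)
      · intro i hi
        exact (Function.update_of_ne (by omega) _ _).trans (h4 i (by omega)))
  exact ⟨mc, hd.mono (by simp [tLargest]; ring_nf; omega), h3⟩

/-- Writes the recorded selection to the output registers. -/
def outputProg : Program := forLt .i Var.n (writeArr .inp Var.i (read .y Var.i))

theorem output_does {B : ℕ} {σ : St} (hB : 10000 ≤ B) (hn : 8 * σ.n + 8 ≤ B)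
    (hy : ∀ i < σ.n, σ.y i ≤ B) :
    ∃ σ', Does B outputProg σ ((σ.n + 1) * 40) σ' ∧ ∀ i < σ.n, σ'.inp i = σ.y i := by
  obtain ⟨σ', hd, inp, rfl, h1⟩ := Does.for (B := B) (v := .i) (e := Var.n)
    (a := writeArr .inp Var.i (read .y Var.i)) (c := 20) (N := σ.n)
    (fun t τ => ∃ inp, τ = { σ with inp := inp, i := t } ∧ ∀ i < t, inp i = σ.y i)
    σ (by omega) (by simp; omega)
    (fun t τ ht => by
      obtain ⟨inp, rfl, -⟩ := ht
      exact ⟨by simp [St.get]; omega, rfl, rfl⟩)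
    ⟨σ.inp, rfl, by simp⟩
    (fun t ht τ hτ => by
      obtain ⟨inp, rfl, h1⟩ := hτ
      have := hy t ht
      refine ⟨_, Does.mono (Does.write _ _ _ _ ?_ ?_ ?_ ?_) ?_, rfl,
        Function.update inp t (σ.y t), rfl, ?_⟩
      · simp [St.get]; omega
      · simp [St.get]; omega
      · simp [St.get, St.arr]; omega
      · simp; omega
      · simp
      · intro i hi
        by_cases hit : i = t
        · subst hit; simp
        · simpa [hit] using h1 i (by omega))
  exact ⟨_, hd.mono (by simp), h1⟩

/-- The algorithm for instances with at least one item. -/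
def mainProg : Program :=
  .seq largestProg <| .seq (.seq (assign .best (Var.tot + lit 1)) <|
    .seq (assign .lim (lit 400 * Var.tot + lit 2)) (assign .C (lit 1))) <|
  .seq guessesProg outputProg

/-- The complete program. It stops at once if there are no items: then the number of scenarios is
not bounded by the length of the input, and a loop over them would not be polynomial. -/
def selectProg : Program :=
  .seq (.seq (assign .n (read .inp (lit 0))) <|
    .seq (assign .K (read .inp (lit 1))) (assign .p (read .inp (lit 2)))) <|
  cond Var.n mainProg skip

/-- The memory with input `inp` and empty work space. -/
def St.init (inp : ℕ → ℕ) : St :=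
  ⟨inp, 0, 0, 0, 0, 0, 0, 0, 0, 0, 0, 0, 0, 0, 0, 0, 0, 0, 0, 0, 0, 0, 0, 0, 0⟩

theorem select_does_zero {B : ℕ} {inp : ℕ → ℕ} (hB : 10000 ≤ B) (h0 : inp 0 = 0)
    (h1 : inp 1 ≤ B) (h2 : inp 2 ≤ B) :
    ∃ σ', Does B selectProg (St.init inp) 60 σ' := by
  refine ⟨_, Does.mono (Does.seq (Does.seq (Does.assign _ _ _ ?_ ?_) <|
    Does.seq (Does.assign _ _ _ ?_ ?_) <| Does.assign _ _ _ ?_ ?_) <|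
    Does.cond_neg ?_ ?_ ?_ (Does.skip _ (by omega))) ?_⟩
  all_goals simp [St.init, St.get, St.set, St.arr, h0]
  all_goals omega

/-- Correctness and running time of the program in terms of its data: for every guess and every
potential, the result is at least as good as some local optimum. -/
theorem select_does {B X T J : ℕ} {inp : ℕ → ℕ} {n K p tot : ℕ} (hn : inp 0 = n) (hK : inp 1 = K)
    (hp : inp 2 = p) (hn0 : n ≠ 0) (htot : ∑ i ∈ Finset.range n, largest inp n K i = tot)
    (h : ∀ mc : ℕ → ℕ, (∀ i < n, mc i = largest inp n K i) → Setup B X T { St.init inp with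
      n := n, K := K, p := p, mc := mc, tot := tot, lim := 400 * tot + 2 })
    (hJ : 400 * tot + 2 ≤ guess J) :
    ∃ (σ' : St) (y : ℕ → ℕ) (best : ℕ), Does B selectProg (St.init inp)
        (tLargest n K + (J + 1) * (tSizes n K T + 30) + (n + 1) * 40 + 150) σ' ∧
      (∀ i < n, σ'.inp i = y i) ∧
      (∀ i < n, y i ≤ 1) ∧
      (best ≤ tot → ∑ i ∈ Finset.range n, y i = p ∧ ∀ S < K, loadOf inp y n S ≤ best) ∧
      ∀ j, guess j < 400 * tot + 2 → ∀ m < 3 * K,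
        p ≤ cheapCount (largest inp n K) n (guess j) →
        ∃ x, LocalOpt inp (largest inp n K) n K p (guess j) m x ∧ best ≤ maxLoad inp x n K := by
  have hs₀ := h _ fun _ _ => rfl
  have hfits : Fits X inp n K := hs₀.fits
  have hbig := hfits.big
  have hn' := hfits.n_le
  have hK' := hfits.K_le
  have ha := hfits.addr
  have hXB : X ≤ B := (Nat.le_self_pow (by omega) X).trans hs₀.pow_le
  have htX : tot + 1 ≤ X := hs₀.tot_le
  have hlX : 2 * (400 * tot + 2) + 1 ≤ X := hs₀.lim_le
  have hpn : p ≤ n := hs₀.p_le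
  let σ₀ : St := { St.init inp with n := n, K := K, p := p }
  have d₀ : Does B (.seq (assign .n (read .inp (lit 0))) <|
      .seq (assign .K (read .inp (lit 1))) (assign .p (read .inp (lit 2))))
      (St.init inp) 30 σ₀ := by
    refine Does.mono (Does.seq (Does.assign_eq (n := 9) (σ' := { St.init inp with n := n })
      ?_ ?_ ?_ ?_) <| Does.seq (Does.assign_eq (n := 9)
      (σ' := { St.init inp with n := n, K := K }) ?_ ?_ ?_ ?_) <|
      Does.assign_eq (n := 9) ?_ ?_ ?_ ?_) ?_
    all_goals simp [σ₀, St.init, St.set, St.arr, hn, hK, hp]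
    all_goals omega
  obtain ⟨mc, d₁, hmc⟩ := largest_does (B := B) (X := X) (σ := σ₀) hfits hXB rfl rfl rfl
    (by change ∑ i ∈ Finset.range n, largest inp n K i ≤ X; omega)
  replace hmc : ∀ i < n, mc i = largest inp n K i := hmc
  replace d₁ : Does B largestProg σ₀ (tLargest n K) { σ₀ with mc := mc, tot := tot } := by
    rw [← htot]; exact d₁
  let σ₁ : St := { σ₀ with mc := mc, tot := tot, best := tot + 1, lim := 400 * tot + 2, C := 1 }
  have d₂ : Does B (.seq (assign .best (Var.tot + lit 1)) <|
      .seq (assign .lim (lit 400 * Var.tot + lit 2)) (assign .C (lit 1)))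
      { σ₀ with mc := mc, tot := tot } 30 σ₁ := by
    refine Does.mono (Does.seq (Does.assign_eq (n := 9)
      (σ' := { σ₀ with mc := mc, tot := tot, best := tot + 1 }) ?_ ?_ ?_ ?_) <|
      Does.seq (Does.assign_eq (n := 9) (σ' := { σ₀ with
        mc := mc, tot := tot, best := tot + 1, lim := 400 * tot + 2 }) ?_ ?_ ?_ ?_) <|
      Does.assign_eq (n := 9) ?_ ?_ ?_ ?_) ?_
    all_goals simp [σ₁, St.get, St.set]
    all_goals omega
  have hs₁ : Setup B X T σ₁ := (h mc hmc).of_same ⟨rfl, rfl, rfl, rfl, rfl, rfl, rfl⟩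
  obtain ⟨τ, d₃, hpr, hh⟩ := guesses_does hs₁
    ⟨.refl _, fun _ => Nat.zero_le _, le_rfl,
      ⟨fun _ _ => Nat.zero_le _, fun h => absurd h (Nat.not_succ_le_self tot)⟩⟩ rfl hJ
  have hrec := hpr.recorded
  unfold Recorded at hrec
  have eqs := hpr.same
  have e1 : τ.n = n := eqs.n
  have e2 : τ.K = K := eqs.K
  have e3 : τ.p = p := eqs.p
  have e4 : τ.tot = tot := eqs.tot
  have e5 : τ.inp = inp := eqs.inp
  rw [e1, e2, e3, e4, e5] at hrec
  obtain ⟨σ', d₄, hout⟩ := output_does (B := B) (σ := τ) (by omega) (by rw [e1]; omega)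
    (fun i hi => (hrec.1 i (e1 ▸ hi)).trans (by omega))
  rw [e1] at d₄ hout
  refine ⟨σ', τ.y, τ.best, Does.mono (d₀.seq <| Does.cond_pos ?_ ?_ ?_ <| d₁.seq <| d₂.seq <|
    d₃.seq d₄) ?_, hout, hrec.1, hrec.2, fun j hj m hm hc => ?_⟩
  · simp [σ₀, St.get]; omega
  · simp; omega
  · simpa [σ₀, St.get] using hn0
  · simp [σ₁, σ₀]; omega
  · obtain ⟨x, ⟨hx, hopt⟩, hle⟩ := hh j hj m hm (hc.trans_eq (Finset.sum_congr rfl fun i hi => by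
      change _ = 1 - (200 * mc i - guess j)
      rw [hmc i (Finset.mem_range.1 hi)]))
    exact ⟨x, ⟨⟨hx.le_one, hx.card, fun i hi h1 => hmc i hi ▸ hx.cheap i hi h1⟩,
      fun i hi k hk h1 h2 h3 => hopt i hi k hk h1 h2
        (show 200 * mc k ≤ _ by rwa [hmc k hk])⟩, hle⟩

end RAM

/-! ### Falling factorials and the drift of the potential -/

namespace RAM

/-- The truncated falling factorial. -/
noncomputable def fall (k : ℕ) (z : ℝ) : ℝ := ∏ j ∈ Finset.range k, max (z - j) 0

/-- The penalty `2 z + ∑ k ∈ [2, m + 2], z (z - 1) ⋯ (z - k + 1) / (k - 1)` of a load `z`, with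
truncated factors. -/
noncomputable def penalty (m : ℕ) (z : ℝ) : ℝ :=
  2 * fall 1 z + ∑ k ∈ Finset.range (m + 1), fall (k + 2) z / (k + 1)

theorem fall_nonneg (k : ℕ) (z : ℝ) : 0 ≤ fall k z :=
  Finset.prod_nonneg fun _ _ => le_max_right _ _

theorem fall_mono (k : ℕ) : Monotone (fall k) := fun _ _ h =>
  Finset.prod_le_prod (fun _ _ => le_max_right _ _) fun _ _ => by gcongr

theorem fall_succ (k : ℕ) (z : ℝ) : fall (k + 1) z = fall k z * max (z - k) 0 :=
  Finset.prod_range_succ _ _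

theorem fall_one (z : ℝ) : fall 1 z = max z 0 := by simp [fall]

theorem fall_sub_one (k : ℕ) {z : ℝ} (hz : 0 ≤ z) : z * fall k (z - 1) = fall (k + 1) z := by
  unfold fall
  rw [Finset.prod_range_succ', mul_comm]
  congr 1
  · refine Finset.prod_congr rfl fun j _ => ?_
    push_cast
    ring_nf
  · simp [hz]

theorem fall_add_one (k : ℕ) {z : ℝ} (hz : 0 ≤ z) :
    fall (k + 1) (z + 1) = (z + 1) * fall k z := by
  rw [← fall_sub_one k (by linarith : (0 : ℝ) ≤ z + 1), add_sub_cancel_right]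

theorem fall_convex (k : ℕ) : ConvexOn ℝ Set.univ (fall k) := by
  induction k with
  | zero =>
    have : fall 0 = fun _ => (1 : ℝ) := by funext z; simp [fall]
    rw [this]
    exact convexOn_const _ convex_univ
  | succ k ih =>
    have h1 : ConvexOn ℝ Set.univ fun z : ℝ => max (z - k) 0 :=
      ((convexOn_id convex_univ).sub (concaveOn_const _ convex_univ)).sup
        (convexOn_const _ convex_univ)
    have h2 := ih.mul h1 (fun z _ => fall_nonneg k z) (fun z _ => le_max_right _ _)
      (((fall_mono k).monovary (fun x y h => by
        show max (x - (k : ℝ)) 0 ≤ max (y - k) 0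
        gcongr)).monovaryOn _)
    have : fall (k + 1) = fall k * fun z : ℝ => max (z - k) 0 := by
      funext z; simp [fall_succ]
    rw [this]
    exact h2

theorem penalty_convex (m : ℕ) : ConvexOn ℝ Set.univ (penalty m) := by
  have h1 : ConvexOn ℝ Set.univ fun z => 2 * fall 1 z := by
    simpa using (fall_convex 1).smul (c := (2 : ℝ)) (by norm_num)
  have h2 : ∀ n : ℕ, ConvexOn ℝ Set.univ fun z =>
      ∑ k ∈ Finset.range n, fall (k + 2) z / ((k : ℝ) + 1) := by
    intro n
    induction n with
    | zero => simpa using convexOn_const (0 : ℝ) convex_univ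
    | succ n ih =>
      simp only [Finset.sum_range_succ]
      refine ih.add ?_
      have := (fall_convex (n + 2)).smul (c := ((n : ℝ) + 1)⁻¹) (by positivity)
      simpa [div_eq_inv_mul] using this
  exact h1.add (h2 (m + 1))

theorem penalty_mono (m : ℕ) : Monotone (penalty m) := fun x y h => by
  unfold penalty
  gcongr <;> exact fall_mono _ h

theorem penalty_succ (m : ℕ) (z : ℝ) :
    penalty (m + 1) z = penalty m z + fall (m + 3) z / (m + 2) := by
  unfold penalty
  rw [Finset.sum_range_succ _ (m + 1)]
  push_cast
  ring

/-- `z` times the decrease of `φ` on the removal of a unit load, minus its increase on the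
addition of one: to first order, the gain from replacing a load `z` by a load `1`. -/
noncomputable def drift (φ : ℝ → ℝ) (z : ℝ) : ℝ :=
  z * (φ z - φ (z - 1)) - (φ (z + 1) - φ z)

/-- Falling factorials telescope: the drift of each is the difference of two consecutive ones, with
coefficients that are constant for large `z`. -/
theorem fall_drift (k : ℕ) {z : ℝ} (hz : 0 ≤ z) :
    drift (fall (k + 1)) z = fall (k + 1) z * min z (k + 1) - fall k z * min (z + 1) (k + 1) := by
  have h1 := fall_sub_one (k + 1) hz
  have h2 := fall_add_one k hz
  have h3 := fall_succ (k + 1) z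
  have h4 := fall_succ k z
  have e1 : min z ((k : ℝ) + 1) = z - max (z - (k + 1 : ℕ)) 0 := by
    push_cast
    rcases le_total z (k + 1) with h | h
    · rw [min_eq_left h, max_eq_right (by linarith)]; ring
    · rw [min_eq_right h, max_eq_left (by linarith)]; ring
  have e2 : min (z + 1) ((k : ℝ) + 1) = z + 1 - max (z - k) 0 := by
    rcases le_total z k with h | h
    · rw [min_eq_left (by linarith), max_eq_right (by linarith)]; ring
    · rw [min_eq_right (by linarith), max_eq_left (by linarith)]; ring
  unfold drift
  rw [mul_sub, h1, h2, h3, e1, e2]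
  linear_combination h4

theorem fall_eq_zero {k : ℕ} {z : ℝ} (h : z ≤ k) : fall (k + 1) z = 0 := by
  rw [fall_succ, max_eq_right (by linarith), mul_zero]

/-- The coefficients `1 / (k - 1)` of the penalty are chosen such that its telescoping sum leaves
only the first and the last term. -/
theorem drift_penalty (m : ℕ) {z : ℝ} (hz : 0 ≤ z) :
    -2 + min 0 (z ^ 2 - z) + fall (m + 2) z * min z (m + 2) / (m + 1) ≤ drift (penalty m) z := by
  induction m with
  | zero =>
    have e : drift (penalty 0) z = 2 * drift (fall 1) z + drift (fall 2) z := by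
      simp only [drift, penalty, zero_add, Finset.sum_range_one, Nat.cast_zero, div_one]
      ring
    have h1 := fall_drift 0 hz
    have h2 := fall_drift 1 hz
    have e0 : fall 0 z = 1 := by simp [fall]
    have e1 : fall 1 z = z := by rw [fall_one, max_eq_left hz]
    norm_num [e0, e1] at h1 h2
    rw [e, h1, h2]
    norm_num
    rcases le_total z 1 with h | h
    · rw [min_eq_left h, min_eq_left (by linarith : z + 1 ≤ 2),
        min_eq_right (by linarith : 1 ≤ z + 1), min_eq_right (by nlinarith : z ^ 2 - z ≤ 0)]
      nlinarith
    · rw [min_eq_right h, min_eq_right (by linarith : 2 ≤ z + 1),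
        min_eq_right (by linarith : 1 ≤ z + 1), min_eq_left (by nlinarith : 0 ≤ z ^ 2 - z)]
      nlinarith
  | succ m ih =>
    have e : drift (penalty (m + 1)) z =
        drift (penalty m) z + drift (fall (m + 3)) z / (m + 2) := by
      simp only [drift, penalty_succ]
      ring
    have h1 := fall_drift (m + 2) hz
    have key : fall (m + 2) z * min (z + 1) (m + 3) / (m + 2) ≤
        fall (m + 2) z * min z (m + 2) / (m + 1) := by
      rcases le_total z (m + 1) with h | h
      · rw [fall_eq_zero (by push_cast; linarith)]; simp
      · rw [mul_div_assoc, mul_div_assoc]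
        refine mul_le_mul_of_nonneg_left ?_ (fall_nonneg _ _)
        rw [div_le_div_iff₀ (by positivity) (by positivity)]
        rcases le_total z (m + 2) with h' | h'
        · rw [min_eq_left h', min_eq_left (by linarith)]; nlinarith
        · rw [min_eq_right h', min_eq_right (by linarith)]; nlinarith
    push_cast at h1 ⊢
    rw [e, h1]
    have e3 : (m : ℝ) + 2 + 1 = m + 3 := by ring
    have e4 : (m : ℝ) + 1 + 2 = m + 3 := by ring
    have e5 : (m : ℝ) + 1 + 1 = m + 2 := by ring
    rw [e3, e4, e5, sub_div]
    linarith

theorem drift_penalty_ge (m : ℕ) {z : ℝ} (hz : 0 ≤ z) : -(9 / 4) ≤ drift (penalty m) z := by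
  have h1 := drift_penalty m hz
  have h2 : 0 ≤ fall (m + 2) z * min z (m + 2) / (m + 1) := by
    have := fall_nonneg (m + 2) z
    have : 0 ≤ min z ((m : ℝ) + 2) := le_min hz (by positivity)
    positivity
  have h3 : -(1 / 4) ≤ min 0 (z ^ 2 - z) :=
    le_min (by norm_num) (by nlinarith [sq_nonneg (z - 1 / 2)])
  linarith

theorem drift_penalty_ge_fall (m : ℕ) {z : ℝ} (hz : m + 2 ≤ z) :
    -(9 / 4) + fall (m + 2) z ≤ drift (penalty m) z := by
  have h0 : (0 : ℝ) ≤ z := le_trans (by positivity) hz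
  have h1 := drift_penalty m h0
  have h2 : fall (m + 2) z ≤ fall (m + 2) z * min z (m + 2) / (m + 1) := by
    rw [min_eq_right hz, le_div_iff₀ (by positivity)]
    have := fall_nonneg (m + 2) z
    nlinarith
  have h3 : -(1 / 4) ≤ min 0 (z ^ 2 - z) :=
    le_min (by norm_num) (by nlinarith [sq_nonneg (z - 1 / 2)])
  linarith

theorem fall_le_fall {k l : ℕ} (h : k ≤ l) {z : ℝ} (hz : l ≤ z) : fall k z ≤ fall l z := by
  induction l, h using Nat.le_induction with
  | base => exact le_rfl
  | succ l h ih =>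
    push_cast at hz
    rw [fall_succ]
    refine (ih (by linarith)).trans (le_mul_of_one_le_right (fall_nonneg _ _) ?_)
    exact le_max_of_le_left (by linarith)

/-- For large `z`, the last falling factorial dominates the penalty. -/
theorem penalty_le (m : ℕ) {z : ℝ} (hz : m + 2 ≤ z) : penalty m z ≤ (m + 3) * fall (m + 2) z := by
  have h1 : fall 1 z ≤ fall (m + 2) z := fall_le_fall (by omega) (by push_cast; linarith)
  have h2 : ∑ k ∈ Finset.range (m + 1), fall (k + 2) z / ((k : ℝ) + 1) ≤
      ∑ k ∈ Finset.range (m + 1), fall (m + 2) z := by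
    refine Finset.sum_le_sum fun k hk => ?_
    have hk := Finset.mem_range.1 hk
    have hk0 : (0 : ℝ) ≤ k := Nat.cast_nonneg k
    refine (div_le_self (fall_nonneg _ _) (by linarith)).trans ?_
    exact fall_le_fall (by omega) (by push_cast; linarith)
  simp at h2
  unfold penalty
  linarith

theorem convex_combination {φ : ℝ → ℝ} (hφ : ConvexOn ℝ Set.univ φ) (x y : ℝ) {a b : ℝ}
    (ha : 0 ≤ a) (hb : 0 ≤ b) (hab : a + b = 1) : φ (a * x + b * y) ≤ a * φ x + b * φ y :=
  hφ.2 trivial trivial ha hb hab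

theorem convex_exchange {φ : ℝ → ℝ} (hφ : ConvexOn ℝ Set.univ φ)
    {z a b : ℝ} (ha : 0 ≤ a) (hb : 0 ≤ b) :
    φ (z - b + a) + φ z ≤ φ (z + a) + φ (z - b) := by
  rcases (add_nonneg ha hb).eq_or_lt with h | h
  · have : a = 0 := by linarith
    subst this
    have : b = 0 := by linarith
    subst this
    simp
  · have h1 := convex_combination hφ (z - b) (z + a) (a := b / (a + b))
      (b := a / (a + b)) (by positivity) (by positivity) (by field_simp; ring)
    have h2 := convex_combination hφ (z - b) (z + a) (a := a / (a + b))
      (b := b / (a + b)) (by positivity) (by positivity) (by field_simp)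
    have e1 : b / (a + b) * (z - b) + a / (a + b) * (z + a) = z - b + a := by field_simp; ring
    have e2 : a / (a + b) * (z - b) + b / (a + b) * (z + a) = z := by field_simp; ring
    rw [e1] at h1
    rw [e2] at h2
    have e3 : b / (a + b) * φ (z - b) + a / (a + b) * φ (z + a) +
      (a / (a + b) * φ (z - b) + b / (a + b) * φ (z + a)) = φ (z + a) + φ (z - b) := by
      field_simp; ring
    linarith

theorem convex_add_le {φ : ℝ → ℝ} (hφ : ConvexOn ℝ Set.univ φ) {z a : ℝ} (ha : 0 ≤ a)
    (ha1 : a ≤ 1) : φ (z + a) - φ z ≤ a * (φ (z + 1) - φ z) := by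
  have h1 := convex_combination hφ z (z + 1) (a := 1 - a) (b := a) (by linarith) ha
    (by ring)
  rw [show (1 - a) * z + a * (z + 1) = z + a by ring] at h1
  linarith

theorem convex_le_sub {φ : ℝ → ℝ} (hφ : ConvexOn ℝ Set.univ φ) {z a : ℝ} (ha : 0 ≤ a)
    (ha1 : a ≤ 1) : a * (φ z - φ (z - 1)) ≤ φ z - φ (z - a) := by
  have h1 := convex_combination hφ z (z - 1) (a := 1 - a) (b := a) (by linarith) ha
    (by ring)
  rw [show (1 - a) * z + a * (z - 1) = z - a by ring] at h1
  linarith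

theorem convex_sub_le {φ : ℝ → ℝ} (hφ : ConvexOn ℝ Set.univ φ) {z a : ℝ} (ha : 0 ≤ a) :
    φ z - φ (z - a) ≤ a * (φ (z + 1) - φ z) := by
  have h1 := convex_combination hφ (z - a) (z + 1) (a := 1 / (1 + a))
    (b := a / (1 + a)) (by positivity) (by positivity) (by field_simp)
  rw [show 1 / (1 + a) * (z - a) + a / (1 + a) * (z + 1) = z by field_simp; ring] at h1
  have h2 : (1 + a) * φ z ≤ φ (z - a) + a * φ (z + 1) := by
    calc _ ≤ (1 + a) * (1 / (1 + a) * φ (z - a) + a / (1 + a) * φ (z + 1)) := by gcongr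
      _ = _ := by field_simp
  linarith

/-- The exchange argument. Let `A` be selected, let `D` be the items that may replace those of `A`,
and `ξ` a fractional selection of the same size with loads at most `1`. If no exchange lowers the
sum of the convex function `φ` over the loads by more than `θ`, then averaging over the exchanges of
`i` for `j` with weights `(1 - ξ i) ξ j` bounds the sum of the drifts. -/
theorem sum_drift_le {ι κ : Type*} {φ : ℝ → ℝ} (hφ : ConvexOn ℝ Set.univ φ)
    (hmono : Monotone φ) (A D : Finset ι) (s : Finset κ)
    (a : κ → ι → ℝ) (ξ : ι → ℝ) {θ : ℝ}
    (haA : ∀ S ∈ s, ∀ i ∈ A, 0 ≤ a S i ∧ a S i ≤ 1) (haD : ∀ S ∈ s, ∀ i ∈ D, 0 ≤ a S i ∧ a S i ≤ 1)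
    (hA : ∀ i ∈ A, 0 ≤ ξ i ∧ ξ i ≤ 1) (hD : ∀ i ∈ D, 0 ≤ ξ i)
    (hsum : ∑ i ∈ A, ξ i + ∑ i ∈ D, ξ i = A.card)
    (hload : ∀ S ∈ s, ∑ i ∈ A, a S i * ξ i + ∑ i ∈ D, a S i * ξ i ≤ 1)
    (hθ : 0 ≤ θ)
    (hopt : ∀ i ∈ A, ∀ j ∈ D, ∑ S ∈ s, φ (∑ l ∈ A, a S l) - θ ≤
      ∑ S ∈ s, φ (∑ l ∈ A, a S l - a S i + a S j)) :
    ∑ S ∈ s, drift φ (∑ l ∈ A, a S l) ≤ A.card * θ := by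
  set z : κ → ℝ := fun S => ∑ l ∈ A, a S l with hz
  let R : ι → ℝ := fun i => ∑ S ∈ s, (φ (z S) - φ (z S - a S i))
  let U : ι → ℝ := fun j => ∑ S ∈ s, (φ (z S + a S j) - φ (z S))
  have hRU : ∀ i ∈ A, ∀ j ∈ D, R i ≤ U j + θ := by
    intro i hi j hj
    have h1 := hopt i hi j hj
    have h2 : ∑ S ∈ s, φ (z S - a S i + a S j) ≤
        ∑ S ∈ s, (φ (z S + a S j) + φ (z S - a S i) - φ (z S)) := by
      refine Finset.sum_le_sum fun S hS => ?_
      have := convex_exchange hφ (z := z S) (haD S hS j hj).1 (haA S hS i hi).1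
      linarith
    simp only [R, U, Finset.sum_sub_distrib, Finset.sum_add_distrib] at h2 ⊢
    linarith
  set F : ℝ := ∑ j ∈ D, ξ j with hF
  have hF' : ∑ i ∈ A, (1 - ξ i) = F := by
    rw [Finset.sum_sub_distrib]; simp; linarith
  have hF0 : 0 ≤ F := Finset.sum_nonneg hD
  have hFA : F ≤ A.card := by
    have : 0 ≤ ∑ i ∈ A, ξ i := Finset.sum_nonneg fun i hi => (hA i hi).1
    linarith
  -- The averaged gain of the removals is at most the averaged loss of the insertions. If `F = 0`,
  -- there is nothing to exchange, and the weights cannot be normalized.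
  have hmain : ∑ i ∈ A, (1 - ξ i) * R i ≤ ∑ j ∈ D, ξ j * U j + F * θ := by
    rcases hF0.eq_or_lt with h0 | h0
    · have e1 : ∀ j ∈ D, ξ j = 0 := (Finset.sum_eq_zero_iff_of_nonneg hD).1 h0.symm
      have e2 : ∀ i ∈ A, 1 - ξ i = 0 := (Finset.sum_eq_zero_iff_of_nonneg fun i hi => by
        linarith [(hA i hi).2]).1 (hF'.trans h0.symm)
      rw [Finset.sum_eq_zero fun i hi => by rw [e2 i hi, zero_mul],
        Finset.sum_eq_zero fun i hi => by rw [e1 i hi, zero_mul], ← h0]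
      simp
    · have h1 : ∑ i ∈ A, ∑ j ∈ D, (1 - ξ i) * ξ j * R i ≤
          ∑ i ∈ A, ∑ j ∈ D, (1 - ξ i) * ξ j * (U j + θ) := by
        refine Finset.sum_le_sum fun i hi => Finset.sum_le_sum fun j hj => ?_
        exact mul_le_mul_of_nonneg_left (hRU i hi j hj)
          (mul_nonneg (by linarith [(hA i hi).2]) (hD j hj))
      have e1 : ∑ i ∈ A, ∑ j ∈ D, (1 - ξ i) * ξ j * R i = F * ∑ i ∈ A, (1 - ξ i) * R i := by
        rw [hF, Finset.sum_mul_sum, Finset.sum_comm]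
        exact Finset.sum_congr rfl fun _ _ => Finset.sum_congr rfl fun _ _ => by ring
      have e2 : ∑ i ∈ A, ∑ j ∈ D, (1 - ξ i) * ξ j * (U j + θ) =
          F * (∑ j ∈ D, ξ j * U j + F * θ) := by
        have : ∑ j ∈ D, ξ j * U j + F * θ = ∑ j ∈ D, ξ j * (U j + θ) := by
          rw [hF, Finset.sum_mul, ← Finset.sum_add_distrib]
          exact Finset.sum_congr rfl fun _ _ => by ring
        rw [this]
        conv_rhs => rw [← hF', Finset.sum_mul_sum]
        exact Finset.sum_congr rfl fun _ _ => Finset.sum_congr rfl fun _ _ => by ring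
      rw [e1, e2] at h1
      exact le_of_mul_le_mul_left h1 h0
  have hU : ∑ j ∈ D, ξ j * U j ≤ ∑ S ∈ s, (φ (z S + 1) - φ (z S)) * ∑ j ∈ D, a S j * ξ j := by
    simp only [U, Finset.mul_sum]
    rw [Finset.sum_comm]
    refine Finset.sum_le_sum fun S hS => Finset.sum_le_sum fun j hj => ?_
    have := mul_le_mul_of_nonneg_left
      (convex_add_le hφ (z := z S) (haD S hS j hj).1 (haD S hS j hj).2) (hD j hj)
    linarith
  have hR : ∑ S ∈ s, (z S * (φ (z S) - φ (z S - 1)) -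
      (φ (z S + 1) - φ (z S)) * ∑ i ∈ A, a S i * ξ i) ≤ ∑ i ∈ A, (1 - ξ i) * R i := by
    simp only [R, Finset.mul_sum]
    rw [Finset.sum_comm]
    refine Finset.sum_le_sum fun S hS => ?_
    rw [hz, Finset.sum_mul, ← Finset.sum_sub_distrib]
    refine Finset.sum_le_sum fun i hi => ?_
    have h1 := convex_le_sub hφ (z := z S) (haA S hS i hi).1 (haA S hS i hi).2
    have h2 := mul_le_mul_of_nonneg_left (convex_sub_le hφ (z := z S) (haA S hS i hi).1)
      (hA i hi).1
    simp only [hz] at h1 h2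
    linarith
  have hfin : ∑ S ∈ s, drift φ (z S) ≤
      ∑ S ∈ s, (z S * (φ (z S) - φ (z S - 1)) -
        (φ (z S + 1) - φ (z S)) * ∑ i ∈ A, a S i * ξ i) -
      ∑ S ∈ s, (φ (z S + 1) - φ (z S)) * ∑ j ∈ D, a S j * ξ j := by
    rw [← Finset.sum_sub_distrib]
    refine Finset.sum_le_sum fun S hS => ?_
    have h1 : 0 ≤ φ (z S + 1) - φ (z S) := sub_nonneg.2 (hmono (by linarith))
    have h2 := mul_le_mul_of_nonneg_left (hload S hS) h1
    unfold drift
    linarith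
  have : F * θ ≤ A.card * θ := mul_le_mul_of_nonneg_right hFA hθ
  linarith

theorem chain_eq {C c : ℕ} (hC : C ≠ 0) (m : ℕ) :
    ((chain C c m).1 : ℝ) = m.factorial * C ^ (m + 2) * fall (m + 2) (c / C) ∧
    ((chain C c m).2 : ℝ) = (m + 1).factorial * C ^ (m + 2) * penalty m (c / C) := by
  have hC' : (C : ℝ) ≠ 0 := Nat.cast_ne_zero.2 hC
  have hsub : ∀ k : ℕ, ((c - k * C : ℕ) : ℝ) = C * max ((c : ℝ) / C - k) 0 := by
    intro k
    rw [mul_max_of_nonneg _ _ (Nat.cast_nonneg C), mul_zero, mul_sub, mul_div_cancel₀ _ hC']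
    rcases le_total (k * C) c with h | h
    · rw [Nat.cast_sub h, max_eq_left]
      · push_cast; ring
      · have : ((k * C : ℕ) : ℝ) ≤ c := Nat.cast_le.2 h
        push_cast at this; linarith
    · rw [Nat.sub_eq_zero_of_le h, max_eq_right]
      · simp
      · have : (c : ℝ) ≤ (k * C : ℕ) := Nat.cast_le.2 h
        push_cast at this; linarith
  induction m with
  | zero =>
    have h0 : (c : ℝ) = C * fall 1 (c / C) := by
      have := hsub 0
      rw [fall_one]
      simpa using this
    have h1 := hsub 1
    have h2 := fall_succ 1 ((c : ℝ) / C)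
    simp only [one_mul] at h1
    simp only [chain, penalty]
    push_cast
    rw [h1]
    norm_num [h2]
    constructor
    · nth_rewrite 1 [h0]; ring
    · nth_rewrite 1 [h0]
      nth_rewrite 2 [h0]
      ring
  | succ m ih =>
    have h1 := hsub (m + 2)
    have h2 : fall (m + 3) ((c : ℝ) / C) =
        fall (m + 2) ((c : ℝ) / C) * max ((c : ℝ) / C - ((m + 2 : ℕ) : ℝ)) 0 :=
      fall_succ (m + 2) _
    have h3 := penalty_succ m ((c : ℝ) / C)
    have h4 : (m : ℝ) + 2 ≠ 0 := by positivity
    simp only [chain]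
    push_cast [Nat.factorial_succ] at ih h1 h2 ⊢
    rw [show m + 1 + 2 = m + 3 from rfl, ih.1, ih.2, h3, h1, h2]
    generalize max ((c : ℝ) / C - (m + 2)) 0 = d
    constructor
    · ring
    · field_simp
      ring

/-! ### The loads of a local optimum -/

theorem potential_eq {inp x : ℕ → ℕ} {n K C m : ℕ} (hC : C ≠ 0) :
    (potential inp x n K C m : ℝ) = (m + 1).factorial * C ^ (m + 2) *
      ∑ S ∈ Finset.range K, penalty m ((200 * loadOf inp x n S : ℕ) / C) := by
  unfold potential
  rw [Nat.cast_sum, Finset.mul_sum]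
  exact Finset.sum_congr rfl fun S _ => (chain_eq hC m).2

/-- If the linear program has a solution for the value `C / 200`, then the loads of a local optimum
are less than `R` times this value. Otherwise, the last falling factorial in the drift of the
largest load would outweigh the contributions of at least `-9 / 4` of all scenarios. -/
theorem fall_load_le {inp mc x : ℕ → ℕ} {n K p C m : ℕ} (hC : C ≠ 0) (hn : n ≠ 0) (hp : p ≤ n)
    (hopt : LocalOpt inp mc n K p C m x)
    (hmc : ∀ S < K, ∀ i < n, inp (3 + (i + n * S)) ≤ mc i) (ξ : ℕ → ℝ)
    (hξ : ∀ i < n, 200 * mc i ≤ C → 0 ≤ ξ i ∧ ξ i ≤ 1) (hξ0 : ∀ i < n, C < 200 * mc i → ξ i = 0)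
    (hsum : ∑ i ∈ Finset.range n, ξ i = p)
    (hload : ∀ S < K, ∑ i ∈ Finset.range n, 200 * (inp (3 + (i + n * S)) : ℝ) * ξ i ≤ C)
    {R : ℝ} (hR : m + 2 ≤ R) (hF : 9 / 4 * K < 999 / 1000 * fall (m + 2) R) {S : ℕ} (hS : S < K) :
    200 * (loadOf inp x n S : ℝ) < R * C := by
  obtain ⟨hx, hopt⟩ := hopt
  have hC0 : (0 : ℝ) < C := Nat.cast_pos.2 (Nat.pos_of_ne_zero hC)
  let A := (Finset.range n).filter fun i => x i = 1
  let D := (Finset.range n).filter fun i => x i = 0 ∧ 200 * mc i ≤ C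
  let a : ℕ → ℕ → ℝ := fun S i => 200 * (inp (3 + (i + n * S)) : ℝ) / C
  have hx01 : ∀ i, x i = 0 ∨ x i = 1 := fun i => by have := hx.le_one i; omega
  have hcheap : ∀ i < n, 200 * mc i ≤ C → ∀ S ∈ Finset.range K, 0 ≤ a S i ∧ a S i ≤ 1 := by
    intro i hi hc S hS
    refine ⟨by positivity, (div_le_one hC0).2 ?_⟩
    have := hmc S (Finset.mem_range.1 hS) i hi
    exact_mod_cast (Nat.mul_le_mul_left 200 this).trans hc
  have hAn : ∀ i ∈ A, i < n ∧ x i = 1 ∧ 200 * mc i ≤ C := fun i hi => by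
    obtain ⟨h1, h2⟩ := Finset.mem_filter.1 hi
    have h1 := Finset.mem_range.1 h1
    exact ⟨h1, h2, hx.cheap i h1 h2⟩
  have hDn : ∀ i ∈ D, i < n ∧ x i = 0 ∧ 200 * mc i ≤ C := fun i hi => by
    obtain ⟨h1, h2⟩ := Finset.mem_filter.1 hi
    exact ⟨Finset.mem_range.1 h1, h2⟩
  have hsplit : ∀ w : ℕ → ℝ, ∑ i ∈ A, w i * ξ i + ∑ i ∈ D, w i * ξ i =
      ∑ i ∈ Finset.range n, w i * ξ i := by
    intro w
    rw [← Finset.sum_filter_add_sum_filter_not (Finset.range n) (fun i => x i = 1)]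
    congr 1
    refine Finset.sum_subset (fun i hi => ?_) fun i hi hi' => ?_
    · have := hDn i hi
      exact Finset.mem_filter.2 ⟨Finset.mem_range.2 this.1, by omega⟩
    · obtain ⟨h1, h2⟩ := Finset.mem_filter.1 hi
      have h1 := Finset.mem_range.1 h1
      have h3 : C < 200 * mc i := by
        by_contra hcon
        exact hi' (Finset.mem_filter.2 ⟨Finset.mem_range.2 h1, by have := hx01 i; omega, by omega⟩)
      rw [hξ0 i h1 h3, mul_zero]
  have hxsum : ∀ w : ℕ → ℕ, ∑ i ∈ Finset.range n, x i * w i = ∑ i ∈ A, w i := by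
    intro w
    rw [Finset.sum_filter]
    refine Finset.sum_congr rfl fun i _ => ?_
    rcases hx01 i with h | h <;> simp [h]
  have hcard : A.card = p := by
    have := hxsum fun _ => 1
    simp only [mul_one, hx.card] at this
    simpa using this.symm
  have hz : ∀ S, ∑ l ∈ A, a S l = (200 * loadOf inp x n S : ℕ) / C := by
    intro S
    unfold loadOf
    rw [hxsum, ← Finset.sum_div]
    push_cast
    rw [Finset.mul_sum]
  set Q : ℕ := 1000 * (n * (K * (m + 3))) with hQ
  have hK : K ≠ 0 := by omega
  have hQ1 : 1 ≤ Q := by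
    rw [hQ]
    exact Nat.one_le_iff_ne_zero.2 (by simp [hn, hK])
  have hQ0 : (0 : ℝ) < Q := by exact_mod_cast hQ1
  set Φ : ℝ := ∑ S ∈ Finset.range K, penalty m (∑ l ∈ A, a S l) with hΦ
  have hpen0 : ∀ z, 0 ≤ penalty m z := fun z => by
    unfold penalty
    have := fall_nonneg 1 z
    have : 0 ≤ ∑ k ∈ Finset.range (m + 1), fall (k + 2) z / ((k : ℝ) + 1) :=
      Finset.sum_nonneg fun k _ => div_nonneg (fall_nonneg _ _) (by positivity)
    positivity
  have hΦ0 : 0 ≤ Φ := Finset.sum_nonneg fun _ _ => hpen0 _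
  have hs : (0 : ℝ) < (m + 1).factorial * C ^ (m + 2) := by positivity
  have hdrift := sum_drift_le (penalty_convex m) (penalty_mono m) A D (Finset.range K) a ξ
    (θ := Φ / Q) (fun S hS i hi => hcheap i (hAn i hi).1 (hAn i hi).2.2 S hS)
    (fun S hS i hi => hcheap i (hDn i hi).1 (hDn i hi).2.2 S hS)
    (fun i hi => hξ i (hAn i hi).1 (hAn i hi).2.2)
    (fun i hi => (hξ i (hDn i hi).1 (hDn i hi).2.2).1)
    (by
      have := hsplit fun _ => 1
      simp only [one_mul] at this
      rw [this, hsum, hcard])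
    (fun S hS => by
      rw [hsplit]
      have h1 := hload S (Finset.mem_range.1 hS)
      have h2 : ∑ i ∈ Finset.range n, a S i * ξ i =
          (∑ i ∈ Finset.range n, 200 * (inp (3 + (i + n * S)) : ℝ) * ξ i) / C := by
        rw [Finset.sum_div]
        exact Finset.sum_congr rfl fun _ _ => by simp only [a]; ring
      rw [h2]
      exact (div_le_one hC0).2 h1)
    (by positivity)
    (fun i hi j hj => by
      obtain ⟨hi1, hi2, -⟩ := hAn i hi
      obtain ⟨hj1, hj2, hj3⟩ := hDn j hj
      have h1 := hopt i hi1 j hj1 hi2 hj2 hj3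
      have h2 : (potential inp x n K C m : ℝ) * (Q - 1) ≤
          potential inp (exchange x i j) n K C m * Q := by
        have : ((potential inp x n K C m * (Q - 1) : ℕ) : ℝ) ≤
          (potential inp (exchange x i j) n K C m * Q : ℕ) := Nat.cast_le.2 h1
        push_cast [Nat.cast_sub hQ1] at this
        exact this
      have h3 : ∀ S, ((200 * loadOf inp (exchange x i j) n S : ℕ) : ℝ) / C =
          ∑ l ∈ A, a S l - a S i + a S j := by
        intro S
        have h4 := sum_exchange hi1 hj1 hi2 hj2 fun l => inp (3 + (l + n * S))
        have h5 : (loadOf inp (exchange x i j) n S : ℝ) + inp (3 + (i + n * S)) =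
          loadOf inp x n S + inp (3 + (j + n * S)) := by exact_mod_cast h4
        rw [hz]
        simp only [a]
        push_cast
        rw [← sub_div, ← add_div]
        congr 1
        linarith
      rw [potential_eq hC, potential_eq hC] at h2
      simp only [h3, ← hz, mul_assoc] at h2
      have h6 : Φ * (Q - 1) ≤
          (∑ S ∈ Finset.range K, penalty m (∑ l ∈ A, a S l - a S i + a S j)) * Q := by
        refine le_of_mul_le_mul_left ?_ hs
        simpa only [mul_assoc] using h2
      rw [sub_le_iff_le_add, ← sub_le_iff_le_add', le_div_iff₀ hQ0, sub_mul]
      linarith)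
  by_contra hcon
  push Not at hcon
  obtain ⟨T, hT, hmax⟩ := Finset.exists_max_image (Finset.range K) (fun S => ∑ l ∈ A, a S l)
    ⟨S, Finset.mem_range.2 hS⟩
  set z := ∑ l ∈ A, a T l with hzT
  have hzR : R ≤ z := by
    refine le_trans ?_ (hmax S (Finset.mem_range.2 hS))
    show R ≤ ∑ l ∈ A, a S l
    rw [hz, le_div_iff₀ hC0]
    push_cast
    exact hcon
  have hzm : (m : ℝ) + 2 ≤ z := hR.trans hzR
  have hz0 : ∀ S, 0 ≤ ∑ l ∈ A, a S l := fun S => by rw [hz]; positivity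
  have hlow : -(9 / 4) * K + fall (m + 2) z ≤
      ∑ S ∈ Finset.range K, drift (penalty m) (∑ l ∈ A, a S l) := by
    have h1 : ∑ S ∈ Finset.range K, (-(9 / 4) + if S = T then fall (m + 2) z else 0) ≤
        ∑ S ∈ Finset.range K, drift (penalty m) (∑ l ∈ A, a S l) := by
      refine Finset.sum_le_sum fun S _ => ?_
      by_cases hST : S = T
      · subst hST
        simpa using drift_penalty_ge_fall m hzm
      · simpa [hST] using drift_penalty_ge m (hz0 S)
    refine le_trans (le_of_eq ?_) h1
    rw [Finset.sum_add_distrib, Finset.sum_ite_eq' (Finset.range K) T, if_pos hT]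
    simp
    ring
  have hup : (A.card : ℝ) * (Φ / Q) ≤ fall (m + 2) z / 1000 := by
    have h1 : Φ ≤ K * ((m + 3) * fall (m + 2) z) := by
      have : Φ ≤ ∑ S ∈ Finset.range K, (m + 3) * fall (m + 2) z :=
        Finset.sum_le_sum fun S hS => (penalty_mono m (hmax S hS)).trans (penalty_le m hzm)
      simpa using this
    have h2 : (A.card : ℝ) ≤ n := by rw [hcard]; exact_mod_cast hp
    have h3 : (Q : ℝ) = 1000 * (n * (K * (m + 3))) := by rw [hQ]; push_cast; ring
    rw [← mul_div_assoc, div_le_iff₀ hQ0]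
    calc (A.card : ℝ) * Φ ≤ n * (K * ((m + 3) * fall (m + 2) z)) := by gcongr
      _ = _ := by rw [h3]; ring
  have hFz : fall (m + 2) R ≤ fall (m + 2) z := fall_mono _ hzR
  linarith

end RAM

/-! ### The rounding ratio -/

namespace RAM

open Real in
/-- Comparison of a falling factorial with an integral of the logarithm, whose antiderivative is
`z log z - z`. -/
theorem exp_le_fall (k : ℕ) {R : ℝ} (h : 0 < R - k) :
    exp ((R * log R - R) - ((R - k) * log (R - k) - (R - k))) ≤ fall k R := by
  induction k with
  | zero => simp [fall]
  | succ k ih =>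
    push_cast at h ⊢
    -- The step from `c - 1` to `c` of the antiderivative is at most `log c`.
    set c : ℝ := R - k with hc
    have hc1 : R - (k + 1 : ℝ) = c - 1 := by rw [hc]; ring
    rw [hc1] at h ⊢
    have hc0 : 0 < c := by linarith
    rw [fall_succ, ← hc, max_eq_left hc0.le]
    have h1 : (c - 1) * (log c - log (c - 1)) ≤ 1 := by
      rw [← log_div hc0.ne' h.ne']
      have := mul_le_mul_of_nonneg_left (log_le_sub_one_of_pos (div_pos hc0 h)) h.le
      have h2 : (c - 1) * (c / (c - 1) - 1) = 1 := by field_simp; ring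
      linarith
    calc exp ((R * log R - R) - ((c - 1) * log (c - 1) - (c - 1)))
        ≤ exp (((R * log R - R) - (c * log c - c)) + log c) := exp_le_exp.2 (by linarith)
      _ = exp ((R * log R - R) - (c * log c - c)) * c := by rw [exp_add, exp_log hc0]
      _ ≤ fall k R * c := mul_le_mul_of_nonneg_right (ih hc0) hc0.le

open Real in
/-- `R log R - R` is the largest value of `R log s - s` over all `s > 0`. -/
theorem mul_log_sub_le {R s : ℝ} (hR : 0 < R) (hs : 0 < s) :
    R * log s - s ≤ R * log R - R := by
  have h := mul_le_mul_of_nonneg_left (log_le_sub_one_of_pos (div_pos hs hR)) hR.le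
  rw [log_div hs.ne' hR.ne'] at h
  have : R * (s / R - 1) = s - R := by field_simp
  linarith

open Real in
theorem log_le_div_add {L t : ℝ} (hL : 0 < L) (ht : 0 < t) : log L ≤ L / t + log t - 1 := by
  have h := log_le_sub_one_of_pos (div_pos hL ht)
  rw [log_div hL.ne' ht.ne'] at h
  linarith

open Real in
/-- The tangent line of the logarithm at `t` bounds the denominator of the rounding ratio. -/
theorem le_ratio_of_tangent {L t s a b A : ℝ} (hL : 0 < L) (ht : 0 < t)
    (hu : 0 < 1 + log L) (ha : a ≤ log s) (ha0 : 0 ≤ a) (hb : log t ≤ b)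
    (hA : A = L / t + b)
    (h : (L + s - 48 / 100 - 100 / 101 * a) * A ≤ 100 / 101 * (2718 / 1000 * L) * a) :
    L - 48 / 100 ≤ 100 / 101 * (1 + exp 1 * L / (1 + log L)) * log s - s := by
  have h1 := log_le_div_add hL ht
  have hA0 : 0 < A := by linarith
  have h2 : 2718 / 1000 * L / A ≤ exp 1 * L / (1 + log L) := by
    apply div_le_div₀ (mul_nonneg (exp_pos _).le hL.le) _ hu (by linarith)
    exact mul_le_mul_of_nonneg_right (by have := exp_one_gt_d9; linarith) hL.le
  have h3 : L + s - 48 / 100 - 100 / 101 * a ≤ 100 / 101 * (2718 / 1000 * L / A) * a := by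
    rw [show 100 / 101 * (2718 / 1000 * L / A) * a = 100 / 101 * (2718 / 1000 * L) * a / A by ring]
    exact (le_div_iff₀ hA0).2 h
  have h4 : 100 / 101 * (1 + 2718 / 1000 * L / A) * a ≤
      100 / 101 * (1 + exp 1 * L / (1 + log L)) * log s := by
    have : 0 ≤ 2718 / 1000 * L / A := by positivity
    apply mul_le_mul _ ha ha0 <;> nlinarith
  nlinarith

open Real in
/-- The ratio `q = e L / (1 + log L)` is at least `e`, as `y / log y` has its minimum at `e`. -/
theorem exp_one_le_quotient {L : ℝ} (hL : 0 < L) (hu : 0 < 1 + log L) :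
    exp 1 ≤ exp 1 * L / (1 + log L) := by
  rw [le_div_iff₀ hu]
  exact mul_le_mul_of_nonneg_left (by linarith [log_le_sub_one_of_pos hL]) (exp_pos _).le

open Real in
/-- The constant `e` in the rounding ratio makes `R log R - R` exceed `log (2 K)` up to an
additive constant, where `R` is slightly smaller than the ratio. -/
theorem log_le_mul_log_sub {L : ℝ} (hL : 69 / 100 ≤ L) {R : ℝ}
    (hR : R = 100 / 101 * (1 + exp 1 * L / (1 + log L))) :
    L - 48 / 100 ≤ R * log R - R := by
  have l2 := log_two_gt_d9
  have l2' := log_two_lt_d9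
  have l3 := log_three_gt_d9
  have l3' := log_three_lt_d9
  have he := exp_one_gt_d9
  have he' := exp_one_lt_d9
  have hL0 : 0 < L := by linarith
  have hu : 0 < 1 + log L := by
    have h := log_le_log (by norm_num : (0 : ℝ) < 1 / 2) (by linarith : (1 / 2 : ℝ) ≤ L)
    rw [one_div, log_inv] at h
    linarith
  have hq := exp_one_le_quotient hL0 hu
  have hR0 : 0 < R := by rw [hR]; linarith
  -- For small `L`, the lower bound `(1 + e) / 1.01` for `R` suffices. On three bounded intervals,
  -- tangents of both logarithms reduce the claim to a quadratic inequality in `L`.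
  rcases le_total L (159 / 100) with h1 | h1
  · have hs := mul_log_sub_le hR0 (by norm_num : (0 : ℝ) < 32 / 9)
    have : log (32 / 9) = 5 * log 2 - 2 * log 3 := by
      rw [log_div (by norm_num) (by norm_num), show (32 : ℝ) = 2 ^ 5 by norm_num,
        show (9 : ℝ) = 3 ^ 2 by norm_num, log_pow, log_pow]
      norm_num
    have h3 : (1.268 : ℝ) ≤ log (32 / 9) := by rw [this]; linarith
    have h4 : (3.681 : ℝ) ≤ R := by rw [hR]; linarith
    nlinarith
  rcases le_total L (296 / 100) with h2 | h2
  · have hs := mul_log_sub_le hR0 (by norm_num : (0 : ℝ) < 9 / 2)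
    have : log (9 / 2) = 2 * log 3 - log 2 := by
      rw [log_div (by norm_num) (by norm_num), show (9 : ℝ) = 3 ^ 2 by norm_num, log_pow]
      norm_num
    refine le_trans ?_ hs
    rw [hR]
    apply le_ratio_of_tangent (t := 2) (a := 1.504) (b := 0.6932) hL0 (by norm_num)
      hu (by rw [this]; linarith) (by norm_num) (by linarith) rfl
    nlinarith [mul_nonneg (sub_nonneg.2 h1) (sub_nonneg.2 h2)]
  rcases le_total L (652 / 100) with h3 | h3
  · have hs := mul_log_sub_le hR0 (by norm_num : (0 : ℝ) < 16 / 3)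
    have : log (16 / 3) = 4 * log 2 - log 3 := by
      rw [log_div (by norm_num) (by norm_num), show (16 : ℝ) = 2 ^ 4 by norm_num, log_pow]
      norm_num
    have h4 : log 4 = 2 * log 2 := by
      rw [show (4 : ℝ) = 2 ^ 2 by norm_num, log_pow]; norm_num
    refine le_trans ?_ hs
    rw [hR]
    apply le_ratio_of_tangent (t := 4) (a := 1.6739) (b := 1.3863) hL0 (by norm_num)
      hu (by rw [this]; linarith) (by norm_num) (by rw [h4]; linarith) rfl
    nlinarith [mul_nonneg (sub_nonneg.2 h2) (sub_nonneg.2 h3)]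
  rcases le_total L 25 with h4 | h4
  · have hs := mul_log_sub_le hR0 (by norm_num : (0 : ℝ) < 8)
    have h8 : log 8 = 3 * log 2 := by
      rw [show (8 : ℝ) = 2 ^ 3 by norm_num, log_pow]; norm_num
    have h12 : log 12 = 2 * log 2 + log 3 := by
      rw [show (12 : ℝ) = 2 ^ 2 * 3 by norm_num, log_mul (by norm_num) (by norm_num), log_pow]
      norm_num
    refine le_trans ?_ hs
    rw [hR]
    apply le_ratio_of_tangent (t := 12) (a := 2.0794) (b := 2.48491) hL0 (by norm_num)
      hu (by rw [h8]; linarith) (by norm_num) (by rw [h12]; linarith) rfl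
    nlinarith [mul_nonneg (sub_nonneg.2 h3) (sub_nonneg.2 h4)]
  -- For large `L`, the choice `s = q` is good enough, as `R` is close to `q`.
  · set u := 1 + log L with hudef
    set q := exp 1 * L / u with hqdef
    have hq0 : 0 < q := by linarith
    have hs := mul_log_sub_le hR0 hq0
    refine le_trans ?_ hs
    have hlogq : log q = u - log u := by
      rw [hqdef, log_div (by positivity) hu.ne', log_mul (exp_pos 1).ne' hL0.ne', log_exp]
    have hu4 : 37 / 10 ≤ u := by
      have h := log_le_log (by norm_num : (0 : ℝ) < 16) (by linarith : (16 : ℝ) ≤ L)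
      rw [show (16 : ℝ) = 2 ^ 4 by norm_num, log_pow] at h
      push_cast at h
      linarith
    have hlu : log u ≤ u / 4 + 2 * log 2 - 1 := by
      have := log_le_div_add hu (by norm_num : (0 : ℝ) < 4)
      rwa [show (4 : ℝ) = 2 ^ 2 by norm_num, log_pow, show ((2 : ℕ) : ℝ) = 2 by norm_num,
        show (2 : ℝ) ^ 2 = 4 by norm_num] at this
    have hqL : L ≤ q * (u * (368 / 1000)) := by
      have : q * u = exp 1 * L := by rw [hqdef]; field_simp
      nlinarith
    rw [hlogq, hR]
    have h5 : 0 ≤ q * (100 / 101 * (u - log u) - 1 - u * (368 / 1000)) := by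
      apply mul_nonneg hq0.le
      linarith
    nlinarith

open Real in
theorem log_two_mul_ge {K : ℕ} (hK : 1 ≤ K) : 69 / 100 ≤ log (2 * K) := by
  have h : log 2 ≤ log (2 * K) :=
    log_le_log (by norm_num) (by have : (1 : ℝ) ≤ K := by exact_mod_cast hK
                                 linarith)
  linarith [log_two_gt_d9]

open Real in
theorem roundingRatio_eq {K : ℕ} (hK : 1 ≤ K) :
    roundingRatio K = 1 + exp 1 * log (2 * K) / (1 + log (log (2 * K))) := by
  have := log_two_mul_ge hK
  rw [roundingRatio, log_mul (exp_pos 1).ne' (by linarith), log_exp]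

open Real in
theorem one_add_log_log_pos {K : ℕ} (hK : 1 ≤ K) : 0 < 1 + log (log (2 * K)) := by
  have h := log_le_log (by norm_num : (0 : ℝ) < 1 / 2)
    (by linarith [log_two_mul_ge hK] : (1 / 2 : ℝ) ≤ log (2 * K))
  rw [one_div, log_inv] at h
  linarith [log_two_lt_d9]

open Real in
theorem one_add_exp_le_roundingRatio {K : ℕ} (hK : 1 ≤ K) : 1 + exp 1 ≤ roundingRatio K := by
  rw [roundingRatio_eq hK]
  have := exp_one_le_quotient (by linarith [log_two_mul_ge hK]) (one_add_log_log_pos hK)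
  linarith

open Real in
/-- The potentials with index below `3 K` suffice. -/
theorem roundingRatio_lt {K : ℕ} (hK : 1 ≤ K) : 100 / 101 * roundingRatio K < 3 * K + 1 := by
  have hL := log_two_mul_ge hK
  have he := exp_one_gt_d9
  have he' := exp_one_lt_d9
  have hu := one_add_log_log_pos hK
  rw [roundingRatio_eq hK]
  have hL0 : 0 < log (2 * K) := by linarith
  rcases Nat.lt_or_ge K 2 with h | h
  · obtain rfl : K = 1 := by omega
    have l2 := log_two_gt_d9
    have l2' := log_two_lt_d9
    norm_num at hu ⊢
    have h1 : (0.6289 : ℝ) ≤ 1 + log (log 2) := by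
      have h := log_le_log (by norm_num : (0 : ℝ) < 9 / 13) (by linarith : (9 / 13 : ℝ) ≤ log 2)
      have h3 := log_le_sub_one_of_pos (by norm_num : (0 : ℝ) < 13 / 12)
      have : log (9 / 13 : ℝ) = log 3 - 2 * log 2 - log (13 / 12) := by
        rw [log_div (by norm_num) (by norm_num), log_div (by norm_num) (by norm_num),
          show (9 : ℝ) = 3 ^ 2 by norm_num, show (12 : ℝ) = 2 ^ 2 * 3 by norm_num,
          log_mul (by norm_num) (by norm_num), log_pow, log_pow]
        push_cast; ring
      linarith [log_three_gt_d9]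
    have h2 : exp 1 * log 2 / (1 + log (log 2)) ≤ 3 := by
      rw [div_le_iff₀ hu]
      nlinarith
    linarith
  · have hK2 : (2 : ℝ) ≤ K := by exact_mod_cast h
    have h1 : 1 ≤ log (2 * K) := by
      rw [le_log_iff_exp_le (by linarith)]
      linarith
    have h2 : 1 ≤ 1 + log (log (2 * K)) := by linarith [log_nonneg h1]
    have h3 : exp 1 * log (2 * K) ≤ 2 * K := by
      have h := log_le_sub_one_of_pos (div_pos (by linarith : (0 : ℝ) < 2 * K) (exp_pos 1))
      rw [log_div (by linarith) (exp_pos 1).ne', log_exp] at h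
      have h4 : log (2 * K) ≤ 2 * K / exp 1 := by linarith
      rw [le_div_iff₀ (exp_pos 1)] at h4
      linarith
    have h4 : exp 1 * log (2 * K) / (1 + log (log (2 * K))) ≤ exp 1 * log (2 * K) :=
      div_le_self (mul_nonneg (exp_pos 1).le hL0.le) h2
    linarith

open Real in
/-- For one of the potentials that are tried, a load of `roundingRatio K / 1.01` times the budget
in a single scenario is already larger than the bound on the sum over all scenarios. -/
theorem exists_fall_gt {K : ℕ} (hK : 1 ≤ K) : ∃ m < 3 * K,
    (m + 2 : ℝ) ≤ 100 / 101 * roundingRatio K ∧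
      9 / 4 * K < 999 / 1000 * fall (m + 2) (100 / 101 * roundingRatio K) := by
  have hK0 : (1 : ℝ) ≤ K := by exact_mod_cast hK
  set R := 100 / 101 * roundingRatio K with hR
  have hR3 : 3 ≤ R := by
    have := one_add_exp_le_roundingRatio hK
    linarith [exp_one_gt_d9]
  have hlt := roundingRatio_lt hK
  -- With `m + 2 = ⌊R⌋ - 1`, the last factor `R - m - 1` of the falling factorial lies in `[2, 3)`.
  have hfl : 3 ≤ ⌊R⌋₊ := Nat.le_floor (by exact_mod_cast hR3)
  have hfl1 := Nat.floor_le (by linarith : 0 ≤ R)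
  have hfl2 := Nat.lt_floor_add_one R
  obtain ⟨m, hm⟩ : ∃ m, ⌊R⌋₊ = m + 3 := ⟨⌊R⌋₊ - 3, by omega⟩
  rw [hm] at hfl1 hfl2
  push_cast at hfl1 hfl2
  refine ⟨m, ?_, by linarith, ?_⟩
  · have : (m : ℝ) < (3 * K : ℕ) := by push_cast; linarith
    exact_mod_cast this
  · have hr : 0 < R - (m + 2 : ℕ) := by push_cast; linarith
    have h1 := exp_le_fall (m + 2) hr
    have h2 : log (2 * K) - 48 / 100 ≤ R * log R - R :=
      log_le_mul_log_sub (log_two_mul_ge hK) (by rw [hR, roundingRatio_eq hK])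
    set r := R - (m + 2 : ℕ) with hrdef
    have hr1 : 1 ≤ r := by rw [hrdef]; push_cast; linarith
    have hr2 : r ≤ 2 := by rw [hrdef]; push_cast; linarith
    have h3 : r * log r - r ≤ - (61 / 100) := by
      have h := log_le_div_add hr two_pos
      have := mul_le_mul_of_nonneg_left h hr.le
      nlinarith [log_two_lt_d9, mul_nonneg (sub_nonneg.2 hr1) (sub_nonneg.2 hr2)]
    have h4 : exp (log (2 * K) + 13 / 100) ≤ fall (m + 2) R :=
      (exp_le_exp.2 (by linarith)).trans h1
    rw [exp_add, exp_log (by linarith)] at h4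
    have h5 := add_one_le_exp (13 / 100 : ℝ)
    nlinarith

open Real in
theorem roundingRatio_isBigO :
    roundingRatio =O[atTop] fun K : ℕ => Real.log K / Real.log (Real.log K) := by
  have hlog : Tendsto (fun K : ℕ => log (K : ℝ)) atTop atTop :=
    tendsto_log_atTop.comp tendsto_natCast_atTop_atTop
  have hll : Tendsto (fun K : ℕ => log (log (K : ℝ))) atTop atTop :=
    tendsto_log_atTop.comp hlog
  refine IsBigO.of_bound 10 ?_
  filter_upwards [hlog.eventually_ge_atTop 1, hll.eventually_ge_atTop 1,
    eventually_ge_atTop 2] with K h1 h2 hK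
  have hK2 : (2 : ℝ) ≤ K := by exact_mod_cast hK
  have hl : log (2 * K) ≤ 2 * log K := by
    rw [log_mul (by norm_num) (by linarith)]
    linarith [log_le_log (by norm_num) hK2]
  have hl2 : log K ≤ log (2 * K) := log_le_log (by linarith) (by linarith)
  have hl3 : log (log K) ≤ log (log (2 * K)) := log_le_log (by linarith) hl2
  have hle : log (log K) ≤ log K := (log_le_sub_one_of_pos (by linarith)).trans (by linarith)
  have h3 : exp 1 * log (2 * K) / (1 + log (log (2 * K))) ≤ 6 * (log K / log (log K)) := by
    rw [← mul_div_assoc]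
    apply div_le_div₀ (by linarith) _ (by linarith) (by linarith)
    nlinarith [exp_one_lt_d9, exp_pos 1]
  have h4 : 1 ≤ log K / log (log K) := (one_le_div (by linarith)).2 hle
  have h5 := one_add_exp_le_roundingRatio (by omega : 1 ≤ K)
  rw [Real.norm_of_nonneg (by linarith [exp_pos 1]), Real.norm_of_nonneg (by linarith),
    roundingRatio_eq (by omega)]
  linarith

end RAM

/-! ### The linear program -/

namespace SelectingItems

variable (I : SelectingItems)

/-- `x` solves the linear program `LP_C`, and vanishes on the items outside `I_C`. -/
structure Solves (C : ℝ) (x : Fin I.n → ℝ) : Prop where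
  mem_Icc : ∀ i, x i ∈ Set.Icc (0 : ℝ) 1
  sum_eq : ∑ i, x i = I.p
  load_le : ∀ S, ∑ i, (I.cost S i : ℝ) * x i ≤ C
  cheap : ∀ S i, x i = 0 ∨ (I.cost S i : ℝ) ≤ C

variable {I}

theorem lpFeasible_iff {C : ℝ} : I.LPFeasible C ↔ ∃ x, I.Solves C x := by
  classical
  constructor
  · rintro ⟨x, h1, h2, h3⟩
    refine ⟨fun i => if i ∈ I.cheapItems C then x i else 0, fun i => ?_, ?_, fun S => ?_,
      fun S i => ?_⟩
    · split_ifs with h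
      exacts [h3 i h, ⟨le_rfl, zero_le_one⟩]
    · simpa [Finset.sum_ite_mem] using h1
    · simpa [mul_ite, Finset.sum_ite_mem] using h2 S
    · by_cases h : i ∈ I.cheapItems C
      · exact Or.inr ((Finset.mem_filter.1 h).2 S)
      · simp [h]
  · rintro ⟨x, h1, h2, h3, h4⟩
    have h0 : ∀ i ∉ I.cheapItems C, x i = 0 := fun i hi => by
      by_contra hx
      exact hi (Finset.mem_filter.2 ⟨Finset.mem_univ _, fun S => (h4 S i).resolve_left hx⟩)
    have hs : ∀ f : Fin I.n → ℝ, ∑ i ∈ I.cheapItems C, f i * x i = ∑ i, f i * x i := fun f =>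
      Finset.sum_subset (Finset.subset_univ _) fun i _ hi => by rw [h0 i hi, mul_zero]
    refine ⟨x, ?_, fun S => ?_, fun i _ => h1 i⟩
    · rw [← h2]
      simpa using hs fun _ => 1
    · rw [hs]
      exact h3 S

theorem totalCost_le_maxCost (P : Finset (Fin I.n)) (S : Fin I.K) :
    I.totalCost P S ≤ I.maxCost P :=
  Finset.le_sup (f := fun S => I.totalCost P S) (Finset.mem_univ S)

theorem lpFeasible_maxCost {Q : Finset (Fin I.n)} (hQ : Q.card = I.p) :
    I.LPFeasible (I.maxCost Q) := by
  classical
  refine lpFeasible_iff.2 ⟨fun i => if i ∈ Q then 1 else 0, fun i => ?_, ?_, fun S => ?_,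
    fun S i => ?_⟩
  · split_ifs <;> simp
  · simp [hQ]
  · have := totalCost_le_maxCost Q S
    simpa [totalCost] using (Nat.cast_le (α := ℝ)).2 this
  · by_cases h : i ∈ Q
    · right
      exact_mod_cast (Finset.single_le_sum (f := I.cost S) (fun _ _ => Nat.zero_le _) h).trans
        (totalCost_le_maxCost Q S)
    · simp [h]

theorem exists_card_eq (I : SelectingItems) : ∃ Q : Finset (Fin I.n), Q.card = I.p := by
  obtain ⟨Q, -, hQ⟩ := Finset.exists_subset_card_eq
    (s := (Finset.univ : Finset (Fin I.n))) (n := I.p) (by simpa using I.p_le_n)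
  exact ⟨Q, hQ⟩

/-- The smallest `C` exists, since the pairs of a value `C` in a bounded range and a solution of
`LP_C` form a compact set. -/
theorem exists_isLeast (I : SelectingItems) :
    ∃ C, IsLeast {C : ℝ | 0 ≤ C ∧ I.LPFeasible C} C := by
  obtain ⟨Q, hQ⟩ := I.exists_card_eq
  obtain ⟨D, hD⟩ : ∃ D : ℝ, D = I.maxCost Q := ⟨_, rfl⟩
  let F : Set ((Fin I.n → ℝ) × ℝ) := {z | z.1 ∈ Set.univ.pi (fun _ => Set.Icc (0 : ℝ) 1) ∧
    z.2 ∈ Set.Icc 0 D ∧ ∑ i, z.1 i = I.p ∧ (∀ S, ∑ i, (I.cost S i : ℝ) * z.1 i ≤ z.2) ∧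
    ∀ S i, z.1 i = 0 ∨ (I.cost S i : ℝ) ≤ z.2}
  have hclosed : IsClosed {z : (Fin I.n → ℝ) × ℝ | ∑ i, z.1 i = I.p ∧
      (∀ S, ∑ i, (I.cost S i : ℝ) * z.1 i ≤ z.2) ∧
      ∀ S i, z.1 i = 0 ∨ (I.cost S i : ℝ) ≤ z.2} := by
    simp only [Set.ofPred_and, Set.ofPred_forall, Set.ofPred_or]
    refine (isClosed_eq (by fun_prop) (by fun_prop)).inter (IsClosed.inter ?_ ?_)
    · exact isClosed_iInter fun S => isClosed_le (by fun_prop) (by fun_prop)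
    · exact isClosed_iInter fun S => isClosed_iInter fun i =>
        (isClosed_eq (by fun_prop) (by fun_prop)).union (isClosed_le (by fun_prop) (by fun_prop))
  have hF : IsCompact F := by
    have h := ((isCompact_univ_pi fun _ : Fin I.n => isCompact_Icc (a := (0 : ℝ)) (b := 1)).prod
      (isCompact_Icc (a := 0) (b := D))).inter_right hclosed
    convert h using 1
    ext z
    simp only [F, Set.mem_ofPred_eq, Set.mem_inter_iff, Set.mem_prod, and_assoc]
  have hmem : ∀ C, 0 ≤ C → C ≤ D → I.LPFeasible C → C ∈ Prod.snd '' F := fun C h1 h2 h3 => by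
    obtain ⟨x, h4, h5, h6, h7⟩ := lpFeasible_iff.1 h3
    exact ⟨(x, C), ⟨fun i _ => h4 i, ⟨h1, h2⟩, h5, h6, h7⟩, rfl⟩
  have hDF : D ∈ Prod.snd '' F := 
    hmem D (hD ▸ Nat.cast_nonneg _) le_rfl (hD ▸ lpFeasible_maxCost hQ)
  obtain ⟨C, ⟨⟨x, C'⟩, ⟨h1, h2, h3, h4, h5⟩, rfl⟩, hC⟩ :=
    (hF.image continuous_snd).exists_isLeast ⟨D, hDF⟩
  refine ⟨C', ⟨h2.1, lpFeasible_iff.2 ⟨x, fun i => h1 i trivial, h3, h4, h5⟩⟩, fun E hE => ?_⟩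
  rcases le_total E D with h | h
  · exact hC (hmem E hE.1 h hE.2)
  · exact h2.2.trans h

/-- A positive smallest value is at least `1`: below `1`, only items without any cost are
available. -/
theorem eq_zero_or_one_le {C : ℝ} (hC : IsLeast {C : ℝ | 0 ≤ C ∧ I.LPFeasible C} C) :
    C = 0 ∨ 1 ≤ C := by
  rcases lt_or_ge C 1 with h | h
  · left
    obtain ⟨x, h1, h2, h3, h4⟩ := lpFeasible_iff.1 hC.1.2
    have h5 : ∀ S i, x i = 0 ∨ I.cost S i = 0 := fun S i => (h4 S i).imp_right fun h6 => by
      have : (I.cost S i : ℝ) < 1 := h6.trans_lt h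
      have : I.cost S i < 1 := by exact_mod_cast this
      omega
    refine le_antisymm (hC.2 ⟨le_rfl, lpFeasible_iff.2 ⟨x, h1, h2, fun S => ?_, fun S i => ?_⟩⟩)
      hC.1.1
    · refine (Finset.sum_eq_zero fun i _ => ?_).le
      rcases h5 S i with h | h <;> simp [h]
    · exact (h5 S i).imp_right fun h => by simp [h]
  · exact Or.inr h

/-! ### Instances as numbers in memory -/

theorem inputWord_cost (S : Fin I.K) (i : Fin I.n) :
    I.inputWord (3 + (i + I.n * S)) = I.cost S i := by
  have h : (i + I.n * S : ℕ) = finProdFinEquiv (S, i) := rfl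
  have hlt : (i + I.n * S : ℕ) < I.K * I.n := by rw [h]; exact (finProdFinEquiv (S, i)).2
  rw [inputWord, if_neg (by omega), if_neg (by omega), if_neg (by omega)]
  have e : 3 + (i + I.n * S : ℕ) - 3 = i + I.n * S := by omega
  rw [dif_pos (by omega)]
  have e2 : finProdFinEquiv.symm ⟨3 + (i + I.n * S : ℕ) - 3, by omega⟩ = (S, i) := by
    rw [Equiv.symm_apply_eq]
    exact Fin.ext (e.trans h)
  rw [e2]

theorem inputWord_zero : I.inputWord 0 = I.n := rfl
theorem inputWord_one : I.inputWord 1 = I.K := rfl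
theorem inputWord_two : I.inputWord 2 = I.p := rfl

open RAM in
theorem rep_inputMemory (I : SelectingItems) : Rep I.inputMemory (St.init I.inputWord) := by
  constructor
  · intro v
    have : v.addr % 2 ≠ 0 := by simp only [Var.addr]; omega
    rw [inputMemory, if_neg this]
    cases v <;> rfl
  · intro A l
    cases A
    · have : Arr.scale .inp * l + Arr.base .inp = 2 * l := rfl
      rw [this, inputMemory, if_pos (by omega), Nat.mul_div_cancel_left _ two_pos]
      rfl
    all_goals
      rw [inputMemory, if_neg (by simp only [Arr.scale, Arr.base]; omega)]
      rfl

open RAM in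
theorem loadOf_eq (y : ℕ → ℕ) (S : Fin I.K) :
    loadOf I.inputWord y I.n S = ∑ i : Fin I.n, y i * I.cost S i := by
  rw [loadOf, Finset.sum_range]
  simp only [inputWord_cost]

open RAM in
theorem cost_le_largest (S : Fin I.K) (i : Fin I.n) :
    I.cost S i ≤ largest I.inputWord I.n I.K i := by
  rw [← inputWord_cost]
  exact Finset.le_sup (f := fun S => I.inputWord (3 + (i + I.n * S))) (Finset.mem_range.2 S.2)

open RAM in
theorem exists_cost_eq_largest (i : Fin I.n) : ∃ S, I.cost S i = largest I.inputWord I.n I.K i := by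
  obtain ⟨S, hS, h⟩ := Finset.exists_mem_eq_sup (Finset.range I.K) ⟨0, Finset.mem_range.2 I.K_pos⟩
    fun S => I.inputWord (3 + (i + I.n * S))
  exact ⟨⟨S, Finset.mem_range.1 hS⟩, by rw [largest, h, ← inputWord_cost]⟩

open RAM in
theorem loadOf_le {y : ℕ → ℕ} (hy : ∀ i, y i ≤ 1) (S : Fin I.K) :
    loadOf I.inputWord y I.n S ≤ ∑ i ∈ Finset.range I.n, largest I.inputWord I.n I.K i := by
  rw [loadOf_eq, Finset.sum_range]
  exact Finset.sum_le_sum fun i _ =>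
    (Nat.mul_le_mul (hy i) (cost_le_largest S i)).trans_eq (one_mul _)

open RAM in
theorem maxCost_le (Q : Finset (Fin I.n)) :
    I.maxCost Q ≤ ∑ i ∈ Finset.range I.n, largest I.inputWord I.n I.K i := by
  refine Finset.sup_le fun S _ => ?_
  rw [Finset.sum_range]
  exact (Finset.sum_le_sum fun i _ => cost_le_largest S i).trans
    (Finset.sum_le_sum_of_subset (Finset.subset_univ _))

open RAM in
/-- The rounding of the budget to a value of the sequence of guesses costs a factor `1.01`. -/
theorem exists_guess {C : ℝ} (hC : 1 ≤ C) : ∃ j, 200 * C ≤ guess j ∧ guess j ≤ 202 * C := by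
  have hex : ∃ j, 200 * C ≤ guess j := by
    obtain ⟨k, hk⟩ := exists_nat_ge (200 * C)
    exact ⟨k, hk.trans (by exact_mod_cast guess_strictMono.le_apply)⟩
  classical
  refine ⟨Nat.find hex, Nat.find_spec hex, ?_⟩
  obtain ⟨j, hj⟩ : ∃ j, Nat.find hex = j + 1 := by
    refine Nat.exists_eq_add_one_of_ne_zero fun h => ?_
    have := Nat.find_spec hex
    rw [h] at this
    norm_num [guess] at this
    linarith
  have h1 := Nat.find_min hex (m := j) (by omega)
  rw [hj, guess]
  have h2 : ((guess j / 200 : ℕ) : ℝ) ≤ guess j / 200 := by exact_mod_cast Nat.cast_div_le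
  push_cast
  linarith

open RAM in
/-- The analysis of the search: a guess just above the smallest value of the linear program is
among those that are tried, and its local optima satisfy the claimed bound. -/
theorem best_le {C : ℝ} (hC : IsLeast {C : ℝ | 0 ≤ C ∧ I.LPFeasible C} C) (hn : I.n ≠ 0)
    {tot best : ℕ} (htot : ∑ i ∈ Finset.range I.n, largest I.inputWord I.n I.K i = tot)
    (hbest : ∀ j, guess j < 400 * tot + 2 → ∀ m < 3 * I.K,
      I.p ≤ cheapCount (largest I.inputWord I.n I.K) I.n (guess j) →
      ∃ x, LocalOpt I.inputWord (largest I.inputWord I.n I.K) I.n I.K I.p (guess j) m x ∧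
        best ≤ maxLoad I.inputWord x I.n I.K) :
    best ≤ tot ∧ (best : ℝ) ≤ C * roundingRatio I.K := by
  obtain ⟨ξ, h1, h2, h3, h4⟩ := lpFeasible_iff.1 hC.1.2
  have hρ := one_add_exp_le_roundingRatio I.K_pos
  have hρ0 : 0 < roundingRatio I.K := by linarith [Real.exp_pos 1]
  have hCtot : C ≤ tot := by
    obtain ⟨Q, hQ⟩ := I.exists_card_eq
    refine (hC.2 ⟨Nat.cast_nonneg _, lpFeasible_maxCost hQ⟩).trans ?_
    rw [← htot]
    exact_mod_cast maxCost_le Q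
  -- If `C = 0`, the smallest guess `1` has the same cheap items.
  obtain ⟨j, hj1, hj2⟩ : ∃ j, 200 * C ≤ guess j ∧
      ((guess j : ℝ) ≤ 202 * C ∨ guess j = 1 ∧ C = 0) := by
    rcases eq_zero_or_one_le hC with h | h
    · exact ⟨0, by simp [guess, h], Or.inr ⟨rfl, h⟩⟩
    · obtain ⟨j, h5, h6⟩ := exists_guess h
      exact ⟨j, h5, Or.inl h6⟩
  have hjtot : guess j < 400 * tot + 2 := by
    rcases hj2 with h | ⟨h, -⟩
    · have : (guess j : ℝ) < (400 * tot + 2 : ℕ) := by push_cast; linarith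
      exact_mod_cast this
    · omega
  let ξ' : ℕ → ℝ := fun i => if h : i < I.n then ξ ⟨i, h⟩ else 0
  have hξ' : ∀ i : Fin I.n, ξ' i = ξ i := fun i => by simp [ξ']
  have hsum : ∑ i ∈ Finset.range I.n, ξ' i = I.p := by
    rw [Finset.sum_range]
    simpa only [hξ'] using h2
  have h0 : ∀ i < I.n, guess j < 200 * largest I.inputWord I.n I.K i → ξ' i = 0 := by
    intro i hi h5
    obtain ⟨S, hS⟩ := exists_cost_eq_largest ⟨i, hi⟩
    refine (hξ' ⟨i, hi⟩).trans ((h4 S ⟨i, hi⟩).resolve_right fun h6 => ?_)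
    rw [hS] at h6
    have h7 : (guess j : ℝ) < 200 * largest I.inputWord I.n I.K i := by exact_mod_cast h5
    have h8 : (largest I.inputWord I.n I.K i : ℝ) ≤ C := h6
    linarith
  have h01 : ∀ i < I.n, 0 ≤ ξ' i ∧ ξ' i ≤ 1 := fun i hi => by
    rw [hξ' ⟨i, hi⟩]
    exact h1 _
  have hcount : I.p ≤ cheapCount (largest I.inputWord I.n I.K) I.n (guess j) := by
    rw [← Nat.cast_le (α := ℝ), ← hsum, cheapCount, Nat.cast_sum]
    refine Finset.sum_le_sum fun i hi => ?_
    have hi := Finset.mem_range.1 hi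
    rcases lt_or_ge (guess j) (200 * largest I.inputWord I.n I.K i) with h | h
    · rw [h0 i hi h]
      positivity
    · rw [Nat.sub_eq_zero_of_le h]
      simpa using (h01 i hi).2
  obtain ⟨m, hm, hR, hF⟩ := exists_fall_gt I.K_pos
  obtain ⟨x, hx, hb⟩ := hbest j hjtot m hm hcount
  obtain ⟨S, hS, hmax⟩ := Finset.exists_mem_eq_sup (Finset.range I.K)
    ⟨0, Finset.mem_range.2 I.K_pos⟩ (loadOf I.inputWord x I.n)
  rw [maxLoad, hmax] at hb
  have hS := Finset.mem_range.1 hS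
  have hg0 : guess j ≠ 0 := by
    have := guess_strictMono.monotone (Nat.zero_le j)
    simp only [guess] at this
    omega
  have hload := fall_load_le hg0 hn I.p_le_n hx
    (fun S hS i hi => Finset.le_sup (f := fun S => I.inputWord (3 + (i + I.n * S)))
      (Finset.mem_range.2 hS)) ξ' (fun i hi _ => h01 i hi) h0 hsum
    (fun S hS => by
      rw [Finset.sum_range]
      have := h3 ⟨S, hS⟩
      simp only [hξ', mul_assoc, ← Finset.mul_sum]
      have e : ∀ i : Fin I.n, I.inputWord (3 + (i + I.n * S)) = I.cost ⟨S, hS⟩ i :=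
        fun i => inputWord_cost ⟨S, hS⟩ i
      simp only [e]
      linarith) hR hF hS
  refine ⟨hb.trans (htot ▸ loadOf_le hx.1.le_one ⟨S, hS⟩), ?_⟩
  have hb' : (best : ℝ) ≤ loadOf I.inputWord x I.n S := by exact_mod_cast hb
  refine hb'.trans ?_
  rcases hj2 with h | ⟨h, hC0⟩
  · nlinarith
  · -- With the smallest guess, only items without any cost are selected.
    have : loadOf I.inputWord x I.n S = 0 := Finset.sum_eq_zero fun i hi => by
      have hi := Finset.mem_range.1 hi
      rcases Nat.le_one_iff_eq_zero_or_eq_one.1 (hx.1.le_one i) with h5 | h5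
      · rw [h5, zero_mul]
      · have h6 := hx.1.cheap i hi h5
        have h7 : I.inputWord (3 + (i + I.n * S)) ≤ largest I.inputWord I.n I.K i :=
          Finset.le_sup (f := fun S => I.inputWord (3 + (i + I.n * S))) (Finset.mem_range.2 hS)
        rw [show I.inputWord (3 + (i + I.n * S)) = 0 by omega, mul_zero]
    rw [this, hC0]
    simp

end SelectingItems

/-! ### Polynomial running time -/

namespace RAM

/-- The function is given by a polynomial with natural coefficients. -/
def IsPoly (f : ℕ → ℕ) : Prop := ∃ q : Polynomial ℕ, ∀ L, q.eval L = f L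

theorem IsPoly.id : IsPoly fun L => L := ⟨.X, fun _ => Polynomial.eval_X⟩

theorem IsPoly.const (a : ℕ) : IsPoly fun _ => a := ⟨.C a, fun _ => Polynomial.eval_C⟩

theorem IsPoly.add {f g : ℕ → ℕ} (hf : IsPoly f) (hg : IsPoly g) : IsPoly fun L => f L + g L := by
  obtain ⟨q, hq⟩ := hf
  obtain ⟨r, hr⟩ := hg
  exact ⟨q + r, fun L => by rw [Polynomial.eval_add, hq, hr]⟩

theorem IsPoly.mul {f g : ℕ → ℕ} (hf : IsPoly f) (hg : IsPoly g) : IsPoly fun L => f L * g L := by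
  obtain ⟨q, hq⟩ := hf
  obtain ⟨r, hr⟩ := hg
  exact ⟨q * r, fun L => by rw [Polynomial.eval_mul, hq, hr]⟩

/-- The bound on the number of steps of a local search. -/
def searchBound (L : ℕ) : ℕ := 1 + 1000 * (L * (L * (3 * L + 3))) * ((9 * L + 5) * (2 * L + 14))

/-- The exponent of the power of two that bounds all numbers in the computation. -/
def sizeBound (L : ℕ) : ℕ := (2 * L + 14) * (9 * L + 5)

/-- The bound on the running time of the program on inputs of length `L`. -/
def timeBound (L : ℕ) : ℕ :=
  (tLargest L L + (200 * (2 * L + 14) + 1) * (tSizes L L (searchBound L) + 30) + (L + 1) * 40 + 150)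
    * (6 * (sizeBound L + 2))

theorem isPoly_timeBound : IsPoly timeBound := by
  unfold timeBound tLargest tSizes tGuess tInit tPot tSweep tTry tMax tPot tLoad tTerm searchBound
    sizeBound
  with_reducible
    repeat' first
      | exact IsPoly.id
      | exact IsPoly.const _
      | apply IsPoly.add
      | apply IsPoly.mul

theorem fourteen_le_sizeBound (L : ℕ) : 14 ≤ sizeBound L := by
  unfold sizeBound
  nlinarith

theorem le_sizeBound (L : ℕ) : L ≤ sizeBound L := by
  unfold sizeBound
  nlinarith

theorem bits_two_pow (s : ℕ) : bits (2 ^ s) = s + 2 := by rw [bits, Nat.size_pow]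

theorem lt_two_pow_bits (a : ℕ) : a < 2 ^ bits a :=
  (Nat.lt_size_self a).trans_le (Nat.pow_le_pow_right two_pos (Nat.le_succ _))

/-- Every step of the local search multiplies the potential, a natural number, by at most
`1 - 1 / Q`; hence `Q log` of the potential decreases by at least `1`. -/
theorem exists_energy {Q : ℕ} (hQ : 1 ≤ Q) {s e : ℕ} : ∃ E : ℕ → ℕ,
    (∀ a b, b * Q < a * (Q - 1) → E b < E a) ∧ ∀ a ≤ (2 ^ s) ^ e, E a ≤ 1 + Q * (e * s) := by
  have hQ0 : (0 : ℝ) < Q := by exact_mod_cast hQ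
  refine ⟨fun a => if a = 0 then 0 else 1 + ⌊Q * Real.log a⌋₊, fun a b h => ?_, fun a h => ?_⟩
  · have ha : a ≠ 0 := by rintro rfl; simp at h
    dsimp only
    rw [if_neg ha]
    split_ifs with hb
    · omega
    have ha0 : (0 : ℝ) < a := by positivity
    have hb0 : (0 : ℝ) < b := by positivity
    have h1 : (b : ℝ) * Q < a * (Q - 1) := by
      have : ((b * Q : ℕ) : ℝ) < (a * (Q - 1) : ℕ) := by exact_mod_cast h
      push_cast [Nat.cast_sub hQ] at this
      exact this
    have h2 := Real.log_le_sub_one_of_pos (div_pos hb0 ha0)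
    rw [Real.log_div hb0.ne' ha0.ne'] at h2
    have h3 : Q * (b / a - 1 : ℝ) ≤ -1 := by
      rw [show Q * (b / a - 1 : ℝ) = (b * Q - a * Q) / a by field_simp, div_le_iff₀ ha0]
      linarith
    have h4 := mul_le_mul_of_nonneg_left h2 hQ0.le
    have h5 : Q * Real.log b + 1 ≤ Q * Real.log a := by linarith
    have h6 : 0 ≤ Q * Real.log b := mul_nonneg hQ0.le (Real.log_natCast_nonneg b)
    have h7 := Nat.floor_le_floor h5
    rw [Nat.floor_add_one h6] at h7
    omega
  · dsimp only
    split_ifs with ha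
    · omega
    refine Nat.add_le_add_left (Nat.floor_le_of_le ?_) 1
    have ha0 : (0 : ℝ) < a := by positivity
    have h1 : Real.log a ≤ e * s := by
      have h2 : (a : ℝ) ≤ 2 ^ (e * s) := by
        rw [← pow_mul, mul_comm] at h
        exact_mod_cast h
      have h3 := Real.log_le_log ha0 h2
      rw [Real.log_pow] at h3
      have h4 : ((e * s : ℕ) : ℝ) * Real.log 2 ≤ (e * s : ℕ) * 1 :=
        mul_le_mul_of_nonneg_left (by linarith [Real.log_two_lt_d9]) (Nat.cast_nonneg _)
      push_cast at h3 h4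
      linarith
    push_cast
    gcongr

/-- The bounds hold with numbers of polynomial length: the data are at most `2 ^ L`, and all numbers
are at most the `(9 L + 5)`-th power of a bound on the sums of data. -/
theorem setup_of_le {inp mc : ℕ → ℕ} {n K p L : ℕ} (hnK : n * K ≤ L) (hn : 1 ≤ n) (hK : 1 ≤ K)
    (hp : p ≤ n) (hinp : ∀ S < K, ∀ i < n, inp (3 + (i + n * S)) ≤ 2 ^ L)
    (hmc : ∀ i < n, mc i = largest inp n K i) :
    Setup (2 ^ sizeBound L) (2 ^ (2 * L + 14)) (searchBound L) { St.init inp with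
      n := n, K := K, p := p, mc := mc, tot := ∑ i ∈ Finset.range n, largest inp n K i,
      lim := 400 * (∑ i ∈ Finset.range n, largest inp n K i) + 2 } := by
  have hKL : K ≤ L := le_trans (Nat.le_mul_of_pos_left _ hn) hnK
  have hnL : n ≤ L := le_trans (Nat.le_mul_of_pos_right _ hK) hnK
  have hLW : L + 1 ≤ 2 ^ L := Nat.lt_two_pow_self
  have hX : 2 ^ (2 * L + 14) = 16384 * (2 ^ L * 2 ^ L) := by ring
  have hpow : (2 ^ (2 * L + 14)) ^ (9 * K + 5) ≤ 2 ^ sizeBound L := by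
    rw [← pow_mul]
    refine Nat.pow_le_pow_right two_pos ?_
    unfold sizeBound
    gcongr
  have henergy : ∀ m < 3 * K, ∃ E : ℕ → ℕ,
      (∀ a b, b * (1000 * (n * (K * (m + 3)))) < a * (1000 * (n * (K * (m + 3))) - 1) →
        E b < E a) ∧ ∀ a ≤ (2 ^ (2 * L + 14)) ^ (3 * m + 4), E a ≤ searchBound L := by
    intro m hm
    have hQ : 1 ≤ 1000 * (n * (K * (m + 3))) :=
      Nat.mul_pos (by omega) (Nat.mul_pos hn (Nat.mul_pos hK (by omega)))
    obtain ⟨E, h1, h2⟩ := exists_energy hQ (s := 2 * L + 14) (e := 3 * m + 4)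
    refine ⟨E, h1, fun a ha => (h2 a ha).trans ?_⟩
    exact Nat.add_le_add_left (Nat.mul_le_mul (Nat.mul_le_mul_left _ <| Nat.mul_le_mul hnL <|
      Nat.mul_le_mul hKL (by omega)) (Nat.mul_le_mul_right _ (by omega))) 1
  generalize 2 ^ sizeBound L = B at *
  generalize 2 ^ (2 * L + 14) = X at *
  generalize 2 ^ L = W at *
  have hlarge : ∀ i < n, largest inp n K i ≤ W := fun i hi =>
    Finset.sup_le fun S hS => hinp S (Finset.mem_range.1 hS) i hi
  have hsum : ∀ f : ℕ → ℕ, (∀ i < n, f i ≤ W) → ∑ i ∈ Finset.range n, f i ≤ W * W :=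
    fun f hf => (Finset.sum_le_card_nsmul _ _ W fun i hi => hf i (Finset.mem_range.1 hi)).trans (by
      rw [Finset.card_range, smul_eq_mul]
      exact Nat.mul_le_mul_right _ (by omega))
  have htot := hsum _ hlarge
  generalize ∑ i ∈ Finset.range n, largest inp n K i = tot at *
  have hWW : 2 * W ≤ W * W := Nat.mul_le_mul_right _ (by omega)
  have hq : 1000 * (n * (K * (3 * K + 3))) ≤ X := by
    have h : n * K * (3 * K + 3) ≤ W * (3 * W) := Nat.mul_le_mul (by omega) (by omega)
    have e : W * (3 * W) = 3 * (W * W) := by ring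
    rw [← mul_assoc n]
    omega
  have hmcX : ∀ i < n, 200 * mc i ≤ X := fun i hi => by
    have := hlarge i hi
    rw [hmc i hi]
    omega
  have haddr : 8 * (3 + (n + n * K)) + 8 ≤ X := by omega
  exact ⟨⟨by omega, haddr, show n + 1 ≤ X by omega, show 3 * K + 5 ≤ X by omega,
    fun S hS i hi => (hinp S hS i hi).trans (by omega),
    fun S hS => (Nat.mul_le_mul_left 200 (hsum _ (hinp S hS))).trans (by omega)⟩,
    show 2 * (400 * tot + 2) + 1 ≤ X by omega, show tot + 1 ≤ X by omega, hq, hmcX, hp,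
    Nat.one_le_iff_ne_zero.1 hK, hpow, henergy⟩

end RAM

namespace SelectingItems

open RAM

variable {I : SelectingItems}

theorem bits_cost_le (S : Fin I.K) (i : Fin I.n) : bits (I.cost S i) ≤ I.inputLength := by
  have h1 := Finset.single_le_sum (f := fun i => bits (I.cost S i)) (fun _ _ => Nat.zero_le _)
    (Finset.mem_univ i)
  have h2 := Finset.single_le_sum (f := fun S => ∑ i, bits (I.cost S i)) (fun _ _ => Nat.zero_le _)
    (Finset.mem_univ S)
  unfold inputLength
  omega

/-- Every cost has at least one bit in the input. -/
theorem mul_le_inputLength : I.n * I.K ≤ I.inputLength := by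
  have h : ∑ _S : Fin I.K, ∑ _i : Fin I.n, 1 ≤ ∑ S, ∑ i, bits (I.cost S i) :=
    Finset.sum_le_sum fun S _ => Finset.sum_le_sum fun i _ => Nat.succ_le_succ (Nat.zero_le _)
  simp only [Finset.sum_const, Finset.card_univ, Fintype.card_fin, smul_eq_mul, mul_one] at h
  unfold inputLength
  rw [mul_comm]
  omega

theorem setup (hn : I.n ≠ 0) {mc : ℕ → ℕ}
    (hmc : ∀ i < I.n, mc i = largest I.inputWord I.n I.K i) :
    Setup (2 ^ sizeBound I.inputLength) (2 ^ (2 * I.inputLength + 14)) (searchBound I.inputLength)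
      { St.init I.inputWord with
        n := I.n, K := I.K, p := I.p, mc := mc,
        tot := ∑ i ∈ Finset.range I.n, largest I.inputWord I.n I.K i,
        lim := 400 * (∑ i ∈ Finset.range I.n, largest I.inputWord I.n I.K i) + 2 } :=
  setup_of_le mul_le_inputLength (Nat.one_le_iff_ne_zero.2 hn) I.K_pos I.p_le_n
    (fun S hS i hi => (inputWord_cost ⟨S, hS⟩ ⟨i, hi⟩).trans_le <|
      (lt_two_pow_bits _).le.trans (Nat.pow_le_pow_right two_pos (bits_cost_le _ _))) hmc

theorem steps_le (hn : I.n ≠ 0) :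
    (tLargest I.n I.K + (200 * (2 * I.inputLength + 14) + 1) *
      (tSizes I.n I.K (searchBound I.inputLength) + 30) + (I.n + 1) * 40 + 150) *
      (6 * bits (2 ^ sizeBound I.inputLength)) ≤ timeBound I.inputLength := by
  have hnK := I.mul_le_inputLength
  have hKL : I.K ≤ I.inputLength :=
    le_trans (Nat.le_mul_of_pos_left _ (Nat.pos_of_ne_zero hn)) hnK
  have hnL : I.n ≤ I.inputLength := le_trans (Nat.le_mul_of_pos_right _ I.K_pos) hnK
  rw [bits_two_pow]
  unfold timeBound tLargest tSizes tGuess tInit tPot tSweep tTry tMax tPot tLoad tTerm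
  gcongr

/-- The program selects a `p`-set that satisfies the bound, in polynomial time. -/
theorem select_correct (I : SelectingItems) {C : ℝ}
    (hC : IsLeast {C : ℝ | 0 ≤ C ∧ I.LPFeasible C} C) :
    ∃ (M : Memory) (t : ℕ), Exec selectProg I.inputMemory M t ∧ t ≤ timeBound I.inputLength ∧
      (I.outputSet M).card = I.p ∧
      ∀ S, (I.totalCost (I.outputSet M) S : ℝ) ≤ C * roundingRatio I.K := by
  have hρ := one_add_exp_le_roundingRatio I.K_pos
  have hρ0 : 0 < roundingRatio I.K := by linarith [Real.exp_pos 1]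
  rcases eq_or_ne I.n 0 with hn | hn
  · have hB : 2 ^ 14 ≤ 2 ^ sizeBound I.inputLength :=
      Nat.pow_le_pow_right two_pos (fourteen_le_sizeBound _)
    have hL : 2 ^ I.inputLength ≤ 2 ^ sizeBound I.inputLength :=
      Nat.pow_le_pow_right two_pos (le_sizeBound _)
    have hK : I.K ≤ 2 ^ sizeBound I.inputLength := by
      refine (lt_two_pow_bits _).le.trans ((Nat.pow_le_pow_right two_pos ?_).trans hL)
      unfold inputLength
      omega
    have hp : I.p = 0 := by have := I.p_le_n; omega
    obtain ⟨σ, hd⟩ := select_does_zero (inp := I.inputWord)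
      (le_trans (by norm_num) hB) (inputWord_zero.trans hn)
      (inputWord_one.trans_le hK) (by rw [inputWord_two, hp]; exact Nat.zero_le _)
    obtain ⟨M, t, hM, ht, -⟩ := hd _ I.rep_inputMemory
    have he : I.outputSet M = ∅ := by
      have : IsEmpty (Fin I.n) := by rw [hn]; infer_instance
      exact Finset.eq_empty_of_isEmpty _
    refine ⟨M, t, hM, ht.trans ?_, by rw [he, hp, Finset.card_empty], fun S => ?_⟩
    · rw [bits_two_pow, timeBound]
      exact Nat.mul_le_mul_right _ (by omega)
    · rw [he, totalCost, Finset.sum_empty, Nat.cast_zero]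
      exact mul_nonneg hC.1.1 hρ0.le
  · have hJ : 400 * (∑ i ∈ Finset.range I.n, largest I.inputWord I.n I.K i) + 2 ≤
        guess (200 * (2 * I.inputLength + 14)) := by
      refine le_trans ?_ (two_pow_le_guess _)
      have := (setup hn fun _ _ => rfl).lim_le
      dsimp only at this
      omega
    obtain ⟨σ, y, best, hd, h1, h2, h3, h4⟩ := select_does inputWord_zero inputWord_one
      inputWord_two hn rfl (fun mc hmc => setup hn hmc) hJ
    obtain ⟨hb1, hb2⟩ := best_le hC hn rfl h4
    obtain ⟨hcard, hload⟩ := h3 hb1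
    obtain ⟨M, t, hM, ht, -, hrep⟩ := hd _ I.rep_inputMemory
    have hout : ∀ f : Fin I.n → ℕ, ∑ i ∈ I.outputSet M, f i = ∑ i : Fin I.n, y i * f i := by
      intro f
      rw [outputSet, Finset.sum_filter]
      refine Finset.sum_congr rfl fun i _ => ?_
      have e : M (2 * i) = y i := (hrep .inp i).trans (h1 i i.2)
      rw [e]
      rcases Nat.le_one_iff_eq_zero_or_eq_one.1 (h2 i i.2) with h | h <;> simp [h]
    refine ⟨M, t, hM, ht.trans (steps_le hn), ?_, fun S => ?_⟩
    · rw [Finset.card_eq_sum_ones, hout, ← hcard, Finset.sum_range]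
      simp
    · refine le_trans ?_ hb2
      rw [totalCost, hout, ← loadOf_eq]
      exact_mod_cast hload S S.2

end SelectingItems

/-- A single deterministic program `A` with polynomially bounded running time outputs, on every
instance, a `p`-set whose cost in every scenario is at most
`C * (1 + e ln(2K) / ln(e ln(2K)))`, where `C`, the smallest value for which `LP_C` is feasible,
is at most the optimum; this is an `O(log K / log log K)` approximation. -/
theorem mainTheorem1 :
    (roundingRatio =O[atTop] fun K : ℕ => Real.log K / Real.log (Real.log K)) ∧
    ∃ (A : RAM.Program) (q : Polynomial ℕ), ∀ I : SelectingItems,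
      ∃ (M : RAM.Memory) (t : ℕ),
        RAM.Exec A I.inputMemory M t ∧
        t ≤ q.eval I.inputLength ∧
        (I.outputSet M).card = I.p ∧
        (∃ C : ℝ, IsLeast {C : ℝ | 0 ≤ C ∧ I.LPFeasible C} C ∧
          (∀ Q : Finset (Fin I.n), Q.card = I.p → C ≤ (I.maxCost Q : ℝ)) ∧
          ∀ S, (I.totalCost (I.outputSet M) S : ℝ) ≤ C * roundingRatio I.K) ∧
        ∀ Q : Finset (Fin I.n), Q.card = I.p →
          (I.maxCost (I.outputSet M) : ℝ) ≤ roundingRatio I.K * (I.maxCost Q : ℝ) := by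
  refine ⟨RAM.roundingRatio_isBigO, RAM.selectProg, ?_⟩
  obtain ⟨q, hq⟩ := RAM.isPoly_timeBound
  refine ⟨q, fun I => ?_⟩
  obtain ⟨C, hC⟩ := I.exists_isLeast
  obtain ⟨M, t, hM, ht, hcard, hcost⟩ := I.select_correct hC
  have hle : ∀ Q : Finset (Fin I.n), Q.card = I.p → C ≤ (I.maxCost Q : ℝ) := fun Q hQ =>
    hC.2 ⟨Nat.cast_nonneg _, SelectingItems.lpFeasible_maxCost hQ⟩
  refine ⟨M, t, hM, ht.trans_eq (hq _).symm, hcard, ⟨C, hC, hle, hcost⟩, fun Q hQ => ?_⟩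
  have hρ := RAM.one_add_exp_le_roundingRatio I.K_pos
  obtain ⟨S, -, hS⟩ := Finset.exists_mem_eq_sup (Finset.univ : Finset (Fin I.K))
    ⟨⟨0, I.K_pos⟩, Finset.mem_univ _⟩ fun S => I.totalCost (I.outputSet M) S
  rw [SelectingItems.maxCost, hS, mul_comm]
  exact (hcost S).trans (mul_le_mul_of_nonneg_right (hle Q hQ) (by linarith [Real.exp_pos 1]))
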